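/- Let $X=(X_t)_{t\ge 0}$ be a pure-jump subordinator on a probability space, i.e. a Lévy process started at $0$ with nondecreasing right-continuous paths and no drift, so that $\mathsf{E}e^{-uX_t}=e^{-t\Psi(u)}$ with $\Psi(u)=\int_{(0,\infty)}(1-e^{-uz})\,\nu(\mathrm{d}z)$ for $u\ge 0$, where the Lévy measure $\nu$ on $(0,\infty)$ satisfies $\int_{(0,\infty)}\min(1,z)\,\nu(\mathrm{d}z)<\infty$. Assume $\nu\neq 0$. For a process $Y$ put $I_{[Y]}=\int_0^\infty e^{-Y_t}\,\mathrm{d}t$. For $\epsilon\in(0,1)$ and a Poisson random measure $M$ on $[0,\infty)\times(0,\infty)$ with intensity $\mathrm{d}t\otimes\nu(\mathrm{d}z)$ (such as the one for which $X_t=\int_{(0,\infty)}z\,M([0,t],\mathrm{d}z)$), let $$X^{(\epsilon)}_t=\int_{[\epsilon,\infty)}\epsilon\Big\lfloor\frac{z}{\epsilon}\Big\rfloor M([0,t],\mathrm{d}z),\qquad t\ge0 .$$ Put $\upsilon_{\epsilon,k}=\nu\big([\epsilon k,\epsilon(k+1))\big)$ and $\Lambda_\epsilon=\sum_{k=1}^\infty\upsilon_{\epsilon,k}=\nu([\epsilon,\infty))$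 and, when $\Lambda_\epsilon>0$, $$c_{\epsilon,0}=1,\qquad c_{\epsilon,j}=\frac{1}{(1-e^{\epsilon j})\,\Lambda_\epsilon}\sum_{k=1}^{j}e^{\epsilon k}c_{\epsilon,j-k}\,\upsilon_{\epsilon,k},\quad j\ge1 .$$ Then the law of $I_{[X]}$ has a density $\phi_{[X]}$ that is continuous on $(0,\infty)$. For every $\epsilon\in(0,1)$ with $\Lambda_\epsilon>0$ (hence for all sufficiently small $\epsilon$), the series below converge absolutely, the series in the denominator is nonzero, and the law of $I_{[X^{(\epsilon)}]}$ has the density, continuous on $(0,\infty)$, $$\phi_{[X^{(\epsilon)}]}(x)=\frac{\Lambda_\epsilon}{\sum_{j=0}^\infty c_{\epsilon,j}e^{-\epsilon j}}\sum_{j=0}^\infty c_{\epsilon,j}\exp\big(-e^{\epsilon j}x\,\Lambda_\epsilon\big),\qquad x>0 .$$ Moreover, for every $x>0$, $$\phi_{[X^{(\epsilon)}]}(x)\longrightarrow\phi_{[X]}(x)\qquad\text{as }\epsilon\searrow0 .$$ -/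

import Mathlib

open MeasureTheory ProbabilityTheory Set Filter Topology
open scoped NNReal ENNReal

noncomputable section

/-- `ν` is the Lévy measure of a subordinator: a measure carried by `(0, ∞)` with
`∫ min (1, z) ν(dz) < ∞`. -/
structure IsSubordinatorLevyMeasure (ν : Measure ℝ) : Prop where
  supp : ν (Iic 0) = 0
  lintegral_lt_top : ∫⁻ z, ENNReal.ofReal (min 1 z) ∂ν < ∞

/-- The Laplace exponent `Ψ(u) = ∫_{(0, ∞)} (1 - e^{-u z}) ν(dz)` of a subordinator without drift. -/
def laplaceExponent (ν : Measure ℝ) (u : ℝ) : ℝ :=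
  ∫ z in Ioi (0 : ℝ), (1 - Real.exp (-u * z)) ∂ν

/-- `X` is a pure-jump (that is, driftless) subordinator with Lévy measure `ν` under `P`: a Lévy
process started at `0` with nondecreasing right-continuous paths whose Laplace transforms are
given by the Lévy-Khintchine formula with drift `0`. -/
structure IsPureJumpSubordinator {Ω : Type*} [MeasurableSpace Ω] (P : Measure Ω)
    (ν : Measure ℝ) (X : ℝ≥0 → Ω → ℝ) : Prop where
  levyMeasure : IsSubordinatorLevyMeasure ν
  measurable : ∀ t, Measurable (X t)
  zero : ∀ᵐ ω ∂P, X 0 ω = 0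
  paths : ∀ᵐ ω ∂P, Monotone (fun t => X t ω) ∧
    ∀ t, ContinuousWithinAt (fun s => X s ω) (Ici t) t
  indep : HasIndepIncrements X P
  stationary : ∀ s t, IdentDistrib (fun ω => X (s + t) ω - X s ω) (X t) P P
  laplace : ∀ (t : ℝ≥0) (u : ℝ), 0 ≤ u →
    ∫ ω, Real.exp (-u * X t ω) ∂P = Real.exp (-(t : ℝ) * laplaceExponent ν u)

/-- `M` is a Poisson random measure with (sigma-finite) intensity measure `μ` under `P`. -/
structure IsPoissonRandomMeasure {Ω S : Type*} [MeasurableSpace Ω] [MeasurableSpace S]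
    (P : Measure Ω) (μ : Measure S) (M : Ω → Measure S) : Prop where
  measurable : Measurable M
  law : ∀ A, MeasurableSet A → μ A ≠ ∞ →
    P.map (fun ω => M ω A) = (poissonMeasure (μ A).toNNReal).map (fun n : ℕ => (n : ℝ≥0∞))
  indep : ∀ (n : ℕ) (A : Fin n → Set S), (∀ i, MeasurableSet (A i)) →
    Pairwise (fun i j => Disjoint (A i) (A j)) → iIndepFun (fun i ω => M ω (A i)) P

/-- The intensity `dt ⊗ ν(dz)` on `[0, ∞) × (0, ∞)`, as a measure on the plane. -/
def jumpIntensity (ν : Measure ℝ) : Measure (ℝ × ℝ) :=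
  (volume.restrict (Ici 0)).prod (ν.restrict (Ioi 0))

/-- The discretised process `X^{(ε)}_t = ∫_{[ε, ∞)} ε ⌊z / ε⌋ M([0, t], dz)`. -/
def discretisedProcess {Ω : Type*} (M : Ω → Measure (ℝ × ℝ)) (ε : ℝ) (t : ℝ≥0) (ω : Ω) : ℝ :=
  (∫⁻ p in Icc (0 : ℝ) t ×ˢ Ici ε, ENNReal.ofReal (ε * (⌊p.2 / ε⌋ : ℤ)) ∂(M ω)).toReal

/-- The exponential functional `I_{[Y]} = ∫_0^∞ e^{-Y_t} dt`, with values in `[0, ∞]`. -/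
def expFunctional {Ω : Type*} (Y : ℝ≥0 → Ω → ℝ) (ω : Ω) : ℝ≥0∞ :=
  ∫⁻ t in Ici (0 : ℝ), ENNReal.ofReal (Real.exp (-(Y t.toNNReal ω)))

/-- `φ` is the continuous version on `(0, ∞)` of the density of the `[0, ∞]`-valued random
variable `I`; for probability measures `P` this includes that `I` is a.s. finite and positive. -/
structure IsContinuousDensity {Ω : Type*} [MeasurableSpace Ω] (P : Measure Ω) (I : Ω → ℝ≥0∞)
    (φ : ℝ → ℝ) : Prop where
  aemeasurable : AEMeasurable I P
  continuousOn : ContinuousOn φ (Ioi 0)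
  nonneg : ∀ x, 0 < x → 0 ≤ φ x
  law : P.map I = ((volume.restrict (Ioi (0 : ℝ))).withDensity
    (fun x => ENNReal.ofReal (φ x))).map ENNReal.ofReal

/-- `υ_{ε,k} = ν([ε k, ε (k + 1)))`. -/
def binMass (ν : Measure ℝ) (ε : ℝ) (k : ℕ) : ℝ :=
  (ν (Ico (ε * k) (ε * (k + 1)))).toReal

/-- `∑_{k ≥ 1} υ_{ε,k}`. -/
def totalBinMass (ν : Measure ℝ) (ε : ℝ) : ℝ := ∑' k : ℕ, binMass ν ε (k + 1)

/-- The coefficients `c_{ε,j}`; see `dirichletCoeff_of_pos` for the recurrence in usual form. -/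
def dirichletCoeff (ν : Measure ℝ) (ε : ℝ) : ℕ → ℝ
  | 0 => 1
  | j + 1 => 1 / ((1 - Real.exp (ε * ((j : ℝ) + 1))) * totalBinMass ν ε) *
      ∑ k : Fin (j + 1), Real.exp (ε * ((k : ℝ) + 1)) * dirichletCoeff ν ε (j - k) *
        binMass ν ε (k + 1)

theorem dirichletCoeff_zero (ν : Measure ℝ) (ε : ℝ) : dirichletCoeff ν ε 0 = 1 := by
  rw [dirichletCoeff]

theorem dirichletCoeff_of_pos (ν : Measure ℝ) (ε : ℝ) (j : ℕ) (hj : 1 ≤ j) :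
    dirichletCoeff ν ε j = 1 / ((1 - Real.exp (ε * j)) * totalBinMass ν ε) *
      ∑ k ∈ Finset.Icc 1 j, Real.exp (ε * k) * dirichletCoeff ν ε (j - k) * binMass ν ε k := by
  obtain ⟨j, rfl⟩ := Nat.exists_eq_add_of_le' hj
  rw [dirichletCoeff, Fin.sum_univ_eq_sum_range
    (fun k => Real.exp (ε * ((k : ℝ) + 1)) * dirichletCoeff ν ε (j - k) * binMass ν ε (k + 1)),
    Finset.range_eq_Ico, ← Finset.Ico_add_one_right_eq_Icc,
    ← Finset.sum_Ico_add' (fun k : ℕ => Real.exp (ε * k) * dirichletCoeff ν ε (j + 1 - k) *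
      binMass ν ε k) 0 (j + 1) 1]
  simp

/-- The explicit function `φ_{[X^{(ε)}]}(x) = (Λ / ∑_j c_{ε,j} e^{-ε j}) *
∑_j c_{ε,j} exp (- e^{ε j} x Λ)`, where `Λ = ∑_{k ≥ 1} υ_{ε,k}`. -/
def dirichletDensity (ν : Measure ℝ) (ε x : ℝ) : ℝ :=
  totalBinMass ν ε / (∑' j : ℕ, dirichletCoeff ν ε j * Real.exp (-ε * j)) *
    ∑' j : ℕ, dirichletCoeff ν ε j * Real.exp (-Real.exp (ε * j) * x * totalBinMass ν ε)

end

/-! Everything is driven by two descriptions of the law of the exponential functional: its moments,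
and a stationarity equation for its density.

Independence and stationarity of increments give E I^n = n! / (Ψ(1) ⋯ Ψ(n))
(`hasMoments_of_hasSubordinatorPaths`). Since Ψ is increasing, these moments are at most n!
Ψ(1)^{-n}, so they determine the law, and convergence of moments under a common such bound gives
weak convergence (`tendsto_charFun_of_tendsto_moments`, `HasMoments.unique`).

For the discretised process put q = e^{-ε}. The recurrence for the coefficients makes them
absolutely summable (`DirichletSystem.summable_abs`), and one generating identity,
`DirichletSystem.tsum_mul_one_sub`, has two consequences. Tested on powers of q, it gives the moment
recursion `DirichletSystem.mul_powSum`, so the normalised series has the moments of the exponential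
functional. Tested on the exponentials, it gives `DirichletSystem.hasSum_functional_equation`, an
equation expressing the value at x through integrals to the right of x; this forces positivity
(`DirichletSystem.series_pos`). The normalised series is thus a probability density, and by
determinacy it is the density sought.

For the limit ε → 0 the functional equation is read as φ(x) = ∫ μ((x, x e^{r(z)}]) ν(dz), where μ is
the law with density φ and r rounds down to multiples of ε (`jumpAverage`). A bootstrap in this
equation bounds φ on bounded sets uniformly in ε (`IsSubordinatorLevyMeasure.exists_density_bound`).
That bound passes to the weak limit μ, makes it atomless, and dominates the integrand, so the
densities converge pointwise to ∫ μ((x, x e^z]) ν(dz) (`tendsto_dirichletDensity_seq`). Integrating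
this convergence over intervals shows that the limit function is a density of μ; its continuity
comes from the local Lipschitz property of the distribution function. -/

/-! ### The method of moments under factorial bounds. -/

/-- `μ` is a probability measure on `[0, ∞)` with moment sequence `m`. -/
structure HasMoments (μ : Measure ℝ) (m : ℕ → ℝ) : Prop where
  isProb : IsProbabilityMeasure μ
  supp : ∀ᵐ x ∂μ, 0 ≤ x
  nonneg : ∀ n, 0 ≤ m n
  moment : ∀ n, ∫⁻ x, ENNReal.ofReal (x ^ n) ∂μ = ENNReal.ofReal (m n)

namespace HasMoments

variable {μ : Measure ℝ} {m : ℕ → ℝ}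

theorem integrable_pow (h : HasMoments μ m) (n : ℕ) : Integrable (fun x : ℝ => x ^ n) μ := by
  refine ⟨by fun_prop, ?_⟩
  rw [hasFiniteIntegral_iff_ofReal (by filter_upwards [h.supp] with x hx using by positivity),
    h.moment]
  exact ENNReal.ofReal_lt_top

theorem integral_pow (h : HasMoments μ m) (n : ℕ) : ∫ x, x ^ n ∂μ = m n := by
  rw [integral_eq_lintegral_of_nonneg_ae
    (by filter_upwards [h.supp] with x hx using by positivity) (by fun_prop), h.moment,
    ENNReal.toReal_ofReal (h.nonneg n)]

theorem integral_norm_pow (h : HasMoments μ m) (n : ℕ) : ∫ x, ‖x ^ n‖ ∂μ = m n := by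
  rw [← h.integral_pow n]
  refine integral_congr_ae ?_
  filter_upwards [h.supp] with x hx
  rw [Real.norm_of_nonneg (by positivity)]

end HasMoments

/-- The moments of `μ` tilted by the character `x ↦ e^{itx}`. -/
noncomputable def charMoment (μ : Measure ℝ) (n : ℕ) (t : ℝ) : ℂ :=
  ∫ x, (x : ℂ) ^ n * Complex.exp (t * x * Complex.I) ∂μ

theorem charMoment_zero_left (μ : Measure ℝ) (t : ℝ) : charMoment μ 0 t = charFun μ t := by
  simp [charMoment, charFun_apply_real]

theorem HasMoments.charMoment_zero_right {μ : Measure ℝ} {m : ℕ → ℝ} (h : HasMoments μ m)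
    (n : ℕ) : charMoment μ n 0 = m n := by
  simp only [charMoment, Complex.ofReal_zero, zero_mul, Complex.exp_zero, mul_one]
  rw [← h.integral_pow n, ← integral_complex_ofReal]
  simp

theorem norm_exp_mul_mul_I (t x : ℝ) : ‖Complex.exp (t * x * Complex.I)‖ = 1 := by
  rw [← Complex.ofReal_mul, Complex.norm_exp_ofReal_mul_I]

theorem HasMoments.norm_charMoment_le {μ : Measure ℝ} {m : ℕ → ℝ} (h : HasMoments μ m)
    (n : ℕ) (t : ℝ) : ‖charMoment μ n t‖ ≤ m n := by
  refine (norm_integral_le_integral_norm _).trans_eq ?_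
  rw [← h.integral_norm_pow n]
  refine integral_congr_ae (Eventually.of_forall fun x => ?_)
  simp only [norm_mul, norm_exp_mul_mul_I, mul_one, norm_pow, Complex.norm_real]

/-- As (n + k)! / k! = n! · C(n + k, n), this is a multiple of the negative binomial series in s b.
-/
theorem summable_factorial_bound {b s : ℝ} (hb : 0 ≤ b) (hs : 0 ≤ s) (hbs : s * b < 1) (n : ℕ) :
    Summable (fun k : ℕ => s ^ k / k.factorial * ((n + k).factorial * b ^ (n + k))) := by
  have h := (summable_choose_mul_geometric_of_norm_lt_one (R := ℝ) n (r := s * b)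
    (by rw [Real.norm_of_nonneg (by positivity)]; exact hbs)).mul_left (n.factorial * b ^ n)
  refine h.congr fun k => ?_
  have h1 : ((k + n).choose n : ℝ) * n.factorial * k.factorial = (k + n).factorial := by
    have := Nat.choose_mul_factorial_mul_factorial (Nat.le_add_left n k)
    rw [Nat.add_sub_cancel] at this
    exact_mod_cast this
  rw [add_comm n k, ← h1, mul_pow, pow_add]
  field_simp

/-- Expand e^{isx} and integrate term by term. The radius 1/b is the same around every t, which
allows continuation along the whole line. -/
theorem HasMoments.hasSum_charMoment {μ : Measure ℝ} {m : ℕ → ℝ} (h : HasMoments μ m) {b : ℝ}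
    (hb : 0 ≤ b) (hm : ∀ n, m n ≤ n.factorial * b ^ n) (n : ℕ) (t s : ℝ) (hs : |s| * b < 1) :
    HasSum (fun k : ℕ => ((s : ℂ) * Complex.I) ^ k / k.factorial * charMoment μ (n + k) t)
      (charMoment μ n (t + s)) := by
  have := h.isProb
  have key := hasSum_integral_of_summable_integral_norm (E := ℂ) (ι := ℕ) (μ := μ)
    (F := fun (k : ℕ) (x : ℝ) => ((s : ℂ) * Complex.I) ^ k / k.factorial *
      ((x : ℂ) ^ (n + k) * Complex.exp (t * x * Complex.I))) (fun k => ?_) ?_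
  · simp only [integral_const_mul] at key
    have e : charMoment μ n (t + s) = ∫ x, ∑' k : ℕ, ((s : ℂ) * Complex.I) ^ k / k.factorial *
      ((x : ℂ) ^ (n + k) * Complex.exp (t * x * Complex.I)) ∂μ := ?_
    · rw [e]
      exact key
    refine integral_congr_ae (Eventually.of_forall fun x => ?_)
    have hexp : HasSum (fun k : ℕ => ((s * x * Complex.I : ℂ)) ^ k / k.factorial)
        (Complex.exp (s * x * Complex.I)) := by
      rw [Complex.exp_eq_exp_ℂ]
      exact NormedSpace.expSeries_div_hasSum_exp _
    have h2 := hexp.mul_left ((x : ℂ) ^ n * Complex.exp (t * x * Complex.I))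
    dsimp only
    rw [Complex.ofReal_add, add_mul, add_mul, Complex.exp_add, ← mul_assoc, ← h2.tsum_eq]
    refine tsum_congr fun k => ?_
    rw [pow_add, mul_pow, mul_pow, mul_pow]
    ring
  · refine Integrable.const_mul ?_ _
    refine ((h.integrable_pow (n + k)).norm).mono' (by fun_prop) (Eventually.of_forall fun x => ?_)
    simp only [norm_mul, norm_exp_mul_mul_I, mul_one, norm_pow, Complex.norm_real, le_refl]
  · refine Summable.of_nonneg_of_le (fun k => by positivity) (fun k => ?_)
      (summable_factorial_bound hb (abs_nonneg s) hs n)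
    simp only [norm_mul, norm_exp_mul_mul_I, mul_one, norm_pow, Complex.norm_real, norm_div,
      Complex.norm_I, Complex.norm_natCast, Real.norm_eq_abs]
    rw [integral_const_mul]
    have h3 := h.integral_norm_pow (n + k)
    simp only [norm_pow, Real.norm_eq_abs] at h3
    rw [h3]
    gcongr
    exact hm _

/-- The Taylor coefficients at t are again tilted moments, of all orders. Convergence at t must
therefore be assumed for every order, and it is then recovered for every order at t + s by
domination uniform in i. -/
theorem tendsto_charMoment_step {μ : ℕ → Measure ℝ} {m : ℕ → ℕ → ℝ} {μ₀ : Measure ℝ} {m₀ : ℕ → ℝ}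
    (h : ∀ i, HasMoments (μ i) (m i)) (h₀ : HasMoments μ₀ m₀) {b : ℝ} (hb : 0 ≤ b)
    (hm : ∀ i n, m i n ≤ n.factorial * b ^ n) (hm₀ : ∀ n, m₀ n ≤ n.factorial * b ^ n) (t s : ℝ)
    (hs : |s| * b < 1)
    (ht : ∀ n, Tendsto (fun i => charMoment (μ i) n t) atTop (𝓝 (charMoment μ₀ n t))) (n : ℕ) :
    Tendsto (fun i => charMoment (μ i) n (t + s)) atTop (𝓝 (charMoment μ₀ n (t + s))) := by
  rw [← (h₀.hasSum_charMoment hb hm₀ n t s hs).tsum_eq]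
  simp_rw [fun i => ((h i).hasSum_charMoment hb (hm i) n t s hs).tsum_eq.symm]
  refine tendsto_tsum_of_dominated_convergence
    (summable_factorial_bound hb (abs_nonneg s) hs n) (fun k => (ht (n + k)).const_mul _)
    (Eventually.of_forall fun i k => ?_)
  simp only [norm_mul, norm_pow, Complex.norm_real, norm_div,
      Complex.norm_I, Complex.norm_natCast, Real.norm_eq_abs, mul_one]
  gcongr
  exact ((h i).norm_charMoment_le _ _).trans (hm i _)

/-- At 0 the tilted moments are the moments themselves; the point t is reached from 0 in N equal
steps, each shorter than the Taylor radius. -/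
theorem tendsto_charFun_of_tendsto_moments {μ : ℕ → Measure ℝ} {m : ℕ → ℕ → ℝ} {μ₀ : Measure ℝ}
    {m₀ : ℕ → ℝ} (h : ∀ i, HasMoments (μ i) (m i)) (h₀ : HasMoments μ₀ m₀) {b : ℝ} (hb : 0 ≤ b)
    (hm : ∀ i n, m i n ≤ n.factorial * b ^ n) (hm₀ : ∀ n, m₀ n ≤ n.factorial * b ^ n)
    (hlim : ∀ n, Tendsto (fun i => m i n) atTop (𝓝 (m₀ n))) (t : ℝ) :
    Tendsto (fun i => charFun (μ i) t) atTop (𝓝 (charFun μ₀ t)) := by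
  simp_rw [← charMoment_zero_left]
  obtain ⟨N, hN⟩ := exists_nat_gt (|t| * b)
  have hN0 : (0 : ℝ) < N := lt_of_le_of_lt (by positivity) hN
  have hs : |t / N| * b < 1 := by
    rw [abs_div, Nat.abs_cast, div_mul_eq_mul_div, div_lt_one hN0]
    exact hN
  have key : ∀ k n : ℕ, Tendsto (fun i => charMoment (μ i) n (k * (t / N))) atTop
      (𝓝 (charMoment μ₀ n (k * (t / N)))) := by
    intro k
    induction k with
    | zero =>
      intro n
      simp only [Nat.cast_zero, zero_mul, h₀.charMoment_zero_right,
        fun i => (h i).charMoment_zero_right n]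
      exact (Complex.continuous_ofReal.tendsto _).comp (hlim n)
    | succ k ih =>
      intro n
      have := tendsto_charMoment_step h h₀ hb hm hm₀ (k * (t / N)) (t / N) hs ih n
      rwa [← add_one_mul, ← Nat.cast_succ] at this
  have := key N 0
  rwa [mul_div_cancel₀ _ hN0.ne'] at this

theorem HasMoments.unique {μ μ' : Measure ℝ} {m : ℕ → ℝ} (h : HasMoments μ m)
    (h' : HasMoments μ' m) {b : ℝ} (hb : 0 ≤ b) (hm : ∀ n, m n ≤ n.factorial * b ^ n) :
    μ = μ' := by
  have := h.isProb
  have := h'.isProb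
  refine Measure.ext_of_charFun (funext fun t => ?_)
  exact tendsto_nhds_unique tendsto_const_nhds
    (tendsto_charFun_of_tendsto_moments (fun _ => h) h' hb (fun _ => hm) hm
      (fun _ => tendsto_const_nhds) t)

/-- Convergence of moments implies convergence of the measures of sets with null frontier. -/
theorem tendsto_measure_of_tendsto_moments {μ : ℕ → Measure ℝ} {m : ℕ → ℕ → ℝ} {μ₀ : Measure ℝ}
    {m₀ : ℕ → ℝ} (h : ∀ i, HasMoments (μ i) (m i)) (h₀ : HasMoments μ₀ m₀) {b : ℝ} (hb : 0 ≤ b)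
    (hm : ∀ i n, m i n ≤ n.factorial * b ^ n) (hm₀ : ∀ n, m₀ n ≤ n.factorial * b ^ n)
    (hlim : ∀ n, Tendsto (fun i => m i n) atTop (𝓝 (m₀ n))) :
    ∃ (ν : ℕ → ProbabilityMeasure ℝ) (ν₀ : ProbabilityMeasure ℝ), (∀ i, (ν i : Measure ℝ) = μ i) ∧
      (ν₀ : Measure ℝ) = μ₀ ∧ Tendsto ν atTop (𝓝 ν₀) := by
  refine ⟨fun i => ⟨μ i, (h i).isProb⟩, ⟨μ₀, h₀.isProb⟩, fun i => rfl, rfl, ?_⟩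
  exact ProbabilityMeasure.tendsto_of_tendsto_charFun
    (tendsto_charFun_of_tendsto_moments h h₀ hb hm hm₀ hlim)

/-! ### Moments of the exponential functional of a process with subordinator paths. -/

/-- A process all of whose paths start at `0`, are nondecreasing and right-continuous. -/
structure HasSubordinatorPaths {Ω : Type*} [MeasurableSpace Ω] (X : ℝ≥0 → Ω → ℝ) : Prop where
  measurable : ∀ t, Measurable (X t)
  zero : ∀ ω, X 0 ω = 0
  mono : ∀ ω, Monotone (fun t => X t ω)
  rightCont : ∀ ω t, ContinuousWithinAt (fun s => X s ω) (Ici t) t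

theorem HasSubordinatorPaths.nonneg {Ω : Type*} [MeasurableSpace Ω] {X : ℝ≥0 → Ω → ℝ}
    (h : HasSubordinatorPaths X) (t : ℝ≥0)
    (ω : Ω) : 0 ≤ X t ω := by
  rw [← h.zero ω]
  exact h.mono ω (zero_le)

/-- Time is approximated from the right by grid points. The `+ 1` after the floor keeps each
approximant at or beyond the given time, so right-continuity suffices. -/
theorem HasSubordinatorPaths.measurable_uncurry {Ω : Type*} [MeasurableSpace Ω] {X : ℝ≥0 → Ω → ℝ}
    (h : HasSubordinatorPaths X) :
    Measurable (fun p : ℝ≥0 × Ω => X p.1 p.2) := by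
  refine measurable_of_tendsto_metrizable
    (f := fun (n : ℕ) (p : ℝ≥0 × Ω) => X ((⌊((n : ℝ≥0) + 1) * p.1⌋₊ + 1) / ((n : ℝ≥0) + 1)) p.2)
    (fun n => ?_) (tendsto_pi_nhds.2 fun p => ?_)
  · have h1 : Measurable (fun q : ℕ × Ω => X (((q.1 : ℝ≥0) + 1) / ((n : ℝ≥0) + 1)) q.2) :=
      measurable_from_prod_countable_right fun k =>
        h.measurable (((k : ℝ≥0) + 1) / ((n : ℝ≥0) + 1))
    have h2 : Measurable (fun p : ℝ≥0 × Ω => (⌊((n : ℝ≥0) + 1) * p.1⌋₊, p.2)) :=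
      (Nat.measurable_floor.comp (measurable_fst.const_mul _)).prodMk measurable_snd
    have h3 := h1.comp h2
    simp only [Function.comp_def] at h3
    exact h3
  · have hle : ∀ n : ℕ, p.1 ≤ (⌊((n : ℝ≥0) + 1) * p.1⌋₊ + 1) / ((n : ℝ≥0) + 1) := fun n => by
      rw [le_div_iff₀ (by positivity), mul_comm]
      exact (Nat.lt_floor_add_one _).le
    have hub : ∀ n : ℕ, (⌊((n : ℝ≥0) + 1) * p.1⌋₊ + 1) / ((n : ℝ≥0) + 1) ≤
        p.1 + 1 / ((n : ℝ≥0) + 1) := fun n => by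
      rw [add_div]
      gcongr
      rw [div_le_iff₀ (by positivity), mul_comm]
      exact Nat.floor_le (zero_le)
    have hlim : Tendsto (fun n : ℕ => ((⌊((n : ℝ≥0) + 1) * p.1⌋₊ : ℝ≥0) + 1) / ((n : ℝ≥0) + 1))
        atTop (𝓝 p.1) := by
      refine tendsto_of_tendsto_of_tendsto_of_le_of_le tendsto_const_nhds ?_ hle hub
      simpa using (tendsto_one_div_add_atTop_nhds_zero_nat (𝕜 := ℝ≥0)).const_add p.1
    exact (h.rightCont p.2 p.1).tendsto.comp
      (tendsto_nhdsWithin_iff.2 ⟨hlim, Eventually.of_forall hle⟩)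

/-- `Z` is a measurable function of finitely many increments of `X` over `[0, t]`. -/
def IsPastFunctional {Ω : Type*} (X : ℝ≥0 → Ω → ℝ) (t : ℝ≥0) (Z : Ω → ℝ≥0∞) : Prop :=
  ∃ (τ : ℕ → ℝ≥0) (m : ℕ) (G : (Finset.range m → ℝ) → ℝ≥0∞), Monotone τ ∧ τ 0 = 0 ∧ τ m = t ∧
    Measurable G ∧ Z = fun ω => G (fun i => X (τ (i + 1)) ω - X (τ i) ω)

theorem isPastFunctional_one {Ω : Type*} (X : ℝ≥0 → Ω → ℝ) : IsPastFunctional X 0 (fun _ => 1) :=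
  ⟨fun _ => 0, 0, fun _ => 1, monotone_const, rfl, rfl, measurable_const, rfl⟩

theorem IsPastFunctional.measurable {Ω : Type*} [MeasurableSpace Ω] {X : ℝ≥0 → Ω → ℝ}
    (hX : ∀ t, Measurable (X t)) {t : ℝ≥0}
    {Z : Ω → ℝ≥0∞} (hZ : IsPastFunctional X t Z) : Measurable Z := by
  obtain ⟨τ, m, G, -, -, -, hG, rfl⟩ := hZ
  exact hG.comp (measurable_pi_lambda _ fun i => (hX _).sub (hX _))

/-- Any past functional at time `t ≤ r` uses a time grid whose next point is `r`. -/
theorem IsPastFunctional.exists_grid {Ω : Type*} {X : ℝ≥0 → Ω → ℝ} {t r : ℝ≥0} {Z : Ω → ℝ≥0∞}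
    (hZ : IsPastFunctional X t Z) (htr : t ≤ r) :
    ∃ (τ : ℕ → ℝ≥0) (m : ℕ) (G : (Finset.range m → ℝ) → ℝ≥0∞), Monotone τ ∧ τ 0 = 0 ∧ τ m = t ∧
      τ (m + 1) = r ∧ Measurable G ∧ Z = fun ω => G (fun i => X (τ (i + 1)) ω - X (τ i) ω) := by
  obtain ⟨τ, m, G, hτ, hτ0, hτm, hG, rfl⟩ := hZ
  refine ⟨fun i => if i ≤ m then τ i else r, m, G, ?_, by simp [hτ0], by simp [hτm], by simp, hG,
    ?_⟩
  · intro i j hij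
    dsimp only
    split_ifs with h1 h2 h2
    · exact hτ hij
    · exact (hτ h1).trans (hτm.trans_le htr)
    · exact absurd (hij.trans h2) h1
    · exact le_rfl
  · funext ω
    congr 1
    funext i
    have h1 : (i : ℕ) + 1 ≤ m := Finset.mem_range.1 i.2
    have h2 : (i : ℕ) ≤ m := by lia
    simp [h1, h2]

/-- The grid gains the point r, and X_r is the telescoping sum of all increments because X_0 = 0. -/
theorem IsPastFunctional.mul_exp {Ω : Type*} {X : ℝ≥0 → Ω → ℝ} (hX0 : ∀ ω, X 0 ω = 0) {t r : ℝ≥0}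
    {Z : Ω → ℝ≥0∞} (hZ : IsPastFunctional X t Z) (htr : t ≤ r) (k : ℝ) :
    IsPastFunctional X r (fun ω => Z ω * ENNReal.ofReal (Real.exp (-k * X r ω))) := by
  obtain ⟨τ, m, G, hτ, hτ0, hτm, hτr, hG, rfl⟩ := hZ.exists_grid htr
  refine ⟨τ, m + 1, fun v => G (fun i => v ⟨i, Finset.mem_range.2
      ((Finset.mem_range.1 i.2).trans (Nat.lt_succ_self m))⟩) *
      ENNReal.ofReal (Real.exp (-k * ∑ i, v i)), hτ, hτ0, hτr, ?_, ?_⟩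
  · refine (hG.comp (measurable_pi_lambda _ fun i => measurable_pi_apply _)).mul ?_
    refine ENNReal.measurable_ofReal.comp (Real.measurable_exp.comp (Measurable.const_mul ?_ _))
    exact Finset.measurable_sum _ fun i _ => measurable_pi_apply i
  · funext ω
    have : ∑ i : Finset.range (m + 1), (X (τ (i + 1)) ω - X (τ i) ω) = X r ω := by
      rw [Finset.sum_coe_sort (Finset.range (m + 1)) (fun i => X (τ (i + 1)) ω - X (τ i) ω),
        Finset.sum_range_sub (fun i => X (τ i) ω), hτr, hτ0, hX0, sub_zero]
    dsimp only
    rw [this]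

theorem IsPastFunctional.indepFun {Ω : Type*} [MeasurableSpace Ω] {P : Measure Ω} {X : ℝ≥0 → Ω → ℝ}
    (hX : ∀ t, Measurable (X t))
    (hind : HasIndepIncrements X P) {t r : ℝ≥0} {Z : Ω → ℝ≥0∞} (hZ : IsPastFunctional X t Z)
    (htr : t ≤ r) : IndepFun Z (fun ω => X r ω - X t ω) P := by
  obtain ⟨τ, m, G, hτ, hτ0, hτm, hτr, hG, rfl⟩ := hZ.exists_grid htr
  have h := (hind.nat hτ).indepFun_finset (Finset.range m) {m} (by simp)
    (fun i => (hX _).sub (hX _))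
  have h2 := h.comp hG (measurable_pi_apply (⟨m, Finset.mem_singleton_self m⟩ : ({m} : Finset ℕ)))
  have e : (fun ω => X r ω - X t ω) = fun ω => X (τ (m + 1)) ω - X (τ m) ω := by rw [hτm, hτr]
  rw [e]
  exact h2

/-- The iterated integrals `∫_{t < r₁ < ⋯ < rₙ} e^{-X_{r₁}} ⋯ e^{-X_{rₙ}} dr`. -/
noncomputable def iteratedExp {Ω : Type*} (X : ℝ≥0 → Ω → ℝ) : ℕ → ℝ → Ω → ℝ≥0∞
  | 0, _, _ => 1
  | n + 1, t, ω => ∫⁻ r in Ioi t,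
      ENNReal.ofReal (Real.exp (-(X r.toNNReal ω))) * iteratedExp X n r ω

theorem HasSubordinatorPaths.measurable_exp {Ω : Type*} [MeasurableSpace Ω] {X : ℝ≥0 → Ω → ℝ}
    (h : HasSubordinatorPaths X) :
    Measurable (fun p : ℝ × Ω => ENNReal.ofReal (Real.exp (-(X p.1.toNNReal p.2)))) := by
  have := h.measurable_uncurry.comp ((measurable_real_toNNReal.comp
    measurable_fst).prodMk (measurable_snd : Measurable (Prod.snd : ℝ × Ω → Ω)))
  exact (this.neg.exp).ennreal_ofReal

theorem measurable_iteratedExp {Ω : Type*} [MeasurableSpace Ω] {X : ℝ≥0 → Ω → ℝ}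
    (h : HasSubordinatorPaths X) (n : ℕ) :
    Measurable (fun p : ℝ × Ω => iteratedExp X n p.1 p.2) := by
  induction n with
  | zero => exact measurable_const
  | succ n ih =>
    have h1 : Measurable (fun q : (ℝ × Ω) × ℝ => (Ioi q.1.1).indicator (fun r =>
        ENNReal.ofReal (Real.exp (-(X r.toNNReal q.1.2))) * iteratedExp X n r q.1.2) q.2) := by
      have h2 : Measurable (fun q : (ℝ × Ω) × ℝ =>
          ENNReal.ofReal (Real.exp (-(X q.2.toNNReal q.1.2))) * iteratedExp X n q.2 q.1.2) :=
        (h.measurable_exp.mul ih).comp (measurable_snd.prodMk (measurable_snd.comp measurable_fst))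
      exact h2.indicator (measurableSet_lt (measurable_fst.comp measurable_fst) measurable_snd)
    have h3 := h1.lintegral_prod_right' (ν := volume)
    have h4 : (fun p : ℝ × Ω => iteratedExp X (n + 1) p.1 p.2) = fun p => ∫⁻ y, (Ioi p.1).indicator
        (fun r => ENNReal.ofReal (Real.exp (-(X r.toNNReal p.2))) * iteratedExp X n r p.2) y := by
      funext p
      rw [iteratedExp, ← lintegral_indicator measurableSet_Ioi]
    rw [h4]
    exact h3

/-- The exponents are those of a subordinator with Laplace exponent `Ψ`. -/
theorem lintegral_mul_iteratedExp {Ω : Type*} [MeasurableSpace Ω] {P : Measure Ω}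
    [IsProbabilityMeasure P] {X : ℝ≥0 → Ω → ℝ}
    (h : HasSubordinatorPaths X) (hind : HasIndepIncrements X P) {Ψ : ℕ → ℝ}
    (hΨ : ∀ n, 1 ≤ n → 0 < Ψ n)
    (hlap : ∀ (s t : ℝ≥0) (n : ℕ), 1 ≤ n →
      ∫⁻ ω, ENNReal.ofReal (Real.exp (-n * (X (s + t) ω - X s ω))) ∂P =
        ENNReal.ofReal (Real.exp (-t * Ψ n)))
    (n : ℕ) : ∀ (t : ℝ≥0) (Z : Ω → ℝ≥0∞), IsPastFunctional X t Z →
    ∫⁻ ω, Z ω * iteratedExp X n t ω ∂P = ENNReal.ofReal (∏ j ∈ Finset.range n, (Ψ (j + 1))⁻¹) *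
      ∫⁻ ω, Z ω * ENNReal.ofReal (Real.exp (-n * X t ω)) ∂P := by
  induction n with
  | zero => intro t Z hZ; simp [iteratedExp]
  | succ n ih =>
    intro t Z hZ
    have hZm := hZ.measurable h.measurable
    have hmeas : Measurable (fun p : Ω × ℝ => Z p.1 *
        (ENNReal.ofReal (Real.exp (-(X p.2.toNNReal p.1))) * iteratedExp X n p.2 p.1)) :=
      (hZm.comp measurable_fst).mul ((h.measurable_exp.mul (measurable_iteratedExp h n)).comp
        (measurable_snd.prodMk measurable_fst))
    have hmeas' : ∀ ω, Measurable (fun r : ℝ => ENNReal.ofReal (Real.exp (-(X r.toNNReal ω))) *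
        iteratedExp X n r ω) := fun ω =>
      (h.measurable_exp.mul (measurable_iteratedExp h n)).comp (measurable_id.prodMk
        measurable_const)
    -- The general past factor Z is what lets the induction close. For fixed r the induction
    -- hypothesis is applied to Z e^{-X_r}, which produces Z e^{-(n+1) X_r}. Splitting X_r at time
    -- t, the independent increment contributes e^{-(r-t) Ψ(n+1)}, and integrating over r > t gives
    -- 1 / Ψ(n+1).
    calc ∫⁻ ω, Z ω * iteratedExp X (n + 1) t ω ∂P
        = ∫⁻ ω, (∫⁻ r in Ioi (t : ℝ), Z ω * (ENNReal.ofReal (Real.exp (-(X r.toNNReal ω))) *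
            iteratedExp X n r ω)) ∂P := by
          refine lintegral_congr fun ω => ?_
          rw [lintegral_const_mul _ (hmeas' ω), iteratedExp]
      _ = ∫⁻ r in Ioi (t : ℝ), (∫⁻ ω, Z ω * (ENNReal.ofReal (Real.exp (-(X r.toNNReal ω))) *
            iteratedExp X n r ω) ∂P) := lintegral_lintegral_swap hmeas.aemeasurable
      _ = ∫⁻ r in Ioi (t : ℝ), ENNReal.ofReal (∏ j ∈ Finset.range n, (Ψ (j + 1))⁻¹) *
            (∫⁻ ω, Z ω * ENNReal.ofReal (Real.exp (-(n + 1 : ℕ) * X t ω)) ∂P) *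
              ENNReal.ofReal (Real.exp (-(r - t) * Ψ (n + 1))) := by
          refine setLIntegral_congr_fun measurableSet_Ioi fun r hr => ?_
          have htr : (t : ℝ) < r := hr
          have hr0 : 0 ≤ r := t.2.trans htr.le
          have htr' : t ≤ r.toNNReal := by
            rw [← NNReal.coe_le_coe, Real.coe_toNNReal _ hr0]; exact htr.le
          have h1 := ih r.toNNReal _ (hZ.mul_exp h.zero htr' 1)
          rw [Real.coe_toNNReal _ hr0] at h1
          have e1 : ∫⁻ ω, Z ω * (ENNReal.ofReal (Real.exp (-(X r.toNNReal ω))) *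
              iteratedExp X n r ω) ∂P = ∫⁻ ω, Z ω * ENNReal.ofReal
              (Real.exp (-1 * X r.toNNReal ω)) * iteratedExp X n r ω ∂P := by
            refine lintegral_congr fun ω => ?_
            rw [mul_assoc, neg_one_mul]
          have e2 : ∀ ω, Z ω * ENNReal.ofReal (Real.exp (-1 * X r.toNNReal ω)) *
              ENNReal.ofReal (Real.exp (-n * X r.toNNReal ω)) =
              (Z ω * ENNReal.ofReal (Real.exp (-(n + 1 : ℕ) * X t ω))) *
              ENNReal.ofReal (Real.exp (-(n + 1 : ℕ) * (X r.toNNReal ω - X t ω))) := fun ω => by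
            rw [mul_assoc, mul_assoc, ← ENNReal.ofReal_mul (Real.exp_nonneg _),
              ← ENNReal.ofReal_mul (Real.exp_nonneg _), ← Real.exp_add, ← Real.exp_add]
            congr 3
            push_cast
            ring
          rw [e1, h1, mul_assoc]
          congr 1
          simp_rw [e2]
          have hI := (hZ.mul_exp h.zero le_rfl ((n + 1 : ℕ) : ℝ)).indepFun h.measurable hind htr'
          have hI2 := hI.comp measurable_id (ψ := fun x : ℝ =>
            ENNReal.ofReal (Real.exp (-(n + 1 : ℕ) * x))) (by fun_prop)
          have := lintegral_mul_eq_lintegral_mul_lintegral_of_indepFun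
            ((hZ.mul_exp h.zero le_rfl ((n + 1 : ℕ) : ℝ)).measurable h.measurable)
            (by have := h.measurable; fun_prop) hI2
          simp only [Pi.mul_apply, Function.comp_def] at this
          rw [this]
          congr 1
          have h3 := hlap t (r.toNNReal - t) (n + 1) (by lia)
          rw [add_tsub_cancel_of_le htr', NNReal.coe_sub htr', Real.coe_toNNReal _ hr0] at h3
          exact h3
      _ = _ := by
          have hp := hΨ (n + 1) (by lia)
          rw [lintegral_const_mul _ (by fun_prop)]
          have e3 : ∫⁻ r in Ioi (t : ℝ), ENNReal.ofReal (Real.exp (-(r - t) * Ψ (n + 1))) =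
              ENNReal.ofReal (Ψ (n + 1))⁻¹ := by
            have hfun : ∀ r : ℝ, Real.exp (-(r - t) * Ψ (n + 1)) =
                Real.exp (t * Ψ (n + 1)) * Real.exp (-Ψ (n + 1) * r) := fun r => by
              rw [← Real.exp_add]
              ring_nf
            simp_rw [hfun]
            rw [← ofReal_integral_eq_lintegral_ofReal, integral_const_mul,
              integral_exp_mul_Ioi (by linarith)]
            · congr 1
              rw [neg_div_neg_eq, mul_div_assoc', ← Real.exp_add]
              simp [mul_comm]
            · exact (integrableOn_exp_mul_Ioi (by linarith) _).const_mul _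
            · exact Eventually.of_forall fun r => by positivity
          rw [e3, Finset.prod_range_succ, ENNReal.ofReal_mul
            (Finset.prod_nonneg fun j _ => (inv_pos.2 (hΨ _ (by lia))).le)]
          ring

/-- The tail integral F of f has right derivative -f, so -F^{n+1} / (n+1)! is a primitive of f F^n /
n! and vanishes at infinity. Only right derivatives exist, as f may jump; the fundamental theorem in
its one-sided form is enough. -/
theorem lintegral_Ioi_mul_tail_pow {f : ℝ → ℝ} (hf0 : ∀ x, 0 ≤ f x) (hanti : Antitone f)
    (hrc : ∀ t, ContinuousWithinAt f (Ici t) t) (hint : IntegrableOn f (Ioi 0)) (n : ℕ) {t : ℝ}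
    (ht : 0 ≤ t) :
    ∫⁻ r in Ioi t, ENNReal.ofReal (f r) * ENNReal.ofReal ((∫ x in Ioi r, f x) ^ n / n.factorial) =
      ENNReal.ofReal ((∫ x in Ioi t, f x) ^ (n + 1) / (n + 1).factorial) := by
  set F : ℝ → ℝ := fun r => ∫ x in Ioi r, f x with hF
  have hfi : ∀ a b, IntervalIntegrable f volume a b := fun a b => hanti.intervalIntegrable
  have hFsub : ∀ r, 0 ≤ r → F r = F 0 - ∫ x in (0 : ℝ)..r, f x := fun r hr => by
    have := intervalIntegral.integral_interval_add_Ioi hint (hint.mono_set (Ioi_subset_Ioi hr))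
    simp only [hF]
    linarith
  have hFnn : ∀ r, 0 ≤ F r := fun r => setIntegral_nonneg measurableSet_Ioi fun x _ => hf0 x
  have hFle : ∀ r, 0 ≤ r → F r ≤ F 0 := fun r hr => by
    rw [hFsub r hr]
    linarith [intervalIntegral.integral_nonneg hr (μ := volume) fun x _ => hf0 x]
  have hcontI : Continuous (fun r => ∫ x in (0 : ℝ)..r, f x) :=
    intervalIntegral.continuous_primitive hfi 0
  have hFcont : ContinuousOn F (Ici 0) :=
    (continuous_const.sub hcontI).continuousOn.congr fun r hr => hFsub r hr
  have hFmeas : AEStronglyMeasurable F (volume.restrict (Ioi t)) :=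
    ((hFcont.mono (Ioi_subset_Ici ht))).aestronglyMeasurable measurableSet_Ioi
  have hFlim : Tendsto F atTop (𝓝 0) := by
    have h1 := intervalIntegral_tendsto_integral_Ioi 0 hint tendsto_id
    have h2 : Tendsto (fun r => F 0 - ∫ x in (0 : ℝ)..r, f x) atTop (𝓝 (F 0 - F 0)) :=
      tendsto_const_nhds.sub h1
    rw [sub_self] at h2
    refine h2.congr' ?_
    filter_upwards [eventually_ge_atTop 0] with r hr using (hFsub r hr).symm
  have hderiv : ∀ r, 0 < r → HasDerivWithinAt F (-f r) (Ioi r) r := fun r hr => by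
    have h1 : HasDerivWithinAt (fun u => ∫ x in (0 : ℝ)..u, f x) (f r) (Ici r) r :=
      intervalIntegral.integral_hasDerivWithinAt_right (hfi 0 r)
        (hanti.measurable.stronglyMeasurable.stronglyMeasurableAtFilter) 
        ((hrc r).mono Ioi_subset_Ici_self)
    have h2 := (h1.const_sub (F 0)).mono Ioi_subset_Ici_self
    exact h2.congr (fun u hu => hFsub u (hr.le.trans (le_of_lt hu))) (hFsub r hr.le)
  have hint' : IntegrableOn (fun r => f r * (F r ^ n / n.factorial)) (Ioi t) := by
    have h1 : IntegrableOn (fun r => f r * (F 0 ^ n / n.factorial)) (Ioi t) :=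
      (hint.mono_set (Ioi_subset_Ioi ht)).mul_const _
    refine h1.mono' (hanti.measurable.aestronglyMeasurable.mul
      ((hFmeas.pow n).mul_const _)) ?_
    filter_upwards [ae_restrict_mem measurableSet_Ioi] with r hr
    have hr0 : 0 ≤ r := ht.trans (le_of_lt hr)
    have := hf0 r
    have := hFnn r
    rw [Real.norm_of_nonneg (by positivity)]
    gcongr
    exact hFle r hr0
  have hval : ∫ r in Ioi t, f r * (F r ^ n / n.factorial) =
      F t ^ (n + 1) / (n + 1).factorial := by
    refine tendsto_nhds_unique (intervalIntegral_tendsto_integral_Ioi t hint' tendsto_id) ?_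
    have h1 : Tendsto (fun T => F t ^ (n + 1) / (n + 1).factorial -
        F T ^ (n + 1) / (n + 1).factorial) atTop
        (𝓝 (F t ^ (n + 1) / (n + 1).factorial - 0 ^ (n + 1) / (n + 1).factorial)) :=
      tendsto_const_nhds.sub ((hFlim.pow (n + 1)).div_const _)
    rw [zero_pow (by lia), zero_div, sub_zero] at h1
    refine h1.congr' ?_
    filter_upwards [eventually_ge_atTop t] with T hT
    have hft := intervalIntegral.integral_eq_sub_of_hasDeriv_right_of_le hT
      (f := fun r => -(F r ^ (n + 1) / (n + 1).factorial))
      (f' := fun r => f r * (F r ^ n / n.factorial)) ?_ ?_ ?_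
    · rw [id, hft]
      ring
    · exact ((hFcont.mono fun r hr => ht.trans hr.1).pow _).div_const _ |>.neg
    · intro r hr
      have h3 := (((hderiv r (ht.trans_lt hr.1)).pow (n + 1)).div_const
        ((n + 1).factorial : ℝ)).neg
      refine h3.congr_deriv ?_
      rw [Nat.factorial_succ]
      push_cast
      have : (n.factorial : ℝ) ≠ 0 := by positivity
      have : (n + 1 : ℝ) ≠ 0 := by positivity
      field_simp
    · rw [intervalIntegrable_iff_integrableOn_Ioc_of_le hT]
      exact hint'.mono_set Ioc_subset_Ioi_self
  rw [← hval, ofReal_integral_eq_lintegral_ofReal hint'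
    (Eventually.of_forall fun r => by have := hf0 r; have := hFnn r; positivity)]
  refine lintegral_congr fun r => ?_
  rw [ENNReal.ofReal_mul (hf0 r)]

/-- An ordered n-fold integral is 1/n! of the n-th power. Finiteness of the functional is needed
because the tail is a Bochner integral. -/
theorem iteratedExp_eq {Ω : Type*} [MeasurableSpace Ω] {X : ℝ≥0 → Ω → ℝ}
    (h : HasSubordinatorPaths X) {ω : Ω} (hω : expFunctional X ω ≠ ∞) (n : ℕ) :
    ∀ t, 0 ≤ t → iteratedExp X n t ω =
      ENNReal.ofReal ((∫ x in Ioi t, Real.exp (-(X x.toNNReal ω))) ^ n / n.factorial) := by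
  have hanti : Antitone (fun r : ℝ => Real.exp (-(X r.toNNReal ω))) := fun r s hrs =>
    Real.exp_le_exp.2 (neg_le_neg (h.mono ω (Real.toNNReal_mono hrs)))
  have hint : IntegrableOn (fun r : ℝ => Real.exp (-(X r.toNNReal ω))) (Ioi 0) := by
    refine ⟨hanti.measurable.aestronglyMeasurable, ?_⟩
    rw [hasFiniteIntegral_iff_ofReal (Eventually.of_forall fun r => by positivity)]
    refine (lt_top_iff_ne_top.2 hω).trans_le' ?_
    exact lintegral_mono_set Ioi_subset_Ici_self
  have hrc : ∀ t : ℝ, ContinuousWithinAt (fun r : ℝ => Real.exp (-(X r.toNNReal ω))) (Ici t) t :=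
    fun t => by
      refine Real.continuous_exp.continuousAt.comp_continuousWithinAt ?_
      refine ContinuousWithinAt.neg ?_
      exact (h.rightCont ω t.toNNReal).comp continuous_real_toNNReal.continuousWithinAt
        fun s hs => Real.toNNReal_mono hs
  induction n with
  | zero => intro t ht; simp [iteratedExp]
  | succ n ih =>
    intro t ht
    rw [iteratedExp, ← lintegral_Ioi_mul_tail_pow (fun x => (Real.exp_pos _).le) hanti hrc hint n
      ht]
    refine setLIntegral_congr_fun measurableSet_Ioi fun r hr => ?_
    rw [ih r (ht.trans (le_of_lt hr))]

theorem HasSubordinatorPaths.measurable_expFunctional {Ω : Type*} [MeasurableSpace Ω]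
    {X : ℝ≥0 → Ω → ℝ} (h : HasSubordinatorPaths X) : Measurable (expFunctional X) := by
  have := (h.measurable_exp.comp measurable_swap).lintegral_prod_right'
    (ν := volume.restrict (Ici (0 : ℝ)))
  exact this

theorem expFunctional_eq_iteratedExp {Ω : Type*} [MeasurableSpace Ω] (X : ℝ≥0 → Ω → ℝ) (ω : Ω) :
    expFunctional X ω = iteratedExp X 1 0 ω := by
  simp only [iteratedExp, mul_one, expFunctional]
  exact setLIntegral_congr Ioi_ae_eq_Ici.symm

/-- Take Z = 1 and t = 0 in `lintegral_mul_iteratedExp`. The case n = 1 already gives almost sure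
finiteness, after which the iterated integral is I^n / n!. -/
theorem hasMoments_of_hasSubordinatorPaths {Ω : Type*} [MeasurableSpace Ω] {P : Measure Ω}
    [IsProbabilityMeasure P] {X : ℝ≥0 → Ω → ℝ}
    (h : HasSubordinatorPaths X) (hind : HasIndepIncrements X P) {Ψ : ℕ → ℝ}
    (hΨ : ∀ n, 1 ≤ n → 0 < Ψ n)
    (hlap : ∀ (s t : ℝ≥0) (n : ℕ), 1 ≤ n →
      ∫⁻ ω, ENNReal.ofReal (Real.exp (-n * (X (s + t) ω - X s ω))) ∂P =
        ENNReal.ofReal (Real.exp (-t * Ψ n))) :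
    (∀ᵐ ω ∂P, expFunctional X ω ≠ ∞) ∧ HasMoments (P.map (fun ω => (expFunctional X ω).toReal))
      (fun n => n.factorial * ∏ j ∈ Finset.range n, (Ψ (j + 1))⁻¹) := by
  have hK : ∀ n, ∫⁻ ω, iteratedExp X n 0 ω ∂P =
      ENNReal.ofReal (∏ j ∈ Finset.range n, (Ψ (j + 1))⁻¹) := fun n => by
    have := lintegral_mul_iteratedExp h hind hΨ hlap n 0 _ (isPastFunctional_one X)
    simpa [h.zero] using this
  have hfin : ∀ᵐ ω ∂P, expFunctional X ω ≠ ∞ := by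
    refine (ae_lt_top h.measurable_expFunctional ?_).mono fun ω hω => hω.ne
    simp_rw [expFunctional_eq_iteratedExp]
    rw [hK]
    exact ENNReal.ofReal_ne_top
  have hm : Measurable (fun ω => (expFunctional X ω).toReal) :=
    h.measurable_expFunctional.ennreal_toReal
  refine ⟨hfin, ⟨Measure.isProbabilityMeasure_map hm.aemeasurable, ?_, fun n => ?_, fun n => ?_⟩⟩
  · rw [ae_map_iff hm.aemeasurable measurableSet_Ici]
    exact Eventually.of_forall fun ω => ENNReal.toReal_nonneg
  · exact mul_nonneg (by positivity) (Finset.prod_nonneg fun j _ => (inv_pos.2 (hΨ _ (by lia))).le)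
  · have hKm : Measurable (fun ω => iteratedExp X n 0 ω) :=
      (measurable_iteratedExp h n).comp (measurable_const.prodMk measurable_id)
    rw [lintegral_map (by fun_prop) hm, ENNReal.ofReal_mul (by positivity), ← hK,
      ← lintegral_const_mul _ hKm]
    refine lintegral_congr_ae ?_
    filter_upwards [hfin] with ω hω
    rw [iteratedExp_eq h hω n 0 le_rfl, ← ENNReal.ofReal_mul (by positivity),
      mul_div_cancel₀ _ (by positivity)]
    congr 2
    rw [integral_eq_lintegral_of_nonneg_ae (Eventually.of_forall fun r => by positivity)
      (AEMeasurable.aestronglyMeasurable ?_)]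
    · rw [expFunctional_eq_iteratedExp]
      simp [iteratedExp]
    · have hanti : Antitone (fun r : ℝ => Real.exp (-(X r.toNNReal ω))) := fun r s hrs =>
        Real.exp_le_exp.2 (neg_le_neg (h.mono ω (Real.toNNReal_mono hrs)))
      exact hanti.measurable.aemeasurable

/-! ### Laplace exponents, and moments for pure-jump subordinators. -/

namespace IsSubordinatorLevyMeasure

variable {ν : Measure ℝ}

theorem integrable_min (hν : IsSubordinatorLevyMeasure ν) :
    Integrable (fun z : ℝ => min 1 z) (ν.restrict (Ioi 0)) := by
  refine ⟨by fun_prop, ?_⟩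
  rw [hasFiniteIntegral_iff_ofReal
    ((ae_restrict_mem measurableSet_Ioi).mono fun z hz => le_min zero_le_one (le_of_lt hz))]
  exact (setLIntegral_le_lintegral _ _).trans_lt hν.lintegral_lt_top

theorem measure_Ici_lt_top (hν : IsSubordinatorLevyMeasure ν) {δ : ℝ} (hδ : 0 < δ) :
    ν (Ici δ) < ∞ := by
  have h0 : 0 < min 1 δ := lt_min one_pos hδ
  have h1 : ENNReal.ofReal (min 1 δ) * ν (Ici δ) ≤ ∫⁻ z, ENNReal.ofReal (min 1 z) ∂ν := by
    rw [← setLIntegral_const]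
    refine (setLIntegral_mono (by fun_prop) fun z hz => ?_).trans (setLIntegral_le_lintegral _ _)
    exact ENNReal.ofReal_le_ofReal (min_le_min le_rfl hz)
  by_contra h
  rw [not_lt, top_le_iff] at h
  rw [h, ENNReal.mul_top (by simpa using h0)] at h1
  exact (h1.trans_lt hν.lintegral_lt_top).ne rfl

theorem restrict_Ioi (hν : IsSubordinatorLevyMeasure ν) : ν.restrict (Ioi 0) = ν := by
  refine Measure.restrict_eq_self_of_ae_mem ?_
  rw [ae_iff]
  convert hν.supp using 2
  ext z
  simp

theorem one_sub_exp_le {u z : ℝ} (hu : 0 ≤ u) (hz : 0 ≤ z) :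
    1 - Real.exp (-u * z) ≤ (1 + u) * min 1 z := by
  have h1 : -u * z + 1 ≤ Real.exp (-u * z) := Real.add_one_le_exp _
  have h2 := Real.exp_pos (-u * z)
  rcases le_total 1 z with h | h
  · rw [min_eq_left h]; nlinarith
  · rw [min_eq_right h]; nlinarith

theorem integrable_one_sub_exp (hν : IsSubordinatorLevyMeasure ν) {u : ℝ} (hu : 0 ≤ u) :
    Integrable (fun z : ℝ => 1 - Real.exp (-u * z)) (ν.restrict (Ioi 0)) := by
  refine (hν.integrable_min.const_mul (1 + u)).mono' (by fun_prop) ?_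
  filter_upwards [ae_restrict_mem measurableSet_Ioi] with z hz
  have hz0 : 0 ≤ z := le_of_lt hz
  rw [Real.norm_of_nonneg]
  · exact one_sub_exp_le hu hz0
  · rw [sub_nonneg, Real.exp_le_one_iff]
    nlinarith

theorem laplaceExponent_pos (hν : IsSubordinatorLevyMeasure ν) (h0 : ν ≠ 0) {u : ℝ} (hu : 0 < u) :
    0 < laplaceExponent ν u := by
  have hpos : ∀ z ∈ Ioi (0 : ℝ), 0 < 1 - Real.exp (-u * z) := fun z hz => by
    rw [sub_pos, Real.exp_lt_one_iff]
    have : 0 < z := hz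
    nlinarith
  rw [laplaceExponent, integral_pos_iff_support_of_nonneg_ae
    ((ae_restrict_mem measurableSet_Ioi).mono fun z hz => (hpos z hz).le)
    (hν.integrable_one_sub_exp hu.le)]
  have h1 : Ioi (0 : ℝ) ⊆ Function.support (fun z : ℝ => 1 - Real.exp (-u * z)) := fun z hz =>
    (hpos z hz).ne'
  refine lt_of_lt_of_le ?_ (measure_mono h1)
  rw [Measure.restrict_apply_self, pos_iff_ne_zero]
  intro h
  refine h0 (Measure.measure_univ_eq_zero.1 ?_)
  rw [← Iic_union_Ioi (a := (0 : ℝ))]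
  exact measure_union_null hν.supp h

theorem laplaceExponent_mono (hν : IsSubordinatorLevyMeasure ν) {u v : ℝ} (hu : 0 ≤ u)
    (huv : u ≤ v) : laplaceExponent ν u ≤ laplaceExponent ν v := by
  refine setIntegral_mono_on (hν.integrable_one_sub_exp hu)
    (hν.integrable_one_sub_exp (hu.trans huv)) measurableSet_Ioi fun z hz => ?_
  have hz0 : 0 < z := hz
  gcongr

end IsSubordinatorLevyMeasure

/-- The moments of the exponential functional of a subordinator with Lévy measure `ν`. -/
noncomputable def expFunctionalMoment (ν : Measure ℝ) (n : ℕ) : ℝ :=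
  n.factorial * ∏ j ∈ Finset.range n, (laplaceExponent ν ((j + 1 : ℕ) : ℝ))⁻¹

/-- Monotonicity of the Laplace exponent bounds every factor by 1/a. Leaving a free allows one bound
for a whole family of Lévy measures. -/
theorem expFunctionalMoment_le {ν : Measure ℝ} (hν : IsSubordinatorLevyMeasure ν) {a : ℝ}
    (ha : 0 < a) (hle : a ≤ laplaceExponent ν 1) (n : ℕ) :
    expFunctionalMoment ν n ≤ n.factorial * a⁻¹ ^ n := by
  rw [expFunctionalMoment]
  have hj : ∀ j : ℕ, a ≤ laplaceExponent ν ((j + 1 : ℕ) : ℝ) := fun j =>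
    hle.trans (hν.laplaceExponent_mono zero_le_one (by push_cast; linarith [j.cast_nonneg (α := ℝ)]))
  gcongr
  calc _ ≤ ∏ j ∈ Finset.range n, a⁻¹ := by
        refine Finset.prod_le_prod (fun j _ => (inv_pos.2 (ha.trans_le (hj j))).le) fun j _ => ?_
        exact inv_anti₀ ha (hj j)
    _ = _ := by simp

/-- The path properties hold only almost surely. Paths are replaced by 0 on a measurable null set,
which keeps every marginal measurable. -/
theorem IsPureJumpSubordinator.exists_hasSubordinatorPaths {Ω : Type*} [MeasurableSpace Ω]
    {P : Measure Ω} {ν : Measure ℝ} {X : ℝ≥0 → Ω → ℝ} (hX : IsPureJumpSubordinator P ν X) :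
    ∃ Y : ℝ≥0 → Ω → ℝ, HasSubordinatorPaths Y ∧ ∀ᵐ ω ∂P, ∀ t, X t ω = Y t ω := by
  classical
  obtain ⟨N, hN, hNm, hN0⟩ := exists_measurable_superset_of_null (ae_iff.1 (hX.zero.and hX.paths))
  have hgood : ∀ ω, ω ∉ N → X 0 ω = 0 ∧ Monotone (fun t => X t ω) ∧
      ∀ t, ContinuousWithinAt (fun s => X s ω) (Ici t) t := fun ω hω => by
    by_contra h
    exact hω (hN h)
  refine ⟨fun t ω => if ω ∈ N then 0 else X t ω, ⟨fun t => ?_, fun ω => ?_, fun ω => ?_,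
    fun ω t => ?_⟩, ?_⟩
  · exact Measurable.ite hNm measurable_const (hX.measurable t)
  · by_cases h : ω ∈ N
    · simp [h]
    · simp [h, (hgood ω h).1]
  · by_cases h : ω ∈ N
    · simp only [h, if_true]
      exact monotone_const
    · simpa only [h, if_false] using (hgood ω h).2.1
  · by_cases h : ω ∈ N
    · simp only [h, if_true]
      exact continuousWithinAt_const
    · simpa only [h, if_false] using (hgood ω h).2.2 t
  · have : ∀ᵐ ω ∂P, ω ∉ N := measure_eq_zero_iff_ae_notMem.1 hN0
    filter_upwards [this] with ω hω t
    simp [hω]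

theorem IsPureJumpSubordinator.hasMoments {Ω : Type*} [MeasurableSpace Ω]
    {P : Measure Ω} [IsProbabilityMeasure P] {ν : Measure ℝ} (h0 : ν ≠ 0) {X : ℝ≥0 → Ω → ℝ}
    (hX : IsPureJumpSubordinator P ν X) :
    AEMeasurable (expFunctional X) P ∧ (∀ᵐ ω ∂P, expFunctional X ω ≠ ∞) ∧
      HasMoments (P.map (fun ω => (expFunctional X ω).toReal)) (expFunctionalMoment ν) := by
  obtain ⟨Y, hY, hXY⟩ := hX.exists_hasSubordinatorPaths
  have hν := hX.levyMeasure
  have hXYt : ∀ t, X t =ᵐ[P] Y t := fun t => hXY.mono fun ω hω => hω t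
  have hE : expFunctional X =ᵐ[P] expFunctional Y := hXY.mono fun ω hω => by
    simp only [expFunctional, hω]
  have hind : HasIndepIncrements Y P := fun n t ht =>
    (iIndepFun_congr fun i => (hXYt _).sub (hXYt _)).1 (hX.indep n t ht)
  have hlap : ∀ (s t : ℝ≥0) (n : ℕ), 1 ≤ n →
      ∫⁻ ω, ENNReal.ofReal (Real.exp (-n * (Y (s + t) ω - Y s ω))) ∂P =
        ENNReal.ofReal (Real.exp (-t * laplaceExponent ν n)) := fun s t n hn => by
    have h1 : ∫⁻ ω, ENNReal.ofReal (Real.exp (-n * (Y (s + t) ω - Y s ω))) ∂P =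
        ∫⁻ ω, ENNReal.ofReal (Real.exp (-n * (X (s + t) ω - X s ω))) ∂P := by
      refine lintegral_congr_ae ?_
      filter_upwards [hXY] with ω hω
      rw [hω, hω]
    have h2 := (hX.stationary s t).comp (u := fun x : ℝ => ENNReal.ofReal (Real.exp (-n * x)))
      (by fun_prop)
    have h3 := h2.lintegral_eq
    simp only [Function.comp_def] at h3
    rw [h1, h3, ← hX.laplace t n (by positivity), ofReal_integral_eq_lintegral_ofReal]
    · refine Integrable.of_bound (C := 1) ?_ ?_
      · have := hX.measurable t
        exact Measurable.aestronglyMeasurable (by fun_prop)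
      · filter_upwards [hXYt t] with ω hω
        rw [Real.norm_of_nonneg (Real.exp_pos _).le, Real.exp_le_one_iff, hω]
        have := hY.nonneg t ω
        have : (0 : ℝ) ≤ n := by positivity
        nlinarith
    · exact Eventually.of_forall fun ω => (Real.exp_pos _).le
  obtain ⟨h1, h2⟩ := hasMoments_of_hasSubordinatorPaths hY hind
    (Ψ := fun n => laplaceExponent ν n)
    (fun n hn => hν.laplaceExponent_pos h0 (by exact_mod_cast hn)) hlap
  refine ⟨hY.measurable_expFunctional.aemeasurable.congr hE.symm, ?_, ?_⟩
  · filter_upwards [hE, h1] with ω hω h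
    rwa [hω]
  · have : P.map (fun ω => (expFunctional X ω).toReal) =
        P.map (fun ω => (expFunctional Y ω).toReal) :=
      Measure.map_congr (hE.mono fun ω hω => by simp only [hω])
    rw [this]
    exact h2

/-! ### Dirichlet series with renewal coefficients: summability, functional equation, positivity. -/

/-- Data of a Dirichlet series `∑ c_j exp (-q^{-j} Λ x)` whose coefficients solve the renewal
recurrence with weights `w` of total mass `Λ`. -/
structure DirichletSystem (q Λ : ℝ) (w c : ℕ → ℝ) : Prop where
  q_pos : 0 < q
  q_lt_one : q < 1
  w_nonneg : ∀ k, 0 ≤ w k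
  hasSum : HasSum w Λ
  Λ_pos : 0 < Λ
  c_zero : c 0 = 1
  c_succ : ∀ j, c (j + 1) * (1 - q ^ (j + 1)) * Λ =
    -∑ i ∈ Finset.range (j + 1), q ^ i * c i * w (j - i)

/-- The function `x ↦ ∑ c_j exp (-q^{-j} Λ x)`. -/
noncomputable def dirichletSeries (q Λ : ℝ) (c : ℕ → ℝ) (x : ℝ) : ℝ :=
  ∑' j : ℕ, c j * Real.exp (-(q ^ j)⁻¹ * x * Λ)

namespace DirichletSystem

variable {q Λ : ℝ} {w c : ℕ → ℝ}

/-- Take absolute values in the recurrence, sum over j and exchange the sums: the weights add up to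
at most Λ, which cancels. -/
theorem sum_range_abs_mul_le (h : DirichletSystem q Λ w c) (n : ℕ) :
    ∑ j ∈ Finset.range n, |c j| * (1 - q ^ j) ≤ ∑ j ∈ Finset.range n, q ^ j * |c j| := by
  have hq := h.q_pos
  have hΛ := h.Λ_pos
  have hw := h.w_nonneg
  rcases n with - | n
  · simp
  rw [Finset.sum_range_succ']
  simp only [pow_zero, sub_self, mul_zero, add_zero]
  have h1 : ∀ j, |c (j + 1)| * (1 - q ^ (j + 1)) * Λ ≤
      ∑ i ∈ Finset.range (j + 1), q ^ i * |c i| * w (j - i) := fun j => by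
    have h2 : 0 < 1 - q ^ (j + 1) := sub_pos.2 (pow_lt_one₀ hq.le h.q_lt_one (by lia))
    rw [← abs_of_pos h2, ← abs_mul]
    have h4 := congrArg abs (h.c_succ j)
    rw [abs_mul _ Λ, abs_of_pos hΛ, abs_neg] at h4
    rw [h4]
    refine (Finset.abs_sum_le_sum_abs _ _).trans_eq (Finset.sum_congr rfl fun i _ => ?_)
    rw [abs_mul, abs_mul, abs_of_pos (pow_pos hq i), abs_of_nonneg (hw _)]
  refine le_of_mul_le_mul_right ?_ hΛ
  rw [Finset.sum_mul]
  refine (Finset.sum_le_sum fun j _ => h1 j).trans ?_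
  have h3 := Finset.sum_range_diag_flip n (fun i k => q ^ i * |c i| * w k)
  rw [h3]
  calc _ ≤ ∑ i ∈ Finset.range n, q ^ i * |c i| * Λ := by
        refine Finset.sum_le_sum fun i _ => ?_
        rw [← Finset.mul_sum]
        gcongr
        exact sum_le_hasSum _ (fun k _ => hw k) h.hasSum
    _ = (∑ i ∈ Finset.range n, q ^ i * |c i|) * Λ := by rw [Finset.sum_mul]
    _ ≤ _ := by
        gcongr
        lia

/-- The previous inequality says that the partial sums of |c_j| (1 - 2 q^j) are nonpositive. Once
q^j < 1/4 the bracket exceeds 1/2, so the finitely many earlier coefficients control all the others.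
-/
theorem summable_abs (h : DirichletSystem q Λ w c) : Summable (fun j => |c j|) := by
  have hq := h.q_pos
  obtain ⟨N, hN⟩ := exists_pow_lt_of_lt_one (show (0 : ℝ) < 1 / 4 by norm_num) h.q_lt_one
  refine summable_of_sum_range_le (c := 4 * ∑ j ∈ Finset.range N, |c j|) (fun _ => abs_nonneg _)
    fun n => ?_
  have h1 := h.sum_range_abs_mul_le n
  have h2 : ∑ j ∈ Finset.range n, |c j| * (1 - 2 * q ^ j) ≤ 0 := by
    rw [← sub_nonpos, ← Finset.sum_sub_distrib] at h1
    refine le_of_eq_of_le (Finset.sum_congr rfl fun j _ => ?_) h1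
    ring
  have h3 : ∀ j, 2⁻¹ * |c j| ≤ |c j| * (1 - 2 * q ^ j) + 2 * if j < N then |c j| else 0 :=
    fun j => by
      have hc := abs_nonneg (c j)
      split_ifs with hj
      · have : q ^ j ≤ 1 := pow_le_one₀ hq.le h.q_lt_one.le
        nlinarith
      · have : q ^ j ≤ q ^ N := pow_le_pow_of_le_one hq.le h.q_lt_one.le (not_lt.1 hj)
        nlinarith
  have h4 : ∑ j ∈ Finset.range n, (if j < N then |c j| else 0) ≤ ∑ j ∈ Finset.range N, |c j| := by
    rw [← Finset.sum_filter]
    refine Finset.sum_le_sum_of_subset_of_nonneg (fun j hj => ?_) fun _ _ _ => abs_nonneg _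
    exact Finset.mem_range.2 (Finset.mem_filter.1 hj).2
  have h5 := Finset.sum_le_sum fun j (_ : j ∈ Finset.range n) => h3 j
  rw [Finset.sum_add_distrib, ← Finset.mul_sum, ← Finset.mul_sum] at h5
  linarith

theorem summable_mul (h : DirichletSystem q Λ w c) {g : ℕ → ℝ} (hg : ∀ j, |g j| ≤ 1) :
    Summable (fun j => c j * g j) := by
  refine Summable.of_norm_bounded h.summable_abs fun j => ?_
  rw [Real.norm_eq_abs, abs_mul]
  exact mul_le_of_le_one_right (abs_nonneg _) (hg j)

theorem summable_prod (h : DirichletSystem q Λ w c) {g : ℕ → ℝ} (hg : ∀ j, |g j| ≤ 1) :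
    Summable (fun p : ℕ × ℕ => q ^ p.1 * c p.1 * w p.2 * g (p.1 + p.2 + 1)) := by
  have hw := h.w_nonneg
  have h1 : Summable (fun p : ℕ × ℕ => |c p.1| * w p.2) :=
    h.summable_abs.mul_of_nonneg h.hasSum.summable (fun _ => abs_nonneg _) hw
  refine Summable.of_norm_bounded h1 fun p => ?_
  have hq1 : q ^ p.1 ≤ 1 := pow_le_one₀ h.q_pos.le h.q_lt_one.le
  have hq0 : 0 ≤ q ^ p.1 := pow_nonneg h.q_pos.le _
  rw [Real.norm_eq_abs, abs_mul, abs_mul, abs_mul, abs_of_nonneg hq0, abs_of_nonneg (hw _)]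
  calc _ ≤ 1 * |c p.1| * w p.2 * 1 := by
        have := hw p.2
        gcongr
        exact hg _
    _ = _ := by ring

/-- The generating identity behind both the functional equation and the moments. -/
theorem tsum_mul_one_sub (h : DirichletSystem q Λ w c) {g : ℕ → ℝ} (hg : ∀ j, |g j| ≤ 1) :
    ∑' j, c j * (1 - q ^ j) * g j * Λ =
      -∑' i, q ^ i * c i * ∑' k, w k * g (i + k + 1) := by
  have hs := h.summable_prod hg
  have hone : ∀ j, |(1 - q ^ j) * g j| ≤ 1 := fun j => by
    have hq1 : q ^ j ≤ 1 := pow_le_one₀ h.q_pos.le h.q_lt_one.le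
    have hq0 : 0 ≤ q ^ j := pow_nonneg h.q_pos.le _
    rw [abs_mul, abs_of_nonneg (by linarith)]
    exact mul_le_one₀ (by linarith) (abs_nonneg _) (hg j)
  have hsum : Summable (fun j => c j * (1 - q ^ j) * g j * Λ) := by
    simpa only [mul_assoc] using (h.summable_mul hone).mul_right Λ
  -- The term j = 0 vanishes since 1 - q^0 = 0. The others are given by the recurrence as
  -- antidiagonal sums over i + k = j, which reassemble into an absolutely convergent double series.
  rw [hsum.tsum_eq_zero_add]
  simp only [pow_zero, sub_self, mul_zero, zero_mul, zero_add]
  have h1 : ∀ j, c (j + 1) * (1 - q ^ (j + 1)) * g (j + 1) * Λ =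
      -∑ p ∈ Finset.HasAntidiagonal.antidiagonal j, q ^ p.1 * c p.1 * w p.2 * g (p.1 + p.2 + 1) := fun j => by
    rw [mul_right_comm, h.c_succ, neg_mul, Finset.sum_mul,
      Finset.Nat.sum_antidiagonal_eq_sum_range_succ
        (fun i k => q ^ i * c i * w k * g (i + k + 1))]
    congr 1
    refine Finset.sum_congr rfl fun i hi => ?_
    have : i ≤ j := by have := Finset.mem_range.1 hi; lia
    rw [Nat.add_sub_cancel' this]
  simp_rw [h1]
  rw [tsum_neg]
  congr 1
  rw [← (Finset.HasAntidiagonal.sigmaAntidiagonalEquivProd (A := ℕ)).summable_iff] at hs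
  calc _ = ∑' n, ∑' p : Finset.HasAntidiagonal.antidiagonal n,
        q ^ p.1.1 * c p.1.1 * w p.1.2 * g (p.1.1 + p.1.2 + 1) := by
        refine tsum_congr fun n => ?_
        rw [tsum_fintype]
        exact (Finset.sum_coe_sort (Finset.HasAntidiagonal.antidiagonal n)
          (fun p => q ^ p.1 * c p.1 * w p.2 * g (p.1 + p.2 + 1))).symm
    _ = ∑' p : ℕ × ℕ, q ^ p.1 * c p.1 * w p.2 * g (p.1 + p.2 + 1) := by
        rw [← (Finset.HasAntidiagonal.sigmaAntidiagonalEquivProd (A := ℕ)).tsum_eq]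
        exact hs.tsum_sigma.symm
    _ = _ := by
        rw [(h.summable_prod hg).tsum_prod]
        refine tsum_congr fun i => ?_
        rw [← tsum_mul_left]
        exact tsum_congr fun k => by ring

/-- `∑ c_j q^{jn}`. -/
noncomputable def powSum (q : ℝ) (c : ℕ → ℝ) (n : ℕ) : ℝ := ∑' j, c j * (q ^ j) ^ n

theorem summable_powSum (h : DirichletSystem q Λ w c) (n : ℕ) :
    Summable (fun j => c j * (q ^ j) ^ n) := by
  refine h.summable_mul fun j => ?_
  have := h.q_pos
  rw [abs_of_nonneg (by positivity)]
  exact pow_le_one₀ (by positivity) (pow_le_one₀ this.le h.q_lt_one.le)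

/-- For g(j) = q^{jn} the inner sum in `tsum_mul_one_sub` factorises, leaving a first-order
recursion in n. For q = e^{-ε} its bracket is the discretised Laplace exponent at n. -/
theorem mul_powSum (h : DirichletSystem q Λ w c) (n : ℕ) :
    Λ * powSum q c n = powSum q c (n + 1) * (Λ - ∑' k, w k * (q ^ (k + 1)) ^ n) := by
  have hq := h.q_pos
  have h1 := h.tsum_mul_one_sub (g := fun j => (q ^ j) ^ n) (fun j => by
    rw [abs_of_nonneg (by positivity)]
    exact pow_le_one₀ (by positivity) (pow_le_one₀ hq.le h.q_lt_one.le))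
  have h2 : ∑' j, c j * (1 - q ^ j) * (q ^ j) ^ n * Λ =
      (powSum q c n - powSum q c (n + 1)) * Λ := by
    rw [tsum_mul_right, powSum, powSum,
      ← (h.summable_powSum n).tsum_sub (h.summable_powSum (n + 1))]
    congr 1
    exact tsum_congr fun j => by ring
  have h3 : ∑' i, q ^ i * c i * ∑' k, w k * (q ^ (i + k + 1)) ^ n =
      powSum q c (n + 1) * ∑' k, w k * (q ^ (k + 1)) ^ n := by
    rw [powSum, ← tsum_mul_right]
    refine tsum_congr fun i => ?_
    have : ∀ k, w k * (q ^ (i + k + 1)) ^ n = (q ^ i) ^ n * (w k * (q ^ (k + 1)) ^ n) :=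
      fun k => by rw [add_assoc, pow_add q i, mul_pow]; ring
    simp_rw [this]
    rw [tsum_mul_left]
    ring
  rw [h2, h3] at h1
  linarith

theorem exp_le_one (h : DirichletSystem q Λ w c) (j : ℕ) {x : ℝ} (hx : 0 ≤ x) :
    |Real.exp (-(q ^ j)⁻¹ * x * Λ)| ≤ 1 := by
  have := h.q_pos
  have := h.Λ_pos
  rw [Real.abs_exp, Real.exp_le_one_iff, neg_mul, neg_mul, neg_nonpos]
  positivity

theorem summable_series (h : DirichletSystem q Λ w c) {x : ℝ} (hx : 0 ≤ x) :
    Summable (fun j => c j * Real.exp (-(q ^ j)⁻¹ * x * Λ)) :=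
  h.summable_mul fun j => h.exp_le_one j hx

theorem abs_series_le (h : DirichletSystem q Λ w c) {x : ℝ} (hx : 0 ≤ x) :
    |dirichletSeries q Λ c x| ≤ ∑' j, |c j| := by
  rw [← Real.norm_eq_abs]
  refine tsum_of_norm_bounded h.summable_abs.hasSum fun j => ?_
  rw [norm_mul, Real.norm_eq_abs, Real.norm_eq_abs]
  exact mul_le_of_le_one_right (abs_nonneg _) (h.exp_le_one j hx)

theorem continuousOn_series (h : DirichletSystem q Λ w c) :
    ContinuousOn (dirichletSeries q Λ c) (Ici 0) := by
  refine continuousOn_tsum (fun j => by fun_prop) h.summable_abs fun j x hx => ?_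
  rw [norm_mul, Real.norm_eq_abs, Real.norm_eq_abs]
  exact mul_le_of_le_one_right (abs_nonneg _) (h.exp_le_one j hx)

theorem intervalIntegrable_series (h : DirichletSystem q Λ w c) {x y : ℝ} (hx : 0 ≤ x)
    (hy : 0 ≤ y) : IntervalIntegrable (dirichletSeries q Λ c) volume x y :=
  (h.continuousOn_series.mono fun _ hz => (le_min hx hy).trans hz.1).intervalIntegrable

theorem integral_series (h : DirichletSystem q Λ w c) {x y : ℝ} (hx : 0 ≤ x) (hxy : x ≤ y) :
    ∫ t in x..y, dirichletSeries q Λ c t = ∑' j, c j * (q ^ j *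
      (Real.exp (-(q ^ j)⁻¹ * x * Λ) - Real.exp (-(q ^ j)⁻¹ * y * Λ)) / Λ) := by
  have hq := h.q_pos
  have hΛ := h.Λ_pos
  have h1 := intervalIntegral.hasSum_integral_of_dominated_convergence (μ := volume) (a := x)
    (b := y) (F := fun j t => c j * Real.exp (-(q ^ j)⁻¹ * t * Λ))
    (f := dirichletSeries q Λ c) (fun j _ => |c j|)
    (fun j => (by fun_prop : Continuous fun t => c j * Real.exp (-(q ^ j)⁻¹ * t * Λ)
      ).aestronglyMeasurable)
    (fun j => Eventually.of_forall fun t ht => ?_)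
    (Eventually.of_forall fun t _ => h.summable_abs) (by simp)
    (Eventually.of_forall fun t ht => (h.summable_series ?_).hasSum)
  · rw [← h1.tsum_eq]
    refine tsum_congr fun j => ?_
    rw [intervalIntegral.integral_const_mul]
    congr 1
    have h2 : ∀ t ∈ uIcc x y, HasDerivAt
        (fun t => -(q ^ j * Real.exp (-(q ^ j)⁻¹ * t * Λ) / Λ))
        (Real.exp (-(q ^ j)⁻¹ * t * Λ)) t := fun t _ => by
      have h3 := ((((hasDerivAt_id t).const_mul (-(q ^ j)⁻¹)).mul_const Λ).exp.const_mul
        (q ^ j)).div_const Λ |>.neg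
      refine h3.congr_deriv ?_
      simp only [id]
      field_simp
    rw [intervalIntegral.integral_eq_sub_of_hasDerivAt h2
      (Continuous.intervalIntegrable (by fun_prop) _ _)]
    ring
  · rw [uIoc_of_le hxy] at ht
    rw [norm_mul, Real.norm_eq_abs, Real.norm_eq_abs]
    exact mul_le_of_le_one_right (abs_nonneg _) (h.exp_le_one j (hx.trans ht.1.le))
  · rw [uIoc_of_le hxy] at ht
    exact hx.trans ht.1.le

theorem le_div_pow (h : DirichletSystem q Λ w c) {x : ℝ} (hx : 0 ≤ x) (k : ℕ) :
    x ≤ x / q ^ k := by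
  have := h.q_pos
  rw [le_div_iff₀ (by positivity)]
  exact mul_le_of_le_one_right hx (pow_le_one₀ this.le h.q_lt_one.le)

/-- Replacing x by x / q^{k+1} shifts the exponential of index i to index i + k + 1. Termwise
integration therefore produces the double sum of `tsum_mul_one_sub` with g(j) = exp(-q^{-j} x Λ). -/
theorem hasSum_functional_equation (h : DirichletSystem q Λ w c) {x : ℝ} (hx : 0 ≤ x) :
    HasSum (fun k => w k * ∫ t in x..(x / q ^ (k + 1)), dirichletSeries q Λ c t)
      (dirichletSeries q Λ c x) := by
  have hq := h.q_pos
  have hΛ := h.Λ_pos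
  set E : ℕ → ℝ := fun j => Real.exp (-(q ^ j)⁻¹ * x * Λ) with hE
  have hE1 : ∀ j, |E j| ≤ 1 := fun j => h.exp_le_one j hx
  have hterm : ∀ k, ∫ t in x..(x / q ^ (k + 1)), dirichletSeries q Λ c t =
      ∑' i, q ^ i * c i * (E i - E (i + k + 1)) / Λ := fun k => by
    rw [h.integral_series hx (h.le_div_pow hx _)]
    refine tsum_congr fun i => ?_
    have : -(q ^ i)⁻¹ * (x / q ^ (k + 1)) * Λ = -(q ^ (i + k + 1))⁻¹ * x * Λ := by
      rw [add_assoc, pow_add]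
      field_simp
      ring
    rw [this]
    ring
  have hs1 : Summable (fun p : ℕ × ℕ => q ^ p.1 * c p.1 * w p.2 * E p.1) := by
    have h1 : Summable (fun p : ℕ × ℕ => |c p.1| * w p.2) :=
      h.summable_abs.mul_of_nonneg h.hasSum.summable (fun _ => abs_nonneg _) h.w_nonneg
    refine Summable.of_norm_bounded h1 fun p => ?_
    have hq1 : q ^ p.1 ≤ 1 := pow_le_one₀ hq.le h.q_lt_one.le
    have hq0 : 0 ≤ q ^ p.1 := pow_nonneg hq.le _
    rw [Real.norm_eq_abs, abs_mul, abs_mul, abs_mul, abs_of_nonneg hq0,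
      abs_of_nonneg (h.w_nonneg _)]
    calc _ ≤ 1 * |c p.1| * w p.2 * 1 := by
          have := h.w_nonneg p.2
          gcongr
          exact hE1 _
      _ = _ := by ring
  have hs2 : Summable (fun p : ℕ × ℕ => w p.2 * (q ^ p.1 * c p.1 * (E p.1 - E (p.1 + p.2 + 1)) /
      Λ)) := by
    refine ((hs1.sub (h.summable_prod hE1)).div_const Λ).congr fun p => ?_
    ring
  have hs3 : Summable (fun p : ℕ × ℕ => w p.1 * (q ^ p.2 * c p.2 * (E p.2 - E (p.2 + p.1 + 1)) /
      Λ)) := (Equiv.prodComm ℕ ℕ).summable_iff.2 hs2 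
  have hval : ∑' k, w k * ∫ t in x..(x / q ^ (k + 1)), dirichletSeries q Λ c t =
      dirichletSeries q Λ c x := by
    simp_rw [hterm, ← tsum_mul_left]
    rw [Summable.tsum_comm (f := fun i k => w k * (q ^ i * c i * (E i - E (i + k + 1)) / Λ)) hs2]
    have h2 : ∀ i, ∑' k, w k * (q ^ i * c i * (E i - E (i + k + 1)) / Λ) =
        c i * (q ^ i * E i) - (q ^ i * c i * ∑' k, w k * E (i + k + 1)) * Λ⁻¹ := fun i => by
      have hsw : Summable (fun k => w k * E (i + k + 1)) := by
        refine Summable.of_norm_bounded h.hasSum.summable fun k => ?_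
        rw [Real.norm_eq_abs, abs_mul, abs_of_nonneg (h.w_nonneg k)]
        exact mul_le_of_le_one_right (h.w_nonneg k) (hE1 _)
      have h3 : ∀ k, w k * (q ^ i * c i * (E i - E (i + k + 1)) / Λ) =
          w k * (q ^ i * c i * E i / Λ) - (w k * E (i + k + 1)) * (q ^ i * c i / Λ) :=
        fun k => by ring
      simp_rw [h3]
      rw [(h.hasSum.summable.mul_right _).tsum_sub (hsw.mul_right _), tsum_mul_right,
        tsum_mul_right, h.hasSum.tsum_eq]
      field_simp
    simp_rw [h2]
    have hqE : ∀ j, |q ^ j * E j| ≤ 1 := fun j => by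
      rw [abs_mul, abs_of_pos (pow_pos hq j)]
      exact mul_le_one₀ (pow_le_one₀ hq.le h.q_lt_one.le) (abs_nonneg _) (hE1 j)
    have hs4 : Summable (fun i => q ^ i * c i * ∑' k, w k * E (i + k + 1)) := by
      refine (h.summable_prod hE1).prod.congr fun i => ?_
      rw [← tsum_mul_left]
      exact tsum_congr fun k => by ring
    rw [(h.summable_mul hqE).tsum_sub (hs4.mul_right _), tsum_mul_right]
    have h5 := h.tsum_mul_one_sub hE1
    have h6 : ∑' j, c j * (1 - q ^ j) * E j * Λ =
        (dirichletSeries q Λ c x - ∑' j, c j * (q ^ j * E j)) * Λ := by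
      rw [tsum_mul_right, dirichletSeries, ← (h.summable_mul hE1).tsum_sub (h.summable_mul hqE)]
      congr 1
      exact tsum_congr fun j => by ring
    rw [h6] at h5
    have h7 : ∑' i, q ^ i * c i * ∑' k, w k * E (i + k + 1) =
      -((dirichletSeries q Λ c x - ∑' j, c j * (q ^ j * E j)) * Λ) := by linarith
    rw [h7]
    field_simp
    ring
  rw [← hval]
  refine Summable.hasSum ?_
  simp_rw [hterm, ← tsum_mul_left]
  exact hs3.prod

/-- The leading term is e^{-Λx} since c_0 = 1, and all the others together are at most a constant
times e^{-Λx/q}, which is of smaller order. -/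
theorem series_pos_of_large (h : DirichletSystem q Λ w c) :
    ∃ x₀, 0 < x₀ ∧ ∀ x, x₀ ≤ x → 0 < dirichletSeries q Λ c x := by
  have hq := h.q_pos
  have hΛ := h.Λ_pos
  have hq1 : 1 < q⁻¹ := (one_lt_inv₀ hq).2 h.q_lt_one
  set S := ∑' j, |c j| with hS
  have hlim : Tendsto (fun x : ℝ => S * Real.exp (-((q⁻¹ - 1) * Λ) * x)) atTop (𝓝 (S * 0)) := by
    refine Tendsto.const_mul _ (Real.tendsto_exp_atBot.comp ?_)
    exact tendsto_id.const_mul_atTop_of_neg (neg_lt_zero.2 (by nlinarith))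
  rw [mul_zero] at hlim
  obtain ⟨x₁, hx₁⟩ := eventually_atTop.1 (hlim.eventually_lt_const zero_lt_one)
  refine ⟨max x₁ 1, by positivity, fun x hx => ?_⟩
  have hx0 : 0 ≤ x := zero_le_one.trans ((le_max_right _ _).trans hx)
  have hlt := hx₁ x ((le_max_left _ _).trans hx)
  rw [dirichletSeries, (h.summable_series hx0).tsum_eq_zero_add, h.c_zero]
  have hb : |∑' j, c (j + 1) * Real.exp (-(q ^ (j + 1))⁻¹ * x * Λ)| ≤
      (∑' j, |c (j + 1)|) * Real.exp (-q⁻¹ * x * Λ) := by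
    rw [← tsum_mul_right, ← Real.norm_eq_abs]
    refine tsum_of_norm_bounded
      (((summable_nat_add_iff 1).2 h.summable_abs).mul_right _).hasSum fun j => ?_
    rw [norm_mul, Real.norm_eq_abs, Real.norm_eq_abs, Real.abs_exp]
    gcongr
    exact pow_le_of_le_one hq.le h.q_lt_one.le (by lia)
  have hS' : ∑' j, |c (j + 1)| ≤ S := by
    rw [hS, h.summable_abs.tsum_eq_zero_add]
    linarith [abs_nonneg (c 0)]
  have he : Real.exp (-q⁻¹ * x * Λ) = Real.exp (-((q⁻¹ - 1) * Λ) * x) * Real.exp (-x * Λ) := by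
    rw [← Real.exp_add]
    ring_nf
  have hpos := Real.exp_pos (-x * Λ)
  have h3 : (∑' j, |c (j + 1)|) * Real.exp (-q⁻¹ * x * Λ) < Real.exp (-x * Λ) := by
    refine (mul_le_mul_of_nonneg_right hS' (Real.exp_pos _).le).trans_lt ?_
    rw [he, ← mul_assoc]
    exact mul_lt_of_lt_one_left hpos hlt
  have h4 := neg_abs_le (∑' j, c (j + 1) * Real.exp (-(q ^ (j + 1))⁻¹ * x * Λ))
  simp only [pow_zero, inv_one, one_mul, neg_mul] at *
  linarith

/-- At the last point s where the series is nonpositive, the functional equation writes its value as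
a sum of integrals over intervals to the right of s, where the series is positive. Some weight is
positive, so the value at s is positive, a contradiction. -/
theorem series_pos (h : DirichletSystem q Λ w c) {x : ℝ} (hx : 0 < x) :
    0 < dirichletSeries q Λ c x := by
  obtain ⟨x₀, hx₀, hlarge⟩ := h.series_pos_of_large
  by_contra hneg
  rw [not_lt] at hneg
  set A : Set ℝ := Icc x x₀ ∩ dirichletSeries q Λ c ⁻¹' Iic 0 with hA
  have hcont : ContinuousOn (dirichletSeries q Λ c) (Icc x x₀) :=
    h.continuousOn_series.mono fun y hy => hx.le.trans hy.1
  have hAc : IsClosed A := hcont.preimage_isClosed_of_isClosed isClosed_Icc isClosed_Iic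
  have hxx : x ≤ x₀ := by
    by_contra hlt
    exact absurd (hlarge x (not_le.1 hlt).le) (not_lt.2 hneg)
  have hAn : A.Nonempty := ⟨x, ⟨le_rfl, hxx⟩, hneg⟩
  have hAb : BddAbove A := ⟨x₀, fun y hy => hy.1.2⟩
  set s := sSup A with hs
  have hsA : s ∈ A := hAc.csSup_mem hAn hAb
  have hs0 : 0 < s := hx.trans_le hsA.1.1
  have hgt : ∀ y, s < y → 0 < dirichletSeries q Λ c y := fun y hy => by
    by_contra hy0
    rcases le_or_gt x₀ y with h1 | h1
    · exact hy0 (hlarge y h1)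
    · exact absurd (le_csSup hAb ⟨⟨hsA.1.1.trans hy.le, h1.le⟩, not_lt.1 hy0⟩) (not_le.2 hy)
  have hlt : ∀ k, s < s / q ^ (k + 1) := fun k => by
    rw [lt_div_iff₀ (pow_pos h.q_pos _)]
    exact mul_lt_of_lt_one_right hs0 (pow_lt_one₀ h.q_pos.le h.q_lt_one (by lia))
  have hIpos : ∀ k, 0 < ∫ t in s..(s / q ^ (k + 1)), dirichletSeries q Λ c t := fun k =>
    intervalIntegral.intervalIntegral_pos_of_pos_on
      (h.intervalIntegrable_series hs0.le (hs0.trans (hlt k)).le) (fun y hy => hgt y hy.1) (hlt k)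
  have hfe := h.hasSum_functional_equation hs0.le
  obtain ⟨k, hk⟩ : ∃ k, 0 < w k := by
    by_contra hk
    push Not at hk
    have : w = 0 := funext fun k => le_antisymm (hk k) (h.w_nonneg k)
    have h1 := h.hasSum
    rw [this] at h1
    exact h.Λ_pos.ne' (h1.unique hasSum_zero)
  have h1 := le_hasSum hfe k fun j _ => mul_nonneg (h.w_nonneg j) (hIpos j).le
  have h2 : dirichletSeries q Λ c s ≤ 0 := hsA.2
  exact absurd (mul_pos hk (hIpos k)) (not_lt.2 (h1.trans h2))

end DirichletSystem

/-! ### The normalised Dirichlet series as a probability density, and its moments. -/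

theorem integral_pow_mul_exp_neg_mul_Ioi (n : ℕ) {r : ℝ} (hr : 0 < r) :
    ∫ x in Ioi (0 : ℝ), x ^ n * Real.exp (-(r * x)) = n.factorial * r⁻¹ ^ (n + 1) := by
  have h := Real.integral_rpow_mul_exp_neg_mul_Ioi (a := n + 1) (by positivity) hr
  rw [Real.Gamma_nat_eq_factorial, one_div, mul_comm] at h
  rw [← Real.rpow_natCast r⁻¹ (n + 1), Nat.cast_succ, ← h]
  refine setIntegral_congr_fun measurableSet_Ioi fun x _ => ?_
  rw [add_sub_cancel_right, Real.rpow_natCast]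

/-- A Bochner integral with nonzero value can only come from an integrable function. -/
theorem integrableOn_pow_mul_exp_neg_mul_Ioi (n : ℕ) {r : ℝ} (hr : 0 < r) :
    IntegrableOn (fun x : ℝ => x ^ n * Real.exp (-(r * x))) (Ioi 0) := by
  by_contra h
  have h1 := integral_pow_mul_exp_neg_mul_Ioi n hr
  rw [integral_undef h] at h1
  have : 0 < (n.factorial : ℝ) * r⁻¹ ^ (n + 1) := by positivity
  exact this.ne h1

namespace DirichletSystem

variable {q Λ : ℝ} {w c : ℕ → ℝ}

theorem exponent_le (h : DirichletSystem q Λ w c) (j : ℕ) {x : ℝ} (hx : 0 ≤ x) :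
    -(q ^ j)⁻¹ * x * Λ ≤ -(Λ * x) := by
  have := h.q_pos
  have hΛ := h.Λ_pos
  have h1 : 1 ≤ (q ^ j)⁻¹ := (one_le_inv₀ (by positivity)).2 (pow_le_one₀ this.le h.q_lt_one.le)
  have : 0 ≤ Λ * x := by positivity
  nlinarith

theorem abs_series_le_exp (h : DirichletSystem q Λ w c) {x : ℝ} (hx : 0 ≤ x) :
    |dirichletSeries q Λ c x| ≤ (∑' j, |c j|) * Real.exp (-(Λ * x)) := by
  rw [← Real.norm_eq_abs, ← tsum_mul_right]
  refine tsum_of_norm_bounded (h.summable_abs.mul_right _).hasSum fun j => ?_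
  rw [norm_mul, Real.norm_eq_abs, Real.norm_eq_abs, Real.abs_exp]
  gcongr
  exact h.exponent_le j hx

theorem integrableOn_pow_mul_series (h : DirichletSystem q Λ w c) (n : ℕ) :
    IntegrableOn (fun x => x ^ n * dirichletSeries q Λ c x) (Ioi 0) := by
  refine ((integrableOn_pow_mul_exp_neg_mul_Ioi n h.Λ_pos).const_mul (∑' j, |c j|)).mono' ?_ ?_
  · refine ContinuousOn.aestronglyMeasurable ?_ measurableSet_Ioi
    exact (continuousOn_pow n).mul (h.continuousOn_series.mono Ioi_subset_Ici_self)
  · filter_upwards [ae_restrict_mem measurableSet_Ioi] with x hx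
    have hx0 : 0 ≤ x := le_of_lt hx
    rw [norm_mul, Real.norm_of_nonneg (by positivity), Real.norm_eq_abs]
    refine (mul_le_mul_of_nonneg_left (h.abs_series_le_exp hx0) (by positivity)).trans_eq ?_
    ring

theorem integral_pow_mul_series (h : DirichletSystem q Λ w c) (n : ℕ) :
    ∫ x in Ioi (0 : ℝ), x ^ n * dirichletSeries q Λ c x =
      n.factorial * Λ⁻¹ ^ (n + 1) * powSum q c (n + 1) := by
  have hq := h.q_pos
  have hΛ := h.Λ_pos
  have hrate : ∀ j, 0 < (q ^ j)⁻¹ * Λ := fun j => by positivity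
  have hfun : ∀ (j : ℕ) (x : ℝ), x ^ n * (c j * Real.exp (-(q ^ j)⁻¹ * x * Λ)) =
      c j * (x ^ n * Real.exp (-((q ^ j)⁻¹ * Λ * x))) := fun j x => by
    rw [show -(q ^ j)⁻¹ * x * Λ = -((q ^ j)⁻¹ * Λ * x) by ring]
    ring
  have key := hasSum_integral_of_summable_integral_norm (μ := volume.restrict (Ioi (0 : ℝ)))
    (F := fun (j : ℕ) (x : ℝ) => x ^ n * (c j * Real.exp (-(q ^ j)⁻¹ * x * Λ))) (fun j => ?_) ?_
  · have h1 : ∫ x in Ioi (0 : ℝ), x ^ n * dirichletSeries q Λ c x =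
        ∫ x in Ioi (0 : ℝ), ∑' j, x ^ n * (c j * Real.exp (-(q ^ j)⁻¹ * x * Λ)) :=
      setIntegral_congr_fun measurableSet_Ioi fun x _ => by
        rw [dirichletSeries, tsum_mul_left]
    rw [h1, ← key.tsum_eq, powSum, ← tsum_mul_left]
    refine tsum_congr fun j => ?_
    simp_rw [hfun]
    rw [integral_const_mul, integral_pow_mul_exp_neg_mul_Ioi n (hrate j), mul_inv, inv_inv,
      mul_pow]
    ring
  · simp_rw [hfun]
    exact (integrableOn_pow_mul_exp_neg_mul_Ioi n (hrate j)).const_mul _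
  · refine Summable.of_nonneg_of_le (fun j => integral_nonneg fun x => norm_nonneg _) (fun j => ?_)
      (h.summable_abs.mul_right (n.factorial * Λ⁻¹ ^ (n + 1)))
    rw [← integral_pow_mul_exp_neg_mul_Ioi n hΛ, ← integral_const_mul]
    refine setIntegral_mono_on ?_ ((integrableOn_pow_mul_exp_neg_mul_Ioi n hΛ).const_mul _)
      measurableSet_Ioi fun x hx => ?_
    · simp_rw [hfun]
      exact ((integrableOn_pow_mul_exp_neg_mul_Ioi n (hrate j)).const_mul _).norm
    · have hx0 : 0 ≤ x := le_of_lt hx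
      rw [norm_mul, norm_mul, Real.norm_of_nonneg (pow_nonneg hx0 n), Real.norm_eq_abs,
        Real.norm_eq_abs, Real.abs_exp, mul_left_comm]
      gcongr
      exact h.exponent_le j hx0

/-- Up to the factor 1/Λ this sum is the integral of the series, which is positive. This is the
nonvanishing of the normalising denominator. -/
theorem powSum_one_pos (h : DirichletSystem q Λ w c) : 0 < powSum q c 1 := by
  have h1 := h.integral_pow_mul_series 0
  simp only [pow_zero, one_mul, Nat.factorial_zero, Nat.cast_one, zero_add, pow_one] at h1
  have h2 := h.integrableOn_pow_mul_series 0
  simp only [pow_zero, one_mul] at h2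
  have h3 : 0 < ∫ x in Ioi (0 : ℝ), dirichletSeries q Λ c x := by
    rw [setIntegral_pos_iff_support_of_nonneg_ae
      ((ae_restrict_mem measurableSet_Ioi).mono fun x hx => (h.series_pos hx).le) h2]
    have h4 : Ioi (0 : ℝ) ⊆ Function.support (dirichletSeries q Λ c) ∩ Ioi 0 := fun x hx =>
      ⟨(h.series_pos hx).ne', hx⟩
    refine lt_of_lt_of_le ?_ (measure_mono h4)
    simp
  rw [h1] at h3
  exact (pos_iff_pos_of_mul_pos h3).1 (inv_pos.2 h.Λ_pos)

/-- The normalised Dirichlet series. -/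
noncomputable def density (q Λ : ℝ) (c : ℕ → ℝ) (x : ℝ) : ℝ :=
  Λ / powSum q c 1 * dirichletSeries q Λ c x

theorem density_pos (h : DirichletSystem q Λ w c) {x : ℝ} (hx : 0 < x) : 0 < density q Λ c x :=
  mul_pos (div_pos h.Λ_pos h.powSum_one_pos) (h.series_pos hx)

theorem continuousOn_density (h : DirichletSystem q Λ w c) :
    ContinuousOn (density q Λ c) (Ici 0) :=
  continuousOn_const.mul h.continuousOn_series

theorem hasSum_density (h : DirichletSystem q Λ w c) {x : ℝ} (hx : 0 ≤ x) :
    HasSum (fun k => w k * ∫ t in x..(x / q ^ (k + 1)), density q Λ c t) (density q Λ c x) := by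
  refine ((h.hasSum_functional_equation hx).mul_left (Λ / powSum q c 1)).congr_fun fun k => ?_
  simp only [density, intervalIntegral.integral_const_mul]
  ring

theorem density_le (h : DirichletSystem q Λ w c) {x : ℝ} (hx : 0 ≤ x) :
    density q Λ c x ≤ Λ / powSum q c 1 * ∑' j, |c j| :=
  mul_le_mul_of_nonneg_left ((le_abs_self _).trans (h.abs_series_le hx))
    (div_pos h.Λ_pos h.powSum_one_pos).le

/-- The law with density `DirichletSystem.density`. -/
noncomputable def law (q Λ : ℝ) (c : ℕ → ℝ) : Measure ℝ :=
  (volume.restrict (Ioi (0 : ℝ))).withDensity (fun x => ENNReal.ofReal (density q Λ c x))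

theorem powSum_succ (h : DirichletSystem q Λ w c) {Ψ : ℕ → ℝ}
    (hΨ : ∀ n, 1 ≤ n → 0 < Ψ n)
    (hΨw : ∀ n, Ψ n = Λ - ∑' k, w k * (q ^ (k + 1)) ^ n) (n : ℕ) :
    powSum q c (n + 1) = powSum q c 1 * Λ ^ n * ∏ j ∈ Finset.range n, (Ψ (j + 1))⁻¹ := by
  induction n with
  | zero => simp
  | succ n ih =>
    have h1 := h.mul_powSum (n + 1)
    have h2 := hΨ (n + 1) (by lia)
    rw [← hΨw, ih] at h1
    rw [Finset.prod_range_succ, ← mul_assoc, eq_mul_inv_iff_mul_eq₀ h2.ne', ← h1]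
    ring

/-- Normalising cancels the first power sum, and the iterated recursion supplies Λ^n against the
Λ^{-n} from the gamma integrals. -/
theorem hasMoments (h : DirichletSystem q Λ w c) {Ψ : ℕ → ℝ} (hΨ : ∀ n, 1 ≤ n → 0 < Ψ n)
    (hΨw : ∀ n, Ψ n = Λ - ∑' k, w k * (q ^ (k + 1)) ^ n) :
    HasMoments (law q Λ c) (fun n => n.factorial * ∏ j ∈ Finset.range n, (Ψ (j + 1))⁻¹) := by
  have hΛ := h.Λ_pos
  have hC := h.powSum_one_pos
  have hmeas : AEMeasurable (fun x => ENNReal.ofReal (density q Λ c x))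
      (volume.restrict (Ioi (0 : ℝ))) :=
    ((h.continuousOn_density.mono Ioi_subset_Ici_self).aemeasurable
      measurableSet_Ioi).ennreal_ofReal
  have hmom : ∀ n, ∫⁻ x, ENNReal.ofReal (x ^ n) ∂(law q Λ c) =
      ENNReal.ofReal (n.factorial * ∏ j ∈ Finset.range n, (Ψ (j + 1))⁻¹) := fun n => by
    have hv : (n.factorial : ℝ) * ∏ j ∈ Finset.range n, (Ψ (j + 1))⁻¹ =
        ∫ x in Ioi (0 : ℝ), Λ / powSum q c 1 * (x ^ n * dirichletSeries q Λ c x) := by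
      rw [integral_const_mul, h.integral_pow_mul_series, h.powSum_succ hΨ hΨw n, pow_succ, inv_pow]
      field_simp
    rw [law, lintegral_withDensity_eq_lintegral_mul₀ hmeas (by fun_prop), hv,
      ofReal_integral_eq_lintegral_ofReal ((h.integrableOn_pow_mul_series n).const_mul _)]
    · refine setLIntegral_congr_fun measurableSet_Ioi fun x hx => ?_
      rw [Pi.mul_apply, ← ENNReal.ofReal_mul (h.density_pos hx).le, density]
      congr 1
      ring
    · filter_upwards [ae_restrict_mem measurableSet_Ioi] with x hx
      have := h.series_pos hx
      have hx0 : 0 < x := hx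
      simp only [Pi.zero_apply]
      positivity
  refine ⟨⟨?_⟩, ?_, fun n => ?_, hmom⟩
  · simpa using hmom 0
  · refine (withDensity_absolutelyContinuous _ _).ae_le ?_
    filter_upwards [ae_restrict_mem measurableSet_Ioi] with x hx using le_of_lt hx
  · exact mul_nonneg (by positivity)
      (Finset.prod_nonneg fun j _ => (inv_pos.2 (hΨ _ (by lia))).le)

end DirichletSystem

/-! ### Rounding down to multiples of ε, and the discretised Lévy measure. -/

theorem iUnion_Ico_mul_succ {ε : ℝ} (hε : 0 < ε) :
    ⋃ k : ℕ, Ico (ε * ((k + 1 : ℕ) : ℝ)) (ε * ((k + 1 : ℕ) + 1)) = Ici ε := by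
  ext z
  simp only [mem_iUnion, mem_Ico, mem_Ici]
  constructor
  · rintro ⟨k, hk, -⟩
    refine le_trans ?_ hk
    push_cast
    nlinarith [k.cast_nonneg (α := ℝ)]
  · intro hz
    have hz1 : 1 ≤ z / ε := (one_le_div hε).2 hz
    have h1 : 1 ≤ ⌊z / ε⌋₊ := Nat.le_floor (by simpa using hz1)
    refine ⟨⌊z / ε⌋₊ - 1, ?_⟩
    rw [Nat.sub_add_cancel h1]
    have h2 := Nat.floor_le (zero_le_one.trans hz1)
    have h3 := Nat.lt_floor_add_one (z / ε)
    rw [le_div_iff₀ hε] at h2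
    rw [div_lt_iff₀ hε] at h3
    exact ⟨by linarith, by linarith⟩

theorem mul_floor_eq_of_mem_Ico {ε z : ℝ} (hε : 0 < ε) {k : ℕ}
    (hz : z ∈ Ico (ε * (k : ℝ)) (ε * (k + 1))) : ε * (⌊z / ε⌋ : ℤ) = ε * k := by
  have : ⌊z / ε⌋ = k := by
    rw [Int.floor_eq_iff, le_div_iff₀ hε, div_lt_iff₀ hε]
    push_cast
    exact ⟨by linarith [hz.1], by linarith [hz.2]⟩
  rw [this, Int.cast_natCast]

theorem pairwise_disjoint_Ico_mul {ε : ℝ} (hε : 0 < ε) :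
    Pairwise (fun i j : ℕ => Disjoint (Ico (ε * (i : ℝ)) (ε * (i + 1)))
      (Ico (ε * (j : ℝ)) (ε * (j + 1)))) := fun i j hij =>
  Set.disjoint_left.2 fun z hzi hzj => hij <| by
    have := (mul_floor_eq_of_mem_Ico hε hzi).symm.trans (mul_floor_eq_of_mem_Ico hε hzj)
    exact_mod_cast mul_left_cancel₀ hε.ne' this

theorem measurable_mul_floor (ε : ℝ) : Measurable (fun z : ℝ => ε * ((⌊z / ε⌋ : ℤ) : ℝ)) := by
  have h1 : Measurable (fun z : ℝ => ⌊z / ε⌋) := Int.measurable_floor.comp (measurable_id.div_const ε)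
  exact (measurable_from_top.comp h1 : Measurable (fun z : ℝ => ((⌊z / ε⌋ : ℤ) : ℝ))).const_mul ε

theorem mul_floor_le {ε z : ℝ} (hε : 0 < ε) : ε * (⌊z / ε⌋ : ℤ) ≤ z := by
  have := Int.floor_le (z / ε)
  rw [le_div_iff₀ hε] at this
  linarith

theorem sub_lt_mul_floor {ε z : ℝ} (hε : 0 < ε) : z - ε < ε * (⌊z / ε⌋ : ℤ) := by
  have := Int.lt_floor_add_one (z / ε)
  rw [div_lt_iff₀ hε] at this
  linarith

theorem mul_floor_nonneg {ε z : ℝ} (hε : 0 < ε) (hz : 0 ≤ z) : 0 ≤ ε * (⌊z / ε⌋ : ℤ) := by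
  have : (0 : ℤ) ≤ ⌊z / ε⌋ := Int.floor_nonneg.2 (by positivity)
  have : (0 : ℝ) ≤ (⌊z / ε⌋ : ℤ) := by exact_mod_cast this
  positivity

theorem le_mul_floor {ε z : ℝ} (hε : 0 < ε) (hz : ε ≤ z) : ε ≤ ε * (⌊z / ε⌋ : ℤ) := by
  have : (1 : ℤ) ≤ ⌊z / ε⌋ := Int.le_floor.2 (by rw [Int.cast_one]; exact (one_le_div hε).2 hz)
  have : (1 : ℝ) ≤ (⌊z / ε⌋ : ℤ) := by exact_mod_cast this
  nlinarith

theorem hasSum_binMass_mul {ν : Measure ℝ} {ε : ℝ} (hε : 0 < ε) {g : ℝ → ℝ}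
    (hg : IntegrableOn (fun z => g (ε * (⌊z / ε⌋ : ℤ))) (Ici ε) ν) :
    HasSum (fun k : ℕ => binMass ν ε (k + 1) * g (ε * ((k + 1 : ℕ) : ℝ)))
      (∫ z in Ici ε, g (ε * (⌊z / ε⌋ : ℤ)) ∂ν) := by
  rw [← iUnion_Ico_mul_succ hε] at hg ⊢
  refine (hasSum_integral_iUnion (fun k => measurableSet_Ico) ?_ hg).congr_fun fun k => ?_
  · exact fun i j hij => pairwise_disjoint_Ico_mul hε (fun h => hij (Nat.succ_injective h))
  · rw [setIntegral_congr_fun measurableSet_Ico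
      (g := fun _ => g (ε * ((k + 1 : ℕ) : ℝ))) fun z hz => by
        dsimp only; rw [mul_floor_eq_of_mem_Ico hε hz]]
    rw [setIntegral_const, smul_eq_mul, binMass, Measure.real]

/-- The Lévy measure of the discretised process: the image of `ν` on `[ε, ∞)` under
`z ↦ ε ⌊z / ε⌋`. -/
noncomputable def discretisedLevyMeasure (ν : Measure ℝ) (ε : ℝ) : Measure ℝ :=
  (ν.restrict (Ici ε)).map (fun z => ε * (⌊z / ε⌋ : ℤ))

section

variable {ν : Measure ℝ} {ε : ℝ}

theorem IsSubordinatorLevyMeasure.hasSum_binMass (hν : IsSubordinatorLevyMeasure ν) (hε : 0 < ε) :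
    HasSum (fun k : ℕ => binMass ν ε (k + 1)) (ν.real (Ici ε)) := by
  have h := hasSum_binMass_mul (ν := ν) hε (g := fun _ => 1)
    (integrableOn_const (hν.measure_Ici_lt_top hε).ne)
  simpa using h

theorem IsSubordinatorLevyMeasure.totalBinMass_eq (hν : IsSubordinatorLevyMeasure ν) (hε : 0 < ε) :
    totalBinMass ν ε = ν.real (Ici ε) :=
  (hν.hasSum_binMass hε).tsum_eq

theorem IsSubordinatorLevyMeasure.totalBinMass_pos (hν : IsSubordinatorLevyMeasure ν) (hε : 0 < ε)
    (h0 : 0 < ν (Ici ε)) : 0 < totalBinMass ν ε := by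
  rw [hν.totalBinMass_eq hε]
  exact ENNReal.toReal_pos h0.ne' (hν.measure_Ici_lt_top hε).ne

theorem binMass_nonneg (ν : Measure ℝ) (ε : ℝ) (k : ℕ) : 0 ≤ binMass ν ε k :=
  ENNReal.toReal_nonneg

theorem exp_neg_pow (ε : ℝ) (k : ℕ) : Real.exp (-ε) ^ k = Real.exp (-ε * k) := by
  rw [← Real.exp_nat_mul, mul_comm]

/-- The dictionary is q = e^{-ε}, with weights shifted by one because the bins start at k = 1. -/
theorem IsSubordinatorLevyMeasure.dirichletSystem (hν : IsSubordinatorLevyMeasure ν) (hε : 0 < ε)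
    (h0 : 0 < ν (Ici ε)) : DirichletSystem (Real.exp (-ε)) (totalBinMass ν ε)
      (fun k => binMass ν ε (k + 1)) (dirichletCoeff ν ε) where
  q_pos := Real.exp_pos _
  q_lt_one := by rw [Real.exp_lt_one_iff]; linarith
  w_nonneg k := binMass_nonneg _ _ _
  hasSum := by
    rw [hν.totalBinMass_eq hε]
    exact hν.hasSum_binMass hε
  Λ_pos := hν.totalBinMass_pos hε h0
  c_zero := dirichletCoeff_zero _ _
  c_succ j := by
    have hΛ := hν.totalBinMass_pos hε h0
    have hq : 0 < Real.exp (-ε) := Real.exp_pos _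
    have hq1 : Real.exp (-ε) < 1 := by rw [Real.exp_lt_one_iff]; linarith
    have hE : Real.exp (ε * ((j : ℝ) + 1)) = (Real.exp (-ε) ^ (j + 1))⁻¹ := by
      rw [exp_neg_pow, ← Real.exp_neg]
      push_cast
      ring_nf
    have hp : 0 < Real.exp (-ε) ^ (j + 1) := pow_pos hq _
    have hp1 : Real.exp (-ε) ^ (j + 1) < 1 := pow_lt_one₀ hq.le hq1 (by lia)
    rw [dirichletCoeff, hE, Fin.sum_univ_eq_sum_range
      (fun k => Real.exp (ε * ((k : ℝ) + 1)) * dirichletCoeff ν ε (j - k) * binMass ν ε (k + 1)),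
      ← Finset.sum_range_reflect]
    -- Reversing the sum turns the factor e^{ε(k+1)} into q^{-(j+1)} q^i with i = j - k, so the
    -- power q^{-(j+1)} comes out.
    have hsum : ∑ i ∈ Finset.range (j + 1), Real.exp (ε * (((j + 1 - 1 - i : ℕ) : ℝ) + 1)) *
        dirichletCoeff ν ε (j - (j + 1 - 1 - i)) * binMass ν ε (j + 1 - 1 - i + 1) =
        (Real.exp (-ε) ^ (j + 1))⁻¹ * ∑ i ∈ Finset.range (j + 1), Real.exp (-ε) ^ i *
          dirichletCoeff ν ε i * binMass ν ε (j - i + 1) := by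
      rw [Finset.mul_sum]
      refine Finset.sum_congr rfl fun i hi => ?_
      have hij : i ≤ j := by have := Finset.mem_range.1 hi; lia
      rw [Nat.add_sub_cancel, Nat.sub_sub_self hij, Nat.cast_sub hij, ← hE, exp_neg_pow,
        ← mul_assoc, ← mul_assoc, ← Real.exp_add]
      ring_nf
    rw [hsum]
    set p := Real.exp (-ε) ^ (j + 1)
    have h1 : 1 - p⁻¹ ≠ 0 := by
      have : 1 < p⁻¹ := (one_lt_inv₀ hp).2 hp1
      linarith
    have h2 : p - 1 ≠ 0 := by linarith
    field_simp
    ring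

theorem dirichletDensity_eq (ν : Measure ℝ) (ε : ℝ) : dirichletDensity ν ε =
    DirichletSystem.density (Real.exp (-ε)) (totalBinMass ν ε) (dirichletCoeff ν ε) := by
  funext x
  have hE : ∀ j : ℕ, Real.exp (ε * j) = (Real.exp (-ε) ^ j)⁻¹ := fun j => by
    rw [exp_neg_pow, ← Real.exp_neg]
    ring_nf
  simp only [dirichletDensity, DirichletSystem.density, DirichletSystem.powSum, dirichletSeries, hE,
    exp_neg_pow, pow_one]

theorem isSubordinatorLevyMeasure_discretised (hν : IsSubordinatorLevyMeasure ν) (hε : 0 < ε) :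
    IsSubordinatorLevyMeasure (discretisedLevyMeasure ν ε) where
  supp := by
    rw [discretisedLevyMeasure, Measure.map_apply (measurable_mul_floor ε) measurableSet_Iic,
      Measure.restrict_apply (measurable_mul_floor ε measurableSet_Iic)]
    convert measure_empty (μ := ν)
    ext z
    simp only [mem_inter_iff, mem_preimage, mem_Iic, mem_Ici, mem_empty_iff_false, iff_false,
      not_and, not_le]
    intro h1
    by_contra h2
    linarith [le_mul_floor hε (not_lt.1 h2)]
  lintegral_lt_top := by
    rw [discretisedLevyMeasure, lintegral_map (by fun_prop) (measurable_mul_floor ε)]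
    refine ((lintegral_mono fun z => ?_).trans (setLIntegral_le_lintegral _ _)).trans_lt
      hν.lintegral_lt_top
    exact ENNReal.ofReal_le_ofReal (min_le_min le_rfl (mul_floor_le hε))

theorem discretisedLevyMeasure_ne_zero (h0 : 0 < ν (Ici ε)) : discretisedLevyMeasure ν ε ≠ 0 := by
  intro h
  have h1 : discretisedLevyMeasure ν ε univ = 0 := by rw [h]; rfl
  rw [discretisedLevyMeasure, Measure.map_apply (measurable_mul_floor ε) MeasurableSet.univ,
    preimage_univ, Measure.restrict_apply_univ] at h1
  exact h0.ne' h1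

theorem setIntegral_discretisedLevyMeasure (hε : 0 < ε) {g : ℝ → ℝ} (hg : Measurable g) :
    ∫ z in Ioi 0, g z ∂(discretisedLevyMeasure ν ε) =
      ∫ z in Ici ε, g (ε * (⌊z / ε⌋ : ℤ)) ∂ν := by
  rw [discretisedLevyMeasure, setIntegral_map measurableSet_Ioi hg.aestronglyMeasurable
    (measurable_mul_floor ε).aemeasurable, Measure.restrict_restrict
    (measurable_mul_floor ε measurableSet_Ioi)]
  congr 2
  refine inter_eq_right.2 fun z hz => ?_
  exact hε.trans_le (le_mul_floor hε hz)

theorem laplaceExponent_discretised (hν : IsSubordinatorLevyMeasure ν) (hε : 0 < ε) {u : ℝ}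
    (hu : 0 ≤ u) : HasSum (fun k : ℕ => binMass ν ε (k + 1) *
      (1 - Real.exp (-u * (ε * ((k + 1 : ℕ) : ℝ))))) (laplaceExponent (discretisedLevyMeasure ν ε) u) := by
  rw [laplaceExponent, setIntegral_discretisedLevyMeasure hε (by fun_prop)]
  refine hasSum_binMass_mul hε (g := fun z => 1 - Real.exp (-u * z)) ?_
  have := (measurable_mul_floor ε)
  refine Integrable.mono' (g := fun _ => (1 : ℝ))
    (integrableOn_const (hν.measure_Ici_lt_top hε).ne)
    (Measurable.aestronglyMeasurable (by fun_prop)) ?_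
  filter_upwards [ae_restrict_mem measurableSet_Ici] with z hz
  have h1 := mul_floor_nonneg hε (hε.le.trans hz)
  have h2 := Real.exp_pos (-u * (ε * ((⌊z / ε⌋ : ℤ) : ℝ)))
  have h3 : Real.exp (-u * (ε * ((⌊z / ε⌋ : ℤ) : ℝ))) ≤ 1 := by
    rw [Real.exp_le_one_iff]
    nlinarith
  rw [Real.norm_of_nonneg (by linarith)]
  linarith

theorem laplaceExponent_discretised_eq (hν : IsSubordinatorLevyMeasure ν) (hε : 0 < ε) (n : ℕ) :
    laplaceExponent (discretisedLevyMeasure ν ε) n =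
      totalBinMass ν ε - ∑' k, binMass ν ε (k + 1) * (Real.exp (-ε) ^ (k + 1)) ^ n := by
  have h1 := laplaceExponent_discretised hν hε (Nat.cast_nonneg n)
  have h2 := hν.hasSum_binMass hε
  have h3 := h2.sub h1
  have h4 : (fun k : ℕ => binMass ν ε (k + 1) - binMass ν ε (k + 1) *
      (1 - Real.exp (-(n : ℝ) * (ε * ((k + 1 : ℕ) : ℝ))))) =
      fun k => binMass ν ε (k + 1) * (Real.exp (-ε) ^ (k + 1)) ^ n := by
    funext k
    rw [exp_neg_pow, ← Real.exp_nat_mul]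
    ring_nf
  rw [h4] at h3
  rw [h3.tsum_eq, hν.totalBinMass_eq hε]
  ring

/-- The law with density `dirichletDensity ν ε`. -/
noncomputable def dirichletLaw (ν : Measure ℝ) (ε : ℝ) : Measure ℝ :=
  (volume.restrict (Ioi (0 : ℝ))).withDensity (fun x => ENNReal.ofReal (dirichletDensity ν ε x))

theorem hasMoments_dirichletLaw (hν : IsSubordinatorLevyMeasure ν) (hε : 0 < ε)
    (h0 : 0 < ν (Ici ε)) :
    HasMoments (dirichletLaw ν ε) (expFunctionalMoment (discretisedLevyMeasure ν ε)) := by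
  rw [dirichletLaw, dirichletDensity_eq]
  exact (hν.dirichletSystem hε h0).hasMoments
    (Ψ := fun n => laplaceExponent (discretisedLevyMeasure ν ε) n)
    (fun n hn => (isSubordinatorLevyMeasure_discretised hν hε).laplaceExponent_pos
      (discretisedLevyMeasure_ne_zero h0) (by exact_mod_cast hn))
    (laplaceExponent_discretised_eq hν hε)

end

/-! ### The stationarity equation and the uniform local bound on its solutions. -/

theorem monotone_measureReal_Ioc_mul_exp (μ : Measure ℝ) [IsFiniteMeasure μ] {x : ℝ} (hx : 0 < x) :
    Monotone (fun z => μ.real (Ioc x (x * Real.exp z))) := fun z z' hz =>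
  measureReal_mono (Ioc_subset_Ioc_right (by gcongr))

/-- `φ x = ∫ μ((x, x e^{r z}]) ν(dz)`: the stationarity equation of the exponential functional,
along a rounding map `r`. -/
noncomputable def jumpAverage (ν μ : Measure ℝ) (r : ℝ → ℝ) (x : ℝ) : ℝ :=
  ∫ z in Ioi 0, μ.real (Ioc x (x * Real.exp (r z))) ∂ν

theorem exp_sub_one_le {z : ℝ} (hz : 0 ≤ z) (hz1 : z ≤ 1) :
    Real.exp z - 1 ≤ Real.exp 1 * z := by
  have h1 : -z + 1 ≤ Real.exp (-z) := Real.add_one_le_exp _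
  have h2 : Real.exp z * Real.exp (-z) = 1 := by rw [← Real.exp_add]; simp
  have h3 : Real.exp z ≤ Real.exp 1 := Real.exp_le_exp.2 hz1
  have h4 := Real.exp_pos z
  nlinarith

namespace IsSubordinatorLevyMeasure

variable {ν : Measure ℝ}

theorem integrableOn_id_Ioc (hν : IsSubordinatorLevyMeasure ν) {δ : ℝ} (hδ : δ ≤ 1) :
    IntegrableOn (fun z => z) (Ioc 0 δ) ν := by
  have h1 : IntegrableOn (fun z => min 1 z) (Ioc 0 δ) ν :=
    hν.integrable_min.mono_measure (Measure.restrict_mono Ioc_subset_Ioi_self le_rfl)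
  refine h1.congr_fun (fun z hz => ?_) measurableSet_Ioc
  exact min_eq_right (hz.2.trans hδ)

theorem measureReal_Ioi_le (hν : IsSubordinatorLevyMeasure ν) {δ : ℝ} (hδ : 0 < δ) (hδ1 : δ ≤ 1) :
    ν.real (Ioi δ) ≤ (∫ z in Ioi 0, min 1 z ∂ν) / δ := by
  have hfin : ν (Ioi δ) ≠ ∞ :=
    ((measure_mono Ioi_subset_Ici_self).trans_lt (hν.measure_Ici_lt_top hδ)).ne
  rw [le_div_iff₀ hδ]
  calc ν.real (Ioi δ) * δ = ∫ z in Ioi δ, δ ∂ν := by simp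
    _ ≤ ∫ z in Ioi δ, min 1 z ∂ν := by
        refine setIntegral_mono_on (integrableOn_const hfin)
          (hν.integrable_min.mono_measure (Measure.restrict_mono (Ioi_subset_Ioi hδ.le) le_rfl))
          measurableSet_Ioi fun z hz => le_min hδ1 (le_of_lt hz)
    _ ≤ ∫ z in Ioi 0, min 1 z ∂ν := by
        refine setIntegral_mono_set hν.integrable_min ?_ (Ioi_subset_Ioi hδ.le).eventuallyLE
        filter_upwards [ae_restrict_mem measurableSet_Ioi] with z hz
        exact le_min zero_le_one (le_of_lt hz)

theorem exists_smallJumps_le (hν : IsSubordinatorLevyMeasure ν) {η : ℝ} (hη : 0 < η) :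
    ∃ δ₀, 0 < δ₀ ∧ δ₀ ≤ 1 ∧ ∀ δ, δ ≤ δ₀ → ∫ z in Ioc 0 δ, z ∂ν ≤ η := by
  have h1 : Tendsto (fun n : ℕ => ∫ z in Ioc (0 : ℝ) (1 / ((n : ℝ) + 1)), z ∂ν) atTop
      (𝓝 (∫ z in ⋂ n : ℕ, Ioc (0 : ℝ) (1 / ((n : ℝ) + 1)), z ∂ν)) := by
    refine tendsto_setIntegral_of_antitone (fun n => measurableSet_Ioc) (fun m n hmn => ?_)
      ⟨0, hν.integrableOn_id_Ioc (by simp)⟩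
    exact Ioc_subset_Ioc_right (one_div_le_one_div_of_le (by positivity) (by gcongr))
  have h2 : ⋂ n : ℕ, Ioc (0 : ℝ) (1 / ((n : ℝ) + 1)) = ∅ := by
    refine eq_empty_of_forall_notMem fun z hz => ?_
    rw [mem_iInter] at hz
    obtain ⟨n, hn⟩ := exists_nat_one_div_lt (hz 0).1
    exact absurd (hz n).2 (not_le.2 hn)
  rw [h2, setIntegral_empty] at h1
  obtain ⟨n, hn⟩ := (h1.eventually_lt_const hη).exists
  have hn1 : 1 / ((n : ℝ) + 1) ≤ 1 := by
    rw [div_le_one (by positivity)]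
    linarith [n.cast_nonneg (α := ℝ)]
  refine ⟨1 / ((n : ℝ) + 1), by positivity, hn1, fun δ hδ => le_trans ?_ hn.le⟩
  refine setIntegral_mono_set (hν.integrableOn_id_Ioc hn1) ?_
    (Ioc_subset_Ioc_right hδ).eventuallyLE
  filter_upwards [ae_restrict_mem measurableSet_Ioc] with z hz using hz.1.le

/-- Since ν may have infinite mass near 0, integrability needs the linear bound on μ near x; for z ≥
1 the total mass 1 suffices. The explicit majorant does not depend on r and serves later as a
dominating function. -/
theorem integrable_jumpAverage (hν : IsSubordinatorLevyMeasure ν) {μ : Measure ℝ}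
    [IsProbabilityMeasure μ] {r : ℝ → ℝ} (hr : Measurable r) (hrz : ∀ z, 0 < z → r z ≤ z) {x C : ℝ}
    (hx : 0 < x) (hC : 0 ≤ C) (hμ : ∀ y, y ≤ x * Real.exp 1 → μ.real (Ioc x y) ≤ C * |y - x|) :
    (∀ z, 0 < z → ‖μ.real (Ioc x (x * Real.exp (r z)))‖ ≤ (1 + C * x * Real.exp 1) * min 1 z) ∧
    Integrable (fun z => μ.real (Ioc x (x * Real.exp (r z)))) (ν.restrict (Ioi 0)) := by
  have hb : ∀ z, 0 < z → ‖μ.real (Ioc x (x * Real.exp (r z)))‖ ≤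
      (1 + C * x * Real.exp 1) * min 1 z := fun z hz => by
    have hmono := monotone_measureReal_Ioc_mul_exp μ hx (hrz z hz)
    simp only at hmono
    rw [Real.norm_of_nonneg measureReal_nonneg]
    have h1 : μ.real (Ioc x (x * Real.exp z)) ≤ 1 := measureReal_le_one
    have he : 0 ≤ C * x * Real.exp 1 := by positivity
    rcases le_total 1 z with h | h
    · rw [min_eq_left h]
      linarith
    · rw [min_eq_right h]
      have h2 := hμ (x * Real.exp z) (by gcongr)
      have h3 : 1 ≤ Real.exp z := Real.one_le_exp hz.le
      rw [abs_of_nonneg (by nlinarith)] at h2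
      have h4 := exp_sub_one_le hz.le h
      have h5 : C * (x * Real.exp z - x) ≤ C * x * (Real.exp 1 * z) := by
        have : C * (x * Real.exp z - x) = C * x * (Real.exp z - 1) := by ring
        rw [this]
        gcongr
      nlinarith
  refine ⟨hb, (hν.integrable_min.const_mul (1 + C * x * Real.exp 1)).mono'
    (((monotone_measureReal_Ioc_mul_exp μ hx).measurable.comp hr).aestronglyMeasurable) ?_⟩
  filter_upwards [ae_restrict_mem measurableSet_Ioi] with z hz using hb z hz

/-- Densities solving the stationarity equation are locally bounded, uniformly in the equation. -/
theorem exists_density_bound (hν : IsSubordinatorLevyMeasure ν) {B : ℝ} (hB : 0 < B) :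
    ∃ C, 0 ≤ C ∧ ∀ (μ : Measure ℝ) [IsProbabilityMeasure μ] (r D : ℝ → ℝ) (M : ℝ),
      Measurable r → (∀ z, 0 < z → r z ≤ z) → (∀ x, 0 < x → D x = jumpAverage ν μ r x) →
      (∀ x, 0 < x → D x ≤ M) →
      (∀ x y S, 0 < x → x ≤ y → (∀ t ∈ Ioc x y, D t ≤ S) → μ.real (Ioc x y) ≤ S * (y - x)) →
      ∀ x, 0 < x → x ≤ B → D x ≤ C := by
  have he := Real.exp_pos 1
  -- The constant makes small jumps contribute a quarter of the local bound: one factor e comes from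
  -- x ≤ B e, the other from e^z - 1 ≤ e z.
  obtain ⟨δ₀, hδ₀, hδ₁, hsmall⟩ := hν.exists_smallJumps_le
    (η := 1 / (4 * (B * Real.exp 1 * Real.exp 1))) (by positivity)
  set κ := ∫ z in Ioi 0, min 1 z ∂ν with hκ
  have hκ0 : 0 ≤ κ := setIntegral_nonneg measurableSet_Ioi fun z hz =>
    le_min zero_le_one (le_of_lt hz)
  set a := 2 * κ / δ₀ with ha
  have ha0 : 0 ≤ a := by positivity
  refine ⟨2 * a, by positivity, fun μ _ r D M hr hrz hD hM hμ => ?_⟩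
  have hDn : ∀ x, 0 < x → 0 ≤ D x := fun x hx => by
    rw [hD x hx]
    exact setIntegral_nonneg measurableSet_Ioi fun z _ => measureReal_nonneg
  have hM0 : 0 ≤ M := (hDn 1 one_pos).trans (hM 1 one_pos)
  -- The endpoints B e^{δ₀ (1 - 2^{-k})} increase in k but stay below B e. At level k jumps are cut
  -- at δ = δ₀ 2^{-k-1}: larger ones contribute at most κ / δ = a 2^k, smaller ones at most a
  -- quarter of the bound at level k + 1. The bound 2 a 2^k reproduces itself, since its quarter at
  -- level k + 1 is again a 2^k, while M shrinks by 1/4 in each round. Letting n → ∞ at k = 0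
  -- removes M.
  have key : ∀ n k : ℕ, ∀ x, 0 < x → x ≤ B * Real.exp (δ₀ * (1 - (1 / 2) ^ k)) →
      D x ≤ 2 * a * 2 ^ k + (1 / 4) ^ n * M := by
    intro n
    induction n with
    | zero =>
      intro k x hx _
      have := hM x hx
      have : 0 ≤ 2 * a * 2 ^ k := by positivity
      simp only [pow_zero, one_mul]
      linarith
    | succ n ih =>
      intro k x hx hxB
      set δ := δ₀ * (1 / 2) ^ (k + 1) with hδ
      have hδ0 : 0 < δ := by positivity
      have hδδ : δ ≤ δ₀ := by
        rw [hδ]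
        exact mul_le_of_le_one_right hδ₀.le (pow_le_one₀ (by norm_num) (by norm_num))
      set S := 2 * a * 2 ^ (k + 1) + (1 / 4) ^ n * M with hS
      have hS0 : 0 ≤ S := by positivity
      have hBk : B * Real.exp (δ₀ * (1 - (1 / 2) ^ k)) * Real.exp δ =
          B * Real.exp (δ₀ * (1 - (1 / 2) ^ (k + 1))) := by
        rw [mul_assoc, ← Real.exp_add, hδ]
        congr 2
        ring
      have hxBe : x ≤ B * Real.exp 1 := by
        refine hxB.trans ?_
        gcongr
        have : (0 : ℝ) ≤ (1 / 2) ^ k := by positivity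
        nlinarith
      have hloc : ∀ z, 0 < z → z ≤ δ → μ.real (Ioc x (x * Real.exp (r z))) ≤
          S * x * Real.exp 1 * z := fun z hz hzδ => by
        have h1 := hμ x (x * Real.exp z) S hx (le_mul_of_one_le_right hx.le (Real.one_le_exp hz.le))
          fun t ht => ih (k + 1) t (hx.trans ht.1) <| by
            rw [← hBk]
            refine ht.2.trans ?_
            gcongr
        refine (monotone_measureReal_Ioc_mul_exp μ hx (hrz z hz)).trans (h1.trans ?_)
        have h2 := exp_sub_one_le hz.le (hzδ.trans (hδδ.trans hδ₁))
        have h3 : S * (x * Real.exp z - x) = S * x * (Real.exp z - 1) := by ring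
        rw [h3, mul_assoc (S * x)]
        gcongr
      have hfin : ν (Ioi δ) ≠ ∞ :=
        ((measure_mono Ioi_subset_Ici_self).trans_lt (hν.measure_Ici_lt_top hδ0)).ne
      have hI1 : IntegrableOn (fun z => S * x * Real.exp 1 * z) (Ioc 0 δ) ν :=
        (hν.integrableOn_id_Ioc (hδδ.trans hδ₁)).const_mul _
      have hmeas : Measurable (fun z => μ.real (Ioc x (x * Real.exp (r z)))) :=
        (monotone_measureReal_Ioc_mul_exp μ hx).measurable.comp hr
      have hG1 : IntegrableOn (fun z => μ.real (Ioc x (x * Real.exp (r z)))) (Ioc 0 δ) ν := by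
        refine hI1.mono' hmeas.aestronglyMeasurable ?_
        filter_upwards [ae_restrict_mem measurableSet_Ioc] with z hz
        rw [Real.norm_of_nonneg measureReal_nonneg]
        exact hloc z hz.1 hz.2
      have hG2 : IntegrableOn (fun z => μ.real (Ioc x (x * Real.exp (r z)))) (Ioi δ) ν := by
        refine (integrableOn_const (C := (1 : ℝ)) hfin).mono' hmeas.aestronglyMeasurable ?_
        refine Eventually.of_forall fun z => ?_
        rw [Real.norm_of_nonneg measureReal_nonneg]
        exact measureReal_le_one
      have hsplit : D x = ∫ z in Ioc 0 δ, μ.real (Ioc x (x * Real.exp (r z))) ∂ν +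
          ∫ z in Ioi δ, μ.real (Ioc x (x * Real.exp (r z))) ∂ν := by
        rw [hD x hx, jumpAverage, ← Ioc_union_Ioi_eq_Ioi hδ0.le,
          setIntegral_union (by
            rw [Set.disjoint_left]
            exact fun z hz hz' => absurd hz.2 (not_le.2 hz')) measurableSet_Ioi hG1 hG2]
      have hb1 : ∫ z in Ioc 0 δ, μ.real (Ioc x (x * Real.exp (r z))) ∂ν ≤ S * (1 / 4) := by
        calc _ ≤ ∫ z in Ioc 0 δ, S * x * Real.exp 1 * z ∂ν :=
              setIntegral_mono_on hG1 hI1 measurableSet_Ioc fun z hz => hloc z hz.1 hz.2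
          _ = S * x * Real.exp 1 * ∫ z in Ioc 0 δ, z ∂ν := integral_const_mul _ _
          _ ≤ S * (B * Real.exp 1) * Real.exp 1 * (1 / (4 * (B * Real.exp 1 * Real.exp 1))) := by
              have := hsmall δ hδδ
              have : 0 ≤ ∫ z in Ioc 0 δ, z ∂ν :=
                setIntegral_nonneg measurableSet_Ioc fun z hz => hz.1.le
              gcongr
          _ = S * (1 / 4) := by field_simp
      have hb2 : ∫ z in Ioi δ, μ.real (Ioc x (x * Real.exp (r z))) ∂ν ≤ a * 2 ^ k := by
        calc _ ≤ ∫ z in Ioi δ, (1 : ℝ) ∂ν :=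
              setIntegral_mono_on hG2 (integrableOn_const hfin) measurableSet_Ioi
                fun z _ => measureReal_le_one
          _ = ν.real (Ioi δ) := by simp
          _ ≤ κ / δ := hν.measureReal_Ioi_le hδ0 (hδδ.trans hδ₁)
          _ = a * 2 ^ k := by
              rw [ha, hδ, pow_succ, one_div, inv_pow]
              field_simp
      rw [hsplit]
      refine (add_le_add hb1 hb2).trans_eq ?_
      rw [hS]
      ring
  intro x hx hxB
  have hlim : Tendsto (fun n : ℕ => 2 * a * 2 ^ 0 + (1 / 4 : ℝ) ^ n * M) atTop
      (𝓝 (2 * a * 2 ^ 0 + 0 * M)) :=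
    tendsto_const_nhds.add
      ((tendsto_pow_atTop_nhds_zero_of_lt_one (by norm_num) (by norm_num)).mul_const M)
  have h1 := ge_of_tendsto' hlim fun n => key n 0 x hx (by simpa using hxB)
  simpa using h1

end IsSubordinatorLevyMeasure

/-! ### Dirichlet densities solve the stationarity equation; approximation of Laplace exponents. -/

section

variable {ν : Measure ℝ} {ε : ℝ}

theorem measureReal_dirichletLaw_Ioc (hν : IsSubordinatorLevyMeasure ν) (hε : 0 < ε)
    (h0 : 0 < ν (Ici ε)) {x y : ℝ} (hx : 0 ≤ x) (hxy : x ≤ y) :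
    (dirichletLaw ν ε).real (Ioc x y) = ∫ t in x..y, dirichletDensity ν ε t := by
  have h := hν.dirichletSystem hε h0
  have hsub : Ioc x y ⊆ Ioi 0 := fun t ht => hx.trans_lt ht.1
  rw [Measure.real, dirichletLaw, withDensity_apply _ measurableSet_Ioc,
    Measure.restrict_restrict measurableSet_Ioc, inter_eq_left.2 hsub,
    intervalIntegral.integral_of_le hxy, integral_eq_lintegral_of_nonneg_ae]
  · filter_upwards [ae_restrict_mem measurableSet_Ioc] with t ht
    rw [dirichletDensity_eq]
    exact (h.density_pos (hsub ht)).le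
  · rw [dirichletDensity_eq]
    exact (h.continuousOn_density.mono fun t ht => hx.trans ht.1.le).aestronglyMeasurable
      measurableSet_Ioc

theorem measureReal_dirichletLaw_Ioc_le (hν : IsSubordinatorLevyMeasure ν) (hε : 0 < ε)
    (h0 : 0 < ν (Ici ε)) {x y S : ℝ} (hx : 0 ≤ x) (hxy : x ≤ y)
    (hS : ∀ t ∈ Ioc x y, dirichletDensity ν ε t ≤ S) :
    (dirichletLaw ν ε).real (Ioc x y) ≤ S * (y - x) := by
  have h := hν.dirichletSystem hε h0
  rw [measureReal_dirichletLaw_Ioc hν hε h0 hx hxy]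
  have hint : IntervalIntegrable (dirichletDensity ν ε) volume x y := by
    rw [dirichletDensity_eq]
    exact (h.continuousOn_density.mono fun t ht =>
      (le_min hx (hx.trans hxy)).trans ht.1).intervalIntegrable
  calc _ ≤ ∫ t in x..y, S := by
        rw [intervalIntegral.integral_of_le hxy, intervalIntegral.integral_of_le hxy]
        exact setIntegral_mono_on ((intervalIntegrable_iff_integrableOn_Ioc_of_le hxy).1 hint)
          (integrableOn_const (by simp)) measurableSet_Ioc hS
    _ = _ := by rw [intervalIntegral.integral_const, smul_eq_mul, mul_comm]

theorem setIntegral_Ioi_mul_floor (hε : 0 < ε) {g : ℝ → ℝ} (hg : g 0 = 0) :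
    ∫ z in Ioi 0, g (ε * (⌊z / ε⌋ : ℤ)) ∂ν = ∫ z in Ici ε, g (ε * (⌊z / ε⌋ : ℤ)) ∂ν := by
  refine setIntegral_eq_of_subset_of_forall_sdiff_eq_zero measurableSet_Ioi
    (fun z hz => hε.trans_le hz) fun z hz => ?_
  have hz0 : 0 < z := hz.1
  have hz1 : z < ε := not_le.1 hz.2
  have : z ∈ Ico (ε * ((0 : ℕ) : ℝ)) (ε * ((0 : ℕ) + 1)) := by
    simp only [Nat.cast_zero, mul_zero, zero_add, mul_one]
    exact ⟨hz0.le, hz1⟩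
  rw [mul_floor_eq_of_mem_Ico hε this]
  simpa using hg

/-- This is the functional equation of the series with q^{-(k+1)} read as e^{ε(k+1)}, the effect of
a rounded jump. Jumps below ε round to 0 and give an empty interval. -/
theorem dirichletDensity_eq_jumpAverage (hν : IsSubordinatorLevyMeasure ν) (hε : 0 < ε)
    (h0 : 0 < ν (Ici ε)) {x : ℝ} (hx : 0 < x) :
    dirichletDensity ν ε x =
      jumpAverage ν (dirichletLaw ν ε) (fun z => ε * (⌊z / ε⌋ : ℤ)) x := by
  have h := hν.dirichletSystem hε h0
  have := (hasMoments_dirichletLaw hν hε h0).isProb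
  rw [jumpAverage, setIntegral_Ioi_mul_floor (ν := ν) hε
    (g := fun z => (dirichletLaw ν ε).real (Ioc x (x * Real.exp z))) (by simp)]
  have h1 := hasSum_binMass_mul (ν := ν) hε
    (g := fun z => (dirichletLaw ν ε).real (Ioc x (x * Real.exp z))) ?_
  · refine HasSum.unique ?_ h1
    rw [dirichletDensity_eq]
    refine (h.hasSum_density hx.le).congr_fun fun k => ?_
    have hy : x / Real.exp (-ε) ^ (k + 1) = x * Real.exp (ε * ((k + 1 : ℕ) : ℝ)) := by
      rw [exp_neg_pow, div_eq_mul_inv, ← Real.exp_neg]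
      ring_nf
    have hxy : x ≤ x * Real.exp (ε * ((k + 1 : ℕ) : ℝ)) :=
      le_mul_of_one_le_right hx.le (Real.one_le_exp (by positivity))
    rw [hy, measureReal_dirichletLaw_Ioc hν hε h0 hx.le hxy, dirichletDensity_eq]
  · refine (integrableOn_const (C := (1 : ℝ)) (hν.measure_Ici_lt_top hε).ne).mono'
      ((monotone_measureReal_Ioc_mul_exp _ hx).measurable.comp
        (measurable_mul_floor ε)).aestronglyMeasurable (Eventually.of_forall fun z => ?_)
    rw [Real.norm_of_nonneg measureReal_nonneg]
    exact measureReal_le_one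

theorem exists_dirichletDensity_bound (hν : IsSubordinatorLevyMeasure ν) (B : ℝ) :
    ∃ C, 0 ≤ C ∧ ∀ ε, 0 < ε → 0 < ν (Ici ε) → ∀ x, 0 < x → x ≤ B → dirichletDensity ν ε x ≤ C := by
  rcases le_or_gt B 0 with hB | hB
  · exact ⟨0, le_rfl, fun ε _ _ x hx hxB => absurd (hx.trans_le hxB) (not_lt.2 hB)⟩
  obtain ⟨C, hC, h⟩ := hν.exists_density_bound hB
  refine ⟨C, hC, fun ε hε h0 => ?_⟩
  have hs := hν.dirichletSystem hε h0
  have := (hasMoments_dirichletLaw hν hε h0).isProb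
  -- The a priori bound supplied here depends on ε, but the resulting C does not.
  refine h (dirichletLaw ν ε) (fun z => ε * (⌊z / ε⌋ : ℤ)) (dirichletDensity ν ε)
    (totalBinMass ν ε / DirichletSystem.powSum (Real.exp (-ε)) (dirichletCoeff ν ε) 1 *
      ∑' j, |dirichletCoeff ν ε j|)
    (measurable_mul_floor ε) (fun z _ => mul_floor_le hε)
    (fun x hx => dirichletDensity_eq_jumpAverage hν hε h0 hx) (fun x hx => ?_)
    (fun x y S hx hxy hS => measureReal_dirichletLaw_Ioc_le hν hε h0 hx.le hxy hS)
  rw [dirichletDensity_eq]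
  exact hs.density_le hx.le

theorem measureReal_dirichletLaw_Ioc_le' (hν : IsSubordinatorLevyMeasure ν) (hε : 0 < ε)
    (h0 : 0 < ν (Ici ε)) {x y B C : ℝ} (hC : 0 ≤ C) (hxy : x ≤ y) (hyB : y ≤ B)
    (hD : ∀ t, 0 < t → t ≤ B → dirichletDensity ν ε t ≤ C) :
    (dirichletLaw ν ε).real (Ioc x y) ≤ C * (y - x) := by
  have := (hasMoments_dirichletLaw hν hε h0).isProb
  rcases le_or_gt 0 y with hy | hy
  · have h1 : (dirichletLaw ν ε).real (Ioc x y) ≤ (dirichletLaw ν ε).real (Ioc (max x 0) y) := by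
      rw [Measure.real, Measure.real]
      refine ENNReal.toReal_mono (measure_ne_top _ _) (measure_mono_ae ?_)
      have h2 : ∀ᵐ t ∂(dirichletLaw ν ε), t ∈ Ioi (0 : ℝ) :=
        (withDensity_absolutelyContinuous _ _).ae_le (ae_restrict_mem measurableSet_Ioi)
      filter_upwards [h2] with t ht hxt
      exact ⟨max_lt hxt.1 ht, hxt.2⟩
    refine h1.trans ((measureReal_dirichletLaw_Ioc_le hν hε h0 (le_max_right _ _)
      (max_le hxy hy) (S := C) fun t ht => ?_).trans ?_)
    · exact hD t ((le_max_right _ _).trans_lt ht.1) (ht.2.trans hyB)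
    · gcongr
      exact le_max_left _ _
  · have h1 : (dirichletLaw ν ε).real (Ioc x y) = 0 := by
      rw [Measure.real, dirichletLaw, withDensity_apply _ measurableSet_Ioc,
        Measure.restrict_restrict measurableSet_Ioc]
      have : Ioc x y ∩ Ioi 0 = ∅ := by
        ext t
        simp only [mem_inter_iff, mem_Ioc, mem_Ioi, mem_empty_iff_false, iff_false]
        rintro ⟨⟨_, h2⟩, h3⟩
        linarith
      simp [this]
    rw [h1]
    exact mul_nonneg hC (by linarith)

theorem tendsto_mul_floor (z : ℝ) :
    Tendsto (fun ε : ℝ => ε * ((⌊z / ε⌋ : ℤ) : ℝ)) (𝓝[>] 0) (𝓝 z) := by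
  have h1 : Tendsto (fun ε : ℝ => z - ε) (𝓝[>] 0) (𝓝 z) := by
    have : Tendsto (fun ε : ℝ => z - ε) (𝓝 0) (𝓝 (z - 0)) := tendsto_const_nhds.sub tendsto_id
    rw [sub_zero] at this
    exact this.mono_left nhdsWithin_le_nhds
  refine tendsto_of_tendsto_of_tendsto_of_le_of_le' h1 tendsto_const_nhds ?_ ?_
  · filter_upwards [self_mem_nhdsWithin] with ε hε using (sub_lt_mul_floor hε).le
  · filter_upwards [self_mem_nhdsWithin] with ε hε using mul_floor_le hε

theorem tendsto_laplaceExponent_discretised (hν : IsSubordinatorLevyMeasure ν) {u : ℝ}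
    (hu : 0 ≤ u) : Tendsto (fun ε => laplaceExponent (discretisedLevyMeasure ν ε) u) (𝓝[>] 0)
      (𝓝 (laplaceExponent ν u)) := by
  have h1 : Tendsto (fun ε : ℝ => ∫ z in Ioi (0 : ℝ), (1 - Real.exp (-u * (ε * (⌊z / ε⌋ : ℤ)))) ∂ν)
      (𝓝[>] 0) (𝓝 (laplaceExponent ν u)) := by
    refine tendsto_integral_filter_of_dominated_convergence (fun z => (1 + u) * min 1 z) ?_ ?_
      (hν.integrable_min.const_mul _) ?_
    · refine Eventually.of_forall fun ε => ?_
      have := measurable_mul_floor ε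
      exact Measurable.aestronglyMeasurable (by fun_prop)
    · filter_upwards [self_mem_nhdsWithin] with ε hε
      filter_upwards [ae_restrict_mem measurableSet_Ioi] with z hz
      have hr0 := mul_floor_nonneg hε (le_of_lt hz)
      have h2 := IsSubordinatorLevyMeasure.one_sub_exp_le hu hr0
      rw [Real.norm_of_nonneg]
      · refine h2.trans ?_
        have := mul_floor_le (z := z) hε
        gcongr
      · rw [sub_nonneg, Real.exp_le_one_iff]
        nlinarith
    · refine Eventually.of_forall fun z => ?_
      exact tendsto_const_nhds.sub ((Real.continuous_exp.tendsto _).comp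
        ((tendsto_mul_floor z).const_mul (-u)))
  refine h1.congr' ?_
  filter_upwards [self_mem_nhdsWithin] with ε hε
  rw [laplaceExponent, setIntegral_discretisedLevyMeasure hε (by fun_prop),
    setIntegral_Ioi_mul_floor (ν := ν) hε (g := fun z => 1 - Real.exp (-u * z)) (by simp)]

theorem IsSubordinatorLevyMeasure.eventually_measure_Ici_pos (hν : IsSubordinatorLevyMeasure ν)
    (h0 : ν ≠ 0) : ∀ᶠ ε in 𝓝[>] (0 : ℝ), 0 < ν (Ici ε) := by
  obtain ⟨δ, hδ, hpos⟩ : ∃ δ, 0 < δ ∧ 0 < ν (Ici δ) := by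
    by_contra hcon
    push Not at hcon
    refine h0 (Measure.measure_univ_eq_zero.1 ?_)
    have h1 : (univ : Set ℝ) ⊆ Iic 0 ∪ ⋃ n : ℕ, Ici (1 / ((n : ℝ) + 1)) := fun z _ => by
      rcases le_or_gt z 0 with hz | hz
      · exact Or.inl hz
      · obtain ⟨n, hn⟩ := exists_nat_one_div_lt hz
        exact Or.inr (mem_iUnion.2 ⟨n, hn.le⟩)
    refine measure_mono_null h1 (measure_union_null hν.supp (measure_iUnion_null fun n => ?_))
    exact le_antisymm (hcon _ (by positivity)) (zero_le)
  filter_upwards [Ioc_mem_nhdsGT hδ] with ε hε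
  exact hpos.trans_le (measure_mono (Ici_subset_Ici.2 hε.2))

end

/-! ### Passage to the limit: weak convergence, then convergence of densities. -/

section

variable {ν μ : Measure ℝ}

theorem tendsto_expFunctionalMoment (hν : IsSubordinatorLevyMeasure ν) (h0 : ν ≠ 0) {ε : ℕ → ℝ}
    (hε : Tendsto ε atTop (𝓝[>] 0)) (n : ℕ) :
    Tendsto (fun i => expFunctionalMoment (discretisedLevyMeasure ν (ε i)) n) atTop
      (𝓝 (expFunctionalMoment ν n)) := by
  refine Tendsto.const_mul _ (tendsto_finsetProd _ fun j _ => ?_)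
  exact ((tendsto_laplaceExponent_discretised hν (Nat.cast_nonneg _)).comp hε).inv₀
    (hν.laplaceExponent_pos h0 (by positivity)).ne'

/-- The weak convergence of the Dirichlet laws along a sequence of admissible mesh sizes. -/
theorem exists_tendsto_dirichletLaw (hν : IsSubordinatorLevyMeasure ν) (h0 : ν ≠ 0)
    (hμ : HasMoments μ (expFunctionalMoment ν)) {ε : ℕ → ℝ} (hε : Tendsto ε atTop (𝓝[>] 0))
    (hεpos : ∀ i, 0 < ε i) (hmass : ∀ i, 0 < ν (Ici (ε i)))
    (hΨ : ∀ i, laplaceExponent ν 1 / 2 ≤ laplaceExponent (discretisedLevyMeasure ν (ε i)) 1) :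
    ∃ (m : ℕ → ProbabilityMeasure ℝ) (m₀ : ProbabilityMeasure ℝ),
      (∀ i, (m i : Measure ℝ) = dirichletLaw ν (ε i)) ∧ (m₀ : Measure ℝ) = μ ∧
        Tendsto m atTop (𝓝 m₀) := by
  have hpos := hν.laplaceExponent_pos h0 one_pos
  refine tendsto_measure_of_tendsto_moments
    (fun i => hasMoments_dirichletLaw hν (hεpos i) (hmass i)) hμ
    (b := (laplaceExponent ν 1 / 2)⁻¹) (by positivity)
    (fun i n => expFunctionalMoment_le (isSubordinatorLevyMeasure_discretised hν (hεpos i))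
      (by positivity) (hΨ i) n)
    (fun n => expFunctionalMoment_le hν (by positivity) (by linarith) n)
    (fun n => tendsto_expFunctionalMoment hν h0 hε n)

theorem eventually_admissible (hν : IsSubordinatorLevyMeasure ν) (h0 : ν ≠ 0) :
    ∀ᶠ ε in 𝓝[>] (0 : ℝ), 0 < ε ∧ 0 < ν (Ici ε) ∧
      laplaceExponent ν 1 / 2 ≤ laplaceExponent (discretisedLevyMeasure ν ε) 1 := by
  have hpos := hν.laplaceExponent_pos h0 one_pos
  filter_upwards [self_mem_nhdsWithin, hν.eventually_measure_Ici_pos h0,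
    (tendsto_laplaceExponent_discretised hν zero_le_one).eventually_const_le
      (half_lt_self hpos)] with ε h1 h2 h3 using ⟨h1, h2, h3⟩

theorem exists_admissible_seq (hν : IsSubordinatorLevyMeasure ν) (h0 : ν ≠ 0) :
    ∃ ε : ℕ → ℝ, Tendsto ε atTop (𝓝[>] 0) ∧ (∀ i, 0 < ε i) ∧ (∀ i, 0 < ν (Ici (ε i))) ∧
      ∀ i, laplaceExponent ν 1 / 2 ≤ laplaceExponent (discretisedLevyMeasure ν (ε i)) 1 := by
  obtain ⟨ε, hε, h⟩ := exists_seq_forall_of_frequently (eventually_admissible hν h0).frequently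
  exact ⟨ε, hε, fun i => (h i).1, fun i => (h i).2.1, fun i => (h i).2.2⟩

/-- The exponential functional has a locally bounded density. -/
theorem HasMoments.exists_Ioc_bound (hμ : HasMoments μ (expFunctionalMoment ν))
    (hν : IsSubordinatorLevyMeasure ν) (h0 : ν ≠ 0) (B : ℝ) :
    ∃ C, 0 ≤ C ∧ (∀ x y, x ≤ y → y ≤ B → μ.real (Ioc x y) ≤ C * (y - x)) ∧
      (∀ ε, 0 < ε → 0 < ν (Ici ε) → ∀ x y, x ≤ y → y ≤ B →
        (dirichletLaw ν ε).real (Ioc x y) ≤ C * (y - x)) ∧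
      ∀ ε, 0 < ε → 0 < ν (Ici ε) → ∀ x, 0 < x → x ≤ B → dirichletDensity ν ε x ≤ C := by
  have := hμ.isProb
  -- Weak convergence bounds limits of open sets only, so (x, y] is enlarged to (x, y + η) with η ≤
  -- 1; the extra unit leaves room for it.
  obtain ⟨C, hC, hD⟩ := exists_dirichletDensity_bound hν (B + 1)
  have hlaw : ∀ ε, 0 < ε → 0 < ν (Ici ε) → ∀ x y, x ≤ y → y ≤ B + 1 →
      (dirichletLaw ν ε).real (Ioc x y) ≤ C * (y - x) := fun ε hε h x y hxy hy =>
    measureReal_dirichletLaw_Ioc_le' hν hε h hC hxy hy (hD ε hε h)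
  refine ⟨C, hC, fun x y hxy hy => ?_, fun ε hε h x y hxy hy => hlaw ε hε h x y hxy (by linarith),
    fun ε hε h x hx hxB => hD ε hε h x hx (by linarith)⟩
  obtain ⟨ε, hε, hεpos, hmass, hΨ⟩ := exists_admissible_seq hν h0
  obtain ⟨m, m₀, hm, hm₀, hlim⟩ := exists_tendsto_dirichletLaw hν h0 hμ hε hεpos hmass hΨ
  have hopen : ∀ η : ℝ, 0 < η → η ≤ 1 → μ.real (Ioc x y) ≤ C * (y + η - x) := fun η hη hη1 => by
    have h1 := ProbabilityMeasure.le_liminf_measure_open_of_tendsto hlim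
      (isOpen_Ioo (a := x) (b := y + η))
    rw [hm₀] at h1
    have h2 : liminf (fun i => (m i : Measure ℝ) (Ioo x (y + η))) atTop ≤
        ENNReal.ofReal (C * (y + η - x)) := by
      refine liminf_le_of_le (by isBoundedDefault) fun b hb => ?_
      obtain ⟨i, hi⟩ := hb.exists
      refine hi.trans ?_
      have := (hasMoments_dirichletLaw hν (hεpos i) (hmass i)).isProb
      rw [hm]
      refine (measure_mono Ioo_subset_Ioc_self).trans ?_
      rw [← ofReal_measureReal (measure_ne_top _ _)]
      exact ENNReal.ofReal_le_ofReal (hlaw _ (hεpos i) (hmass i) _ _ (by linarith) (by linarith))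
    have h3 : μ (Ioc x y) ≤ ENNReal.ofReal (C * (y + η - x)) :=
      (measure_mono fun t (ht : t ∈ Ioc x y) => (⟨ht.1, ht.2.trans_lt (by linarith)⟩ :
        t ∈ Ioo x (y + η))).trans (h1.trans h2)
    exact ENNReal.toReal_le_of_le_ofReal (mul_nonneg hC (by linarith)) h3
  have hcont : Tendsto (fun η : ℝ => C * (y + η - x)) (𝓝[>] 0) (𝓝 (C * (y + 0 - x))) :=
    (Continuous.tendsto (by fun_prop) 0).mono_left nhdsWithin_le_nhds
  rw [add_zero] at hcont
  refine ge_of_tendsto hcont ?_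
  filter_upwards [Ioc_mem_nhdsGT (zero_lt_one (α := ℝ))] with η hη using hopen η hη.1 hη.2

/-- Intervals shrinking to a point have mass at most C times their length. Without atoms, every
half-open interval has null frontier and weak convergence applies to it. -/
theorem HasMoments.nullSingletonClass (hμ : HasMoments μ (expFunctionalMoment ν))
    (hν : IsSubordinatorLevyMeasure ν) (h0 : ν ≠ 0) : NullSingletonClass μ := by
  have := hμ.isProb
  refine ⟨fun y => ?_⟩
  obtain ⟨C, -, hC, -⟩ := hμ.exists_Ioc_bound hν h0 y
  have h1 : ∀ η : ℝ, 0 < η → μ.real {y} ≤ C * η := fun η hη => by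
    refine (measureReal_mono (s₂ := Ioc (y - η) y) ?_).trans
      ((hC (y - η) y (by linarith) le_rfl).trans_eq (by ring))
    rintro _ rfl
    exact ⟨by linarith, le_rfl⟩
  have hcont : Tendsto (fun η : ℝ => C * η) (𝓝[>] 0) (𝓝 (C * 0)) :=
    (Continuous.tendsto (by fun_prop) 0).mono_left nhdsWithin_le_nhds
  rw [mul_zero] at hcont
  have h2 : μ.real {y} ≤ 0 := by
    refine ge_of_tendsto hcont ?_
    filter_upwards [self_mem_nhdsWithin] with η hη using h1 η hη
  exact (measureReal_eq_zero_iff (measure_ne_top _ _)).1 (le_antisymm h2 measureReal_nonneg)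

theorem tendsto_measureReal_Ioc (hν : IsSubordinatorLevyMeasure ν) (h0 : ν ≠ 0)
    (hμ : HasMoments μ (expFunctionalMoment ν)) {ε : ℕ → ℝ} (hε : Tendsto ε atTop (𝓝[>] 0))
    (hεpos : ∀ i, 0 < ε i) (hmass : ∀ i, 0 < ν (Ici (ε i)))
    (hΨ : ∀ i, laplaceExponent ν 1 / 2 ≤ laplaceExponent (discretisedLevyMeasure ν (ε i)) 1)
    (x y : ℝ) :
    Tendsto (fun i => (dirichletLaw ν (ε i)).real (Ioc x y)) atTop (𝓝 (μ.real (Ioc x y))) := by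
  have := hμ.isProb
  have := hμ.nullSingletonClass hν h0
  obtain ⟨m, m₀, hm, hm₀, hlim⟩ := exists_tendsto_dirichletLaw hν h0 hμ hε hεpos hmass hΨ
  have hfr : (m₀ : Measure ℝ) (frontier (Ioc x y)) = 0 := by
    rw [hm₀]
    rcases lt_or_ge x y with h | h
    · rw [frontier_Ioc h]
      exact ((Set.toFinite {x, y}).countable).measure_zero μ
    · simp [Ioc_eq_empty (not_lt.2 h)]
  have h1 := ProbabilityMeasure.tendsto_measure_of_null_frontier_of_tendsto' hlim hfr
  have h2 := (ENNReal.tendsto_toReal (measure_ne_top _ _)).comp h1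
  simpa only [Function.comp_def, hm, hm₀, Measure.real] using h2

/-- Dominated convergence in the stationarity equation. For fixed z both the law and the endpoint of
the interval move; weak convergence handles the first, and the density bound uniform in ε handles
the second. -/
theorem tendsto_dirichletDensity_seq (hν : IsSubordinatorLevyMeasure ν) (h0 : ν ≠ 0)
    (hμ : HasMoments μ (expFunctionalMoment ν)) {ε : ℕ → ℝ} (hε : Tendsto ε atTop (𝓝[>] 0))
    (hεpos : ∀ i, 0 < ε i) (hmass : ∀ i, 0 < ν (Ici (ε i)))
    (hΨ : ∀ i, laplaceExponent ν 1 / 2 ≤ laplaceExponent (discretisedLevyMeasure ν (ε i)) 1)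
    {x : ℝ} (hx : 0 < x) :
    Tendsto (fun i => dirichletDensity ν (ε i) x) atTop (𝓝 (jumpAverage ν μ id x)) := by
  have := hμ.isProb
  simp_rw [fun i => dirichletDensity_eq_jumpAverage hν (hεpos i) (hmass i) hx]
  obtain ⟨C, hC, -, hlaw, -⟩ := hμ.exists_Ioc_bound hν h0 (x * Real.exp 1)
  have hprob : ∀ i, IsProbabilityMeasure (dirichletLaw ν (ε i)) := fun i =>
    (hasMoments_dirichletLaw hν (hεpos i) (hmass i)).isProb
  have hbd : ∀ i y, y ≤ x * Real.exp 1 → (dirichletLaw ν (ε i)).real (Ioc x y) ≤ C * |y - x| :=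
    fun i y hy => by
      rcases le_total x y with h | h
      · rw [abs_of_nonneg (by linarith)]
        exact hlaw _ (hεpos i) (hmass i) _ _ h hy
      · rw [Ioc_eq_empty (not_lt.2 h), measureReal_empty]
        positivity
  refine tendsto_integral_of_dominated_convergence (fun z => (1 + C * x * Real.exp 1) * min 1 z)
    (fun i => (hν.integrable_jumpAverage (measurable_mul_floor (ε i))
      (fun z _ => mul_floor_le (hεpos i)) hx hC (hbd i)).2.aestronglyMeasurable)
    (hν.integrable_min.const_mul _) (fun i => ?_) ?_
  · filter_upwards [ae_restrict_mem measurableSet_Ioi] with z hz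
    exact (hν.integrable_jumpAverage (measurable_mul_floor (ε i))
      (fun z _ => mul_floor_le (hεpos i)) hx hC (hbd i)).1 z hz
  · filter_upwards [ae_restrict_mem measurableSet_Ioi] with z hz
    -- The endpoint x e^z is unbounded in z, so this constant depends on z; only pointwise
    -- convergence is at stake here.
    obtain ⟨C', hC', -, hlaw', -⟩ := hμ.exists_Ioc_bound hν h0 (x * Real.exp z)
    have h1 := tendsto_measureReal_Ioc hν h0 hμ hε hεpos hmass hΨ x (x * Real.exp z)
    have hr : Tendsto (fun i => x * Real.exp (ε i * (⌊z / ε i⌋ : ℤ))) atTop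
        (𝓝 (x * Real.exp z)) :=
      ((Real.continuous_exp.tendsto z).comp ((tendsto_mul_floor z).comp hε)).const_mul x
    have h2 : Tendsto (fun i => C' * (x * Real.exp z - x * Real.exp (ε i * (⌊z / ε i⌋ : ℤ))))
        atTop (𝓝 (C' * (x * Real.exp z - x * Real.exp z))) :=
      (tendsto_const_nhds.sub hr).const_mul C'
    rw [sub_self, mul_zero] at h2
    have h3 := h1.sub h2
    rw [sub_zero] at h3
    refine tendsto_of_tendsto_of_tendsto_of_le_of_le h3 h1 (fun i => ?_) (fun i => ?_)
    · have hle : x * Real.exp (ε i * (⌊z / ε i⌋ : ℤ)) ≤ x * Real.exp z := by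
        have := mul_floor_le (z := z) (hεpos i)
        gcongr
      have h4 := hlaw' _ (hεpos i) (hmass i) _ _ hle le_rfl
      have h5 : (dirichletLaw ν (ε i)).real (Ioc x (x * Real.exp z)) ≤
          (dirichletLaw ν (ε i)).real (Ioc x (x * Real.exp (ε i * (⌊z / ε i⌋ : ℤ)))) +
          (dirichletLaw ν (ε i)).real
            (Ioc (x * Real.exp (ε i * (⌊z / ε i⌋ : ℤ))) (x * Real.exp z)) :=
        (measureReal_mono Ioc_subset_Ioc_union_Ioc).trans (measureReal_union_le _ _)
      dsimp only
      linarith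
    · exact monotone_measureReal_Ioc_mul_exp _ hx (mul_floor_le (hεpos i))

theorem tendsto_dirichletDensity (hν : IsSubordinatorLevyMeasure ν) (h0 : ν ≠ 0)
    (hμ : HasMoments μ (expFunctionalMoment ν)) {x : ℝ} (hx : 0 < x) :
    Tendsto (fun ε => dirichletDensity ν ε x) (𝓝[>] 0) (𝓝 (jumpAverage ν μ id x)) := by
  refine tendsto_of_seq_tendsto fun ε hε => ?_
  obtain ⟨N, hN⟩ := eventually_atTop.1 (hε.eventually (eventually_admissible hν h0))
  rw [← tendsto_add_atTop_iff_nat N]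
  exact tendsto_dirichletDensity_seq hν h0 hμ (hε.comp (tendsto_add_atTop_nat N))
    (fun i => (hN _ (by lia)).1) (fun i => (hN _ (by lia)).2.1) (fun i => (hN _ (by lia)).2.2) hx

theorem jumpAverage_nonneg (x : ℝ) : 0 ≤ jumpAverage ν μ id x :=
  setIntegral_nonneg measurableSet_Ioi fun _ _ => measureReal_nonneg

theorem HasMoments.measureReal_Ioc_le_mul_abs (hμ : HasMoments μ (expFunctionalMoment ν))
    (hν : IsSubordinatorLevyMeasure ν) (h0 : ν ≠ 0) (B : ℝ) :
    ∃ C, 0 ≤ C ∧ ∀ x y, y ≤ B → μ.real (Ioc x y) ≤ C * |y - x| := by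
  obtain ⟨C, hC, h, -⟩ := hμ.exists_Ioc_bound hν h0 B
  refine ⟨C, hC, fun x y hy => ?_⟩
  rcases le_total x y with hxy | hxy
  · rw [abs_of_nonneg (by linarith)]
    exact h x y hxy hy
  · rw [Ioc_eq_empty (not_lt.2 hxy), measureReal_empty]
    positivity

/-- The distribution function is locally Lipschitz, so for each z the integrand is continuous in x.
The same Lipschitz bound gives a majorant uniform near x₀. -/
theorem HasMoments.continuousOn_jumpAverage (hμ : HasMoments μ (expFunctionalMoment ν))
    (hν : IsSubordinatorLevyMeasure ν) (h0 : ν ≠ 0) :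
    ContinuousOn (jumpAverage ν μ id) (Ioi 0) := by
  have := hμ.isProb
  have hcdf : Continuous (fun x => μ.real (Iic x)) := by
    refine continuous_iff_continuousAt.2 fun x₀ => ?_
    obtain ⟨C, hC, hb⟩ := hμ.measureReal_Ioc_le_mul_abs hν h0 (x₀ + 1)
    have hdiff : ∀ x y, x ≤ y → μ.real (Iic y) - μ.real (Iic x) = μ.real (Ioc x y) :=
      fun x y hxy => by
        rw [← Iic_union_Ioc_eq_Iic hxy, measureReal_union (by
          rw [Set.disjoint_left]
          exact fun z hz hz' => absurd hz'.1 (not_lt.2 hz)) measurableSet_Ioc]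
        ring
    have hlip : LipschitzOnWith (Real.toNNReal C) (fun x => μ.real (Iic x)) (Iic (x₀ + 1)) := by
      refine LipschitzOnWith.of_dist_le_mul fun x hx y hy => ?_
      rw [Real.dist_eq, Real.dist_eq, Real.coe_toNNReal _ hC]
      rcases le_total x y with h | h
      · rw [abs_sub_comm, hdiff x y h, abs_of_nonneg measureReal_nonneg, abs_sub_comm]
        exact hb x y hy
      · rw [hdiff y x h, abs_of_nonneg measureReal_nonneg]
        exact hb y x hx
    exact hlip.continuousOn.continuousAt (Iic_mem_nhds (by linarith))
  intro x₀ hx₀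
  have hx₀' : 0 < x₀ := hx₀
  refine ContinuousAt.continuousWithinAt ?_
  obtain ⟨C, hC, hb⟩ := hμ.measureReal_Ioc_le_mul_abs hν h0 (2 * x₀ * Real.exp 1)
  have hnear : ∀ᶠ x in 𝓝 x₀, 0 < x ∧ x ≤ 2 * x₀ := by
    filter_upwards [Ioc_mem_nhds hx₀' (show x₀ < 2 * x₀ by linarith)] with x hx using hx
  have hbx : ∀ x, 0 < x → x ≤ 2 * x₀ → ∀ y, y ≤ x * Real.exp 1 →
      μ.real (Ioc x y) ≤ C * |y - x| := fun x _ hx2 y hy =>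
    hb x y (hy.trans (by gcongr))
  refine continuousAt_of_dominated (bound := fun z => (1 + C * (2 * x₀) * Real.exp 1) * min 1 z)
    ?_ ?_ (hν.integrable_min.const_mul _) ?_
  · filter_upwards [hnear] with x hx
    exact (hν.integrable_jumpAverage measurable_id (fun z _ => le_rfl) hx.1 hC
      (hbx x hx.1 hx.2)).2.aestronglyMeasurable
  · filter_upwards [hnear] with x hx
    filter_upwards [ae_restrict_mem measurableSet_Ioi] with z hz
    refine ((hν.integrable_jumpAverage measurable_id (fun z _ => le_rfl) hx.1 hC
      (hbx x hx.1 hx.2)).1 z hz).trans ?_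
    have : 0 ≤ min 1 z := le_min zero_le_one (le_of_lt hz)
    have := hx.2
    gcongr
  · filter_upwards [ae_restrict_mem measurableSet_Ioi] with z hz
    have heq : (fun x => μ.real (Iic (x * Real.exp z)) - μ.real (Iic x)) =ᶠ[𝓝 x₀]
        (fun x => μ.real (Ioc x (x * Real.exp (id z)))) := by
      filter_upwards [hnear] with x hx
      have hxy : x ≤ x * Real.exp z := le_mul_of_one_le_right hx.1.le (Real.one_le_exp (le_of_lt hz))
      rw [← Iic_union_Ioc_eq_Iic hxy, measureReal_union (by
          rw [Set.disjoint_left]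
          exact fun z hz hz' => absurd hz'.1 (not_lt.2 hz)) measurableSet_Ioc, id]
      ring
    refine ContinuousAt.congr (Continuous.continuousAt ?_) heq
    exact (hcdf.comp (by fun_prop)).sub hcdf

/-- The law of the exponential functional has density `jumpAverage ν μ id`. -/
theorem HasMoments.eq_withDensity (hμ : HasMoments μ (expFunctionalMoment ν))
    (hν : IsSubordinatorLevyMeasure ν) (h0 : ν ≠ 0) :
    μ = (volume.restrict (Ioi (0 : ℝ))).withDensity
      (fun x => ENNReal.ofReal (jumpAverage ν μ id x)) := by
  have := hμ.isProb
  have := hμ.nullSingletonClass hν h0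
  obtain ⟨ε, hε, hεpos, hmass, hΨ⟩ := exists_admissible_seq hν h0
  have hcont := hμ.continuousOn_jumpAverage hν h0
  have hpos : ∀ a b, 0 ≤ a → a < b → μ (Ioc a b) =
      ∫⁻ x in Ioc a b, ENNReal.ofReal (jumpAverage ν μ id x) := fun a b ha hab => by
    obtain ⟨C, hC, -, -, hD⟩ := hμ.exists_Ioc_bound hν h0 b
    have hsub : Ioc a b ⊆ Ioi 0 := fun t ht => ha.trans_lt ht.1
    have hmeas : AEStronglyMeasurable (jumpAverage ν μ id) (volume.restrict (Ioc a b)) :=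
      (hcont.mono hsub).aestronglyMeasurable measurableSet_Ioc
    have h1 := tendsto_measureReal_Ioc hν h0 hμ hε hεpos hmass hΨ a b
    simp_rw [fun i => measureReal_dirichletLaw_Ioc hν (hεpos i) (hmass i) ha hab.le,
      intervalIntegral.integral_of_le hab.le] at h1
    -- The pointwise limit is integrated under the uniform bound C and compared with the weak limit
    -- of the same interval masses.
    have h2 : Tendsto (fun i => ∫ t in Ioc a b, dirichletDensity ν (ε i) t) atTop
        (𝓝 (∫ t in Ioc a b, jumpAverage ν μ id t)) := by
      refine tendsto_integral_of_dominated_convergence (fun _ => C) (fun i => ?_)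
        (integrableOn_const (by simp)) (fun i => ?_) ?_
      · rw [dirichletDensity_eq]
        exact ((hν.dirichletSystem (hεpos i) (hmass i)).continuousOn_density.mono
          fun t ht => ha.trans ht.1.le).aestronglyMeasurable measurableSet_Ioc
      · filter_upwards [ae_restrict_mem measurableSet_Ioc] with t ht
        have h3 := (hν.dirichletSystem (hεpos i) (hmass i)).density_pos (hsub ht)
        rw [← dirichletDensity_eq] at h3
        rw [Real.norm_of_nonneg h3.le]
        exact hD _ (hεpos i) (hmass i) t (hsub ht) ht.2
      · filter_upwards [ae_restrict_mem measurableSet_Ioc] with t ht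
        exact tendsto_dirichletDensity_seq hν h0 hμ hε hεpos hmass hΨ (hsub ht)
    have h3 := tendsto_nhds_unique h1 h2
    have hint : IntegrableOn (jumpAverage ν μ id) (Ioc a b) := by
      refine Integrable.mono' (g := fun _ => C) (integrableOn_const (by simp)) hmeas ?_
      filter_upwards [ae_restrict_mem measurableSet_Ioc] with t ht
      rw [Real.norm_of_nonneg (jumpAverage_nonneg t)]
      refine le_of_tendsto' (tendsto_dirichletDensity_seq hν h0 hμ hε hεpos hmass hΨ (hsub ht))
        fun i => hD _ (hεpos i) (hmass i) t (hsub ht) ht.2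
    rw [← ofReal_integral_eq_lintegral_ofReal hint
      (Eventually.of_forall fun t => jumpAverage_nonneg t), ← h3, ofReal_measureReal]
  have hneg : μ (Iic 0) = 0 := by
    rw [← Iio_union_right, measure_union_null_iff]
    refine ⟨?_, measure_singleton _⟩
    have h1 := ae_iff.1 hμ.supp
    simp only [not_le] at h1
    exact h1
  refine Measure.ext_of_Ioc _ _ fun a b hab => ?_
  rw [withDensity_apply _ measurableSet_Ioc, Measure.restrict_restrict measurableSet_Ioc]
  have hinter : Ioc a b ∩ Ioi 0 = Ioc (max a 0) b := by
    ext t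
    simp only [mem_inter_iff, mem_Ioc, mem_Ioi, max_lt_iff]
    tauto
  have hae : μ (Ioc a b) = μ (Ioc a b ∩ Ioi 0) := by
    refine measure_congr ?_
    have h1 : ∀ᵐ t ∂μ, t ∉ Iic (0 : ℝ) := measure_eq_zero_iff_ae_notMem.1 hneg
    filter_upwards [h1] with t ht
    refine propext ⟨fun h => ⟨h, Set.mem_Ioi.2 (not_le.1 ht)⟩, fun h => h.1⟩
  rw [hae, hinter]
  rcases lt_or_ge (max a 0) b with h | h
  · exact hpos _ _ (le_max_right _ _) h
  · simp [Ioc_eq_empty (not_lt.2 h)]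

end

/-! ### Poisson random measures, and the discretised process as a subordinator. -/

/-- Rows of an independent array are independent. -/
theorem iIndepFun_curry {Ω ι κ E : Type*} [MeasurableSpace Ω] [MeasurableSpace E] {P : Measure Ω}
    {X : ι → κ → Ω → E} (mX : ∀ i j, Measurable (X i j))
    (h : iIndepFun (fun (p : ι × κ) ω => X p.1 p.2 ω) P) :
    iIndepFun (fun i ω => (fun j => X i j ω)) P := by
  have := h.isProbabilityMeasure
  have : ∀ i j, IsProbabilityMeasure (P.map (X i j)) := fun i j =>
    Measure.isProbabilityMeasure_map (mX i j).aemeasurable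
  have hrow : ∀ i, iIndepFun (X i) P := fun i =>
    h.precomp (g := fun j => (i, j)) fun _ _ hj => (Prod.mk.inj hj).2
  rw [iIndepFun_iff_map_fun_eq_infinitePi_map (fun i => measurable_pi_lambda _ (mX i))]
  have h1 := (iIndepFun_iff_map_fun_eq_infinitePi_map (fun p : ι × κ => mX p.1 p.2)).1 h
  have h2 : (fun ω i j => X i j ω) = (MeasurableEquiv.curry ι κ E) ∘
      (fun ω (p : ι × κ) => X p.1 p.2 ω) := by
    ext
    rfl
  rw [h2, ← Measure.map_map (MeasurableEquiv.measurable _)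
    (measurable_pi_lambda (fun ω (p : ι × κ) => X p.1 p.2 ω) fun p => mX p.1 p.2), h1,
    Measure.infinitePi_map_curry (fun i j => P.map (X i j))]
  congr 1
  funext i
  exact ((iIndepFun_iff_map_fun_eq_infinitePi_map (mX i)).1 (hrow i)).symm

theorem integral_exp_poissonMeasure (r : ℝ≥0) (a : ℝ) :
    ∫ n, Real.exp (a * (n : ℝ)) ∂(poissonMeasure r) = Real.exp (r * (Real.exp a - 1)) := by
  rw [integral_poissonMeasure]
  have h1 : HasSum (fun n : ℕ => ((r : ℝ) * Real.exp a) ^ n / n.factorial)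
      (Real.exp (r * Real.exp a)) := by
    rw [Real.exp_eq_exp_ℝ]
    exact NormedSpace.expSeries_div_hasSum_exp _
  rw [show (r : ℝ) * (Real.exp a - 1) = -r + r * Real.exp a by ring, Real.exp_add, ← h1.tsum_eq,
    ← tsum_mul_left]
  refine tsum_congr fun n => ?_
  rw [smul_eq_mul, mul_pow, ← Real.exp_nat_mul, mul_comm a]
  ring

namespace IsPoissonRandomMeasure

variable {Ω S : Type*} [MeasurableSpace Ω] [MeasurableSpace S] {P : Measure Ω} {μ : Measure S}
  {M : Ω → Measure S}

theorem measurable_apply (hM : IsPoissonRandomMeasure P μ M) {A : Set S} (hA : MeasurableSet A) :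
    Measurable (fun ω => M ω A) :=
  (Measure.measurable_coe hA).comp hM.measurable

theorem iIndepFun (hM : IsPoissonRandomMeasure P μ M) {ι : Type*} {A : ι → Set S}
    (hA : ∀ i, MeasurableSet (A i)) (hd : Pairwise (fun i j => Disjoint (A i) (A j))) :
    ProbabilityTheory.iIndepFun (fun i ω => M ω (A i)) P := by
  refine iIndepFun_iff_finset.2 fun s => ?_
  have h := hM.indep s.card (fun i => A (s.equivFin.symm i)) (fun i => hA _)
    (fun i j hij => hd fun h => hij (s.equivFin.symm.injective (Subtype.ext h)))
  have h2 := h.precomp (g := s.equivFin) s.equivFin.injective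
  simp only [Equiv.symm_apply_apply] at h2
  exact h2

theorem ae_nat (hM : IsPoissonRandomMeasure P μ M) {A : Set S} (hA : MeasurableSet A)
    (hμ : μ A ≠ ∞) : ∀ᵐ ω ∂P, ∃ n : ℕ, M ω A = n := by
  have hc : MeasurableSet (range (fun n : ℕ => (n : ℝ≥0∞))) := (countable_range _).measurableSet
  have h1 : ∀ᵐ x ∂(P.map (fun ω => M ω A)), x ∈ range (fun n : ℕ => (n : ℝ≥0∞)) := by
    rw [hM.law A hA hμ]
    refine (ae_map_iff (p := fun x => x ∈ range (fun n : ℕ => (n : ℝ≥0∞)))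
      measurable_from_top.aemeasurable hc).2 ?_
    exact Eventually.of_forall fun n => ⟨n, rfl⟩
  filter_upwards [(ae_map_iff (p := fun x => x ∈ range (fun n : ℕ => (n : ℝ≥0∞)))
    (hM.measurable_apply hA).aemeasurable hc).1 h1] with ω hω
  obtain ⟨n, hn⟩ := hω
  exact ⟨n, hn.symm⟩

theorem integral_exp (hM : IsPoissonRandomMeasure P μ M) {A : Set S} (hA : MeasurableSet A)
    (hμ : μ A ≠ ∞) (a : ℝ) : ∫ ω, Real.exp (a * (M ω A).toReal) ∂P =
      Real.exp ((μ A).toReal * (Real.exp a - 1)) := by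
  have h1 : ∫ ω, Real.exp (a * (M ω A).toReal) ∂P =
      ∫ x : ℝ≥0∞, Real.exp (a * x.toReal) ∂(P.map (fun ω => M ω A)) := by
    rw [integral_map (hM.measurable_apply hA).aemeasurable]
    exact Measurable.aestronglyMeasurable (by fun_prop)
  rw [h1, hM.law A hA hμ, integral_map measurable_from_top.aemeasurable
    (Measurable.aestronglyMeasurable (by fun_prop))]
  simp only [ENNReal.toReal_natCast]
  rw [integral_exp_poissonMeasure]
  rfl

theorem ae_eq_zero (hM : IsPoissonRandomMeasure P μ M) {A : Set S} (hA : MeasurableSet A)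
    (hμ : μ A = 0) : ∀ᵐ ω ∂P, M ω A = 0 := by
  have h1 : ∀ᵐ x ∂(P.map (fun ω => M ω A)), x ∈ ({0} : Set ℝ≥0∞) := by
    rw [hM.law A hA (by simp [hμ]), hμ, ENNReal.toNNReal_zero]
    refine (ae_map_iff (p := fun x => x ∈ ({0} : Set ℝ≥0∞)) measurable_from_top.aemeasurable
      (measurableSet_singleton _)).2 ?_
    rw [ae_iff]
    have h2 : {n : ℕ | ¬((n : ℝ≥0∞) ∈ ({0} : Set ℝ≥0∞))} = {0}ᶜ := by
      ext n
      simp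
    have h3 : poissonMeasure 0 {0} = 1 := by
      rw [poissonMeasure_singleton]
      simp
    rw [h2]
    exact (prob_compl_eq_zero_iff (measurableSet_singleton 0)).2 h3
  exact (ae_map_iff (p := fun x => x ∈ ({0} : Set ℝ≥0∞)) (hM.measurable_apply hA).aemeasurable
    (measurableSet_singleton _)).1 h1

theorem identDistrib (hM : IsPoissonRandomMeasure P μ M) {A B : Set S} (hA : MeasurableSet A)
    (hB : MeasurableSet B) (hμ : μ A ≠ ∞) (hAB : μ A = μ B) :
    IdentDistrib (fun ω => M ω A) (fun ω => M ω B) P P where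
  aemeasurable_fst := (hM.measurable_apply hA).aemeasurable
  aemeasurable_snd := (hM.measurable_apply hB).aemeasurable
  map_eq := by rw [hM.law A hA hμ, hM.law B hB (hAB ▸ hμ), hAB]

end IsPoissonRandomMeasure

theorem IsSubordinatorLevyMeasure.sigmaFinite {ν : Measure ℝ} (hν : IsSubordinatorLevyMeasure ν) :
    SigmaFinite ν := by
  refine ⟨⟨⟨fun n => Iic 0 ∪ Ici (1 / ((n : ℝ) + 1)), fun _ => trivial, fun n => ?_, ?_⟩⟩⟩
  · refine (measure_union_le _ _).trans_lt ?_
    rw [hν.supp, zero_add]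
    exact hν.measure_Ici_lt_top (by positivity)
  · refine eq_univ_of_forall fun z => mem_iUnion.2 ?_
    rcases le_or_gt z 0 with hz | hz
    · exact ⟨0, Or.inl hz⟩
    · obtain ⟨n, hn⟩ := exists_nat_one_div_lt hz
      exact ⟨n, Or.inr hn.le⟩

theorem jumpIntensity_prod {ν : Measure ℝ} (hν : IsSubordinatorLevyMeasure ν) {J B : Set ℝ}
    (hJ : J ⊆ Ici 0) : jumpIntensity ν (J ×ˢ B) = volume J * ν B := by
  have := hν.sigmaFinite
  rw [jumpIntensity, hν.restrict_Ioi, Measure.prod_prod, Measure.restrict_apply' measurableSet_Ici,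
    inter_eq_left.2 hJ]

/-- The random measure on the time axis whose mass on `J` is the total size of the jumps in `J`
that are discretised to a positive multiple of `ε`. -/
noncomputable def jumpMeasure (m : Measure (ℝ × ℝ)) (ε : ℝ) : Measure ℝ :=
  ((m.restrict (univ ×ˢ Ici ε)).withDensity
    (fun p => ENNReal.ofReal (ε * (⌊p.2 / ε⌋ : ℤ)))).map Prod.fst

theorem jumpMeasure_apply (m : Measure (ℝ × ℝ)) (ε : ℝ) {J : Set ℝ} (hJ : MeasurableSet J) :
    jumpMeasure m ε J = ∫⁻ p in J ×ˢ Ici ε, ENNReal.ofReal (ε * (⌊p.2 / ε⌋ : ℤ)) ∂m := by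
  have h1 : MeasurableSet (Prod.fst ⁻¹' J : Set (ℝ × ℝ)) := measurable_fst hJ
  rw [jumpMeasure, Measure.map_apply measurable_fst hJ, withDensity_apply _ h1,
    Measure.restrict_restrict h1]
  congr 2
  ext p
  simp

theorem discretisedProcess_eq {Ω : Type*} (M : Ω → Measure (ℝ × ℝ)) (ε : ℝ) (t : ℝ≥0) (ω : Ω) :
    discretisedProcess M ε t ω = (jumpMeasure (M ω) ε (Icc 0 t)).toReal := by
  rw [discretisedProcess, jumpMeasure_apply _ _ measurableSet_Icc]

/-- The bin of jump sizes that are discretised to `ε (k + 1)`. -/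
def jumpBin (ε : ℝ) (k : ℕ) : Set ℝ := Ico (ε * ((k + 1 : ℕ) : ℝ)) (ε * ((k + 1 : ℕ) + 1))

theorem pairwise_disjoint_jumpBin {ε : ℝ} (hε : 0 < ε) :
    Pairwise (fun i j : ℕ => Disjoint (jumpBin ε i) (jumpBin ε j)) := fun _ _ hij =>
  pairwise_disjoint_Ico_mul hε fun h => hij (Nat.succ_injective h)

/-- The total of the discretised jumps, as a function of the number of jumps in each bin. -/
noncomputable def jumpTotal (ε : ℝ) (v : ℕ → ℝ≥0∞) : ℝ≥0∞ :=
  ∑' k : ℕ, ENNReal.ofReal (ε * ((k + 1 : ℕ) : ℝ)) * v k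

theorem measurable_jumpTotal (ε : ℝ) : Measurable (jumpTotal ε) :=
  Measurable.tsum fun k => (measurable_pi_apply k).const_mul _

/-- The rounded jump size is constant on each bin. Measurability, laws and independence of the
process thereby reduce to those of countably many bin counts. -/
theorem jumpMeasure_eq_jumpTotal (m : Measure (ℝ × ℝ)) {ε : ℝ} (hε : 0 < ε) {J : Set ℝ}
    (hJ : MeasurableSet J) :
    jumpMeasure m ε J = jumpTotal ε (fun k => m (J ×ˢ jumpBin ε k)) := by
  have h1 : J ×ˢ Ici ε = ⋃ k, J ×ˢ jumpBin ε k := by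
    rw [← prod_iUnion, ← iUnion_Ico_mul_succ hε]
    rfl
  have hm : ∀ k, MeasurableSet (J ×ˢ jumpBin ε k) := fun k => hJ.prod measurableSet_Ico
  rw [jumpMeasure_apply _ _ hJ, h1, lintegral_iUnion hm
    (fun i j hij => Disjoint.set_prod_right (pairwise_disjoint_jumpBin hε hij) _ _)]
  refine tsum_congr fun k => ?_
  rw [setLIntegral_congr_fun (g := fun _ => ENNReal.ofReal (ε * ((k + 1 : ℕ) : ℝ))) (hm k)
    (fun p hp => by rw [mul_floor_eq_of_mem_Ico hε hp.2]), setLIntegral_const]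

/-- Right-continuity is continuity of a measure from above, whence the finiteness hypothesis. -/
theorem jumpMeasure_continuousWithinAt (m : Measure (ℝ × ℝ)) {ε : ℝ}
    (h : ∀ n : ℕ, jumpMeasure m ε (Icc 0 n) ≠ ∞) (t : ℝ≥0) :
    ContinuousWithinAt (fun s : ℝ≥0 => (jumpMeasure m ε (Icc 0 s)).toReal) (Ici t) t := by
  have hfin : ∀ s : ℝ≥0, jumpMeasure m ε (Icc 0 (s : ℝ)) ≠ ∞ := fun s => by
    obtain ⟨n, hn⟩ := exists_nat_ge (s : ℝ)
    exact ne_top_of_le_ne_top (h n) (measure_mono (Icc_subset_Icc_right hn))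
  rw [← continuousWithinAt_Ioi_iff_Ici]
  refine (ENNReal.tendsto_toReal (hfin t)).comp ?_
  have h1 := tendsto_measure_biInter_gt (μ := jumpMeasure m ε)
    (s := fun s : ℝ≥0 => Icc (0 : ℝ) s) (a := t)
    (fun _ _ => measurableSet_Icc.nullMeasurableSet)
    (fun i j _ hij => Icc_subset_Icc_right (NNReal.coe_le_coe.2 hij))
    ⟨t + 1, lt_add_one t, hfin _⟩
  have h2 : ⋂ r : ℝ≥0, ⋂ (_ : r > t), Icc (0 : ℝ) r = Icc 0 (t : ℝ) := by
    ext x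
    simp only [mem_iInter, mem_Icc]
    constructor
    · intro hx
      have h0 := (hx (t + 1) (lt_add_one t)).1
      refine ⟨h0, ?_⟩
      lift x to ℝ≥0 using h0
      exact NNReal.coe_le_coe.2 (le_of_forall_gt_imp_ge_of_dense fun r hr =>
        NNReal.coe_le_coe.1 (hx r hr).2)
    · exact fun hx r hr => ⟨hx.1, hx.2.trans (NNReal.coe_le_coe.2 hr.le)⟩
  rwa [h2] at h1

theorem toReal_jumpMeasure_sub (m : Measure (ℝ × ℝ)) {ε : ℝ}
    (h : ∀ n : ℕ, jumpMeasure m ε (Icc 0 n) ≠ ∞) {s t : ℝ≥0} (hst : s ≤ t) :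
    (jumpMeasure m ε (Icc 0 t)).toReal - (jumpMeasure m ε (Icc 0 s)).toReal =
      (jumpMeasure m ε (Ioc s t)).toReal := by
  have hst' : (s : ℝ) ≤ t := NNReal.coe_le_coe.2 hst
  obtain ⟨n, hn⟩ := exists_nat_ge (t : ℝ)
  have hfin : jumpMeasure m ε (Icc 0 (t : ℝ)) ≠ ∞ :=
    ne_top_of_le_ne_top (h n) (measure_mono (Icc_subset_Icc_right hn))
  have h1 : Icc (0 : ℝ) t = Icc 0 (s : ℝ) ∪ Ioc (s : ℝ) t :=
    (Icc_union_Ioc_eq_Icc s.coe_nonneg hst').symm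
  have hd : Disjoint (Icc (0 : ℝ) s) (Ioc (s : ℝ) t) :=
    Set.disjoint_left.2 fun x hx hx' => hx.2.not_gt hx'.1
  have h2 : jumpMeasure m ε (Icc 0 (t : ℝ)) =
      jumpMeasure m ε (Icc 0 (s : ℝ)) + jumpMeasure m ε (Ioc (s : ℝ) t) := by
    rw [h1, measure_union hd measurableSet_Ioc]
  have h3 := ENNReal.add_ne_top.1 (h2 ▸ hfin)
  rw [h2, ENNReal.toReal_add h3.1 h3.2]
  ring

section

variable {Ω : Type*} [MeasurableSpace Ω] {P : Measure Ω} {ν : Measure ℝ}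
  {M : Ω → Measure (ℝ × ℝ)} {ε : ℝ}

theorem IsPoissonRandomMeasure.measurable_jumpMeasure
    (hM : IsPoissonRandomMeasure P (jumpIntensity ν) M) (hε : 0 < ε) {J : Set ℝ}
    (hJ : MeasurableSet J) : Measurable (fun ω => jumpMeasure (M ω) ε J) := by
  simp_rw [jumpMeasure_eq_jumpTotal _ hε hJ]
  exact (measurable_jumpTotal ε).comp
    (measurable_pi_lambda _ fun k => hM.measurable_apply (hJ.prod measurableSet_Ico))

theorem jumpIntensity_prod_jumpBin_ne_top (hν : IsSubordinatorLevyMeasure ν) (hε : 0 < ε)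
    {J : Set ℝ} (hJ : J ⊆ Ici 0) (hJv : volume J ≠ ∞) (k : ℕ) :
    jumpIntensity ν (J ×ˢ jumpBin ε k) ≠ ∞ := by
  rw [jumpIntensity_prod hν hJ]
  refine ENNReal.mul_ne_top hJv (ne_top_of_le_ne_top (hν.measure_Ici_lt_top hε).ne
    (measure_mono ?_))
  rw [← iUnion_Ico_mul_succ hε]
  exact subset_iUnion (jumpBin ε) k

/-- The expected total may be infinite, so a first-moment argument is not available. Instead the bin
counts are integers with a finite sum, hence all but finitely many vanish. -/
theorem IsPoissonRandomMeasure.ae_jumpMeasure_ne_top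
    (hM : IsPoissonRandomMeasure P (jumpIntensity ν) M) (hν : IsSubordinatorLevyMeasure ν)
    (hε : 0 < ε) : ∀ᵐ ω ∂P, ∀ n : ℕ, jumpMeasure (M ω) ε (Icc 0 n) ≠ ∞ := by
  refine ae_all_iff.2 fun n => ?_
  have hJ : Icc (0 : ℝ) n ⊆ Ici 0 := Icc_subset_Ici_self
  have hJv : volume (Icc (0 : ℝ) n) ≠ ∞ := by simp
  have h1 : ∀ᵐ ω ∂P, ∃ N : ℕ, M ω (Icc (0 : ℝ) n ×ˢ Ici ε) = N := by
    refine hM.ae_nat (measurableSet_Icc.prod measurableSet_Ici) ?_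
    rw [jumpIntensity_prod hν hJ]
    exact ENNReal.mul_ne_top hJv (hν.measure_Ici_lt_top hε).ne
  have h2 : ∀ᵐ ω ∂P, ∀ k, ∃ N : ℕ, M ω (Icc (0 : ℝ) n ×ˢ jumpBin ε k) = N :=
    ae_all_iff.2 fun k => hM.ae_nat (measurableSet_Icc.prod measurableSet_Ico)
      (jumpIntensity_prod_jumpBin_ne_top hν hε hJ hJv k)
  filter_upwards [h1, h2] with ω ⟨N, hN⟩ hω
  have h3 : ∑' k, M ω (Icc (0 : ℝ) n ×ˢ jumpBin ε k) ≠ ∞ := by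
    have h4 : Icc (0 : ℝ) n ×ˢ Ici ε = ⋃ k, Icc (0 : ℝ) n ×ˢ jumpBin ε k := by
      rw [← prod_iUnion, ← iUnion_Ico_mul_succ hε]
      rfl
    rw [← measure_iUnion (fun i j hij => Disjoint.set_prod_right
      (pairwise_disjoint_jumpBin hε hij) _ _) (fun k => measurableSet_Icc.prod measurableSet_Ico),
      ← h4, hN]
    exact ENNReal.natCast_ne_top N
  have h5 : ∀ᶠ k in atTop, M ω (Icc (0 : ℝ) n ×ˢ jumpBin ε k) = 0 := by
    filter_upwards [(ENNReal.tendsto_atTop_zero_of_tsum_ne_top h3).eventually_lt_const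
      zero_lt_one] with k hk
    obtain ⟨K, hK⟩ := hω k
    rw [hK] at hk ⊢
    have : K < 1 := by exact_mod_cast hk
    simp [Nat.lt_one_iff.1 this]
  obtain ⟨K, hK⟩ := eventually_atTop.1 h5
  rw [jumpMeasure_eq_jumpTotal _ hε measurableSet_Icc, jumpTotal,
    tsum_eq_sum (s := Finset.range K)
      (fun k hk => by rw [hK k (not_lt.1 (Finset.mem_range.not.1 hk)), mul_zero])]
  refine ENNReal.sum_ne_top.2 fun k _ => ENNReal.mul_ne_top ENNReal.ofReal_ne_top ?_
  obtain ⟨L, hL⟩ := hω k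
  rw [hL]
  exact ENNReal.natCast_ne_top L

/-- The counts over all rectangles (time interval) × (bin) form an independent array, and each
increment is a function of one row. -/
theorem IsPoissonRandomMeasure.hasIndepIncrements_discretisedProcess
    (hM : IsPoissonRandomMeasure P (jumpIntensity ν) M) (hν : IsSubordinatorLevyMeasure ν)
    (hε : 0 < ε) : HasIndepIncrements (discretisedProcess M ε) P := by
  intro n t ht
  have h1 : ∀ i : Fin n, (fun ω => (jumpTotal ε (fun k =>
      M ω (Ioc (t i.castSucc : ℝ) (t i.succ) ×ˢ jumpBin ε k))).toReal) =ᵐ[P]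
      fun ω => discretisedProcess M ε (t i.succ) ω - discretisedProcess M ε (t i.castSucc) ω := by
    intro i
    filter_upwards [hM.ae_jumpMeasure_ne_top hν hε] with ω hω
    rw [discretisedProcess_eq, discretisedProcess_eq,
      toReal_jumpMeasure_sub _ hω (ht (Fin.castSucc_le_succ i)),
      jumpMeasure_eq_jumpTotal _ hε measurableSet_Ioc]
  refine iIndepFun.congr h1 ?_
  have hm : ∀ (i : Fin n) (k : ℕ),
      MeasurableSet (Ioc (t i.castSucc : ℝ) (t i.succ) ×ˢ jumpBin ε k) :=
    fun i k => measurableSet_Ioc.prod measurableSet_Ico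
  have hdisj : ∀ i j : Fin n, i < j → Disjoint (Ioc (t i.castSucc : ℝ) (t i.succ))
      (Ioc (t j.castSucc : ℝ) (t j.succ)) := fun i j hij => by
    refine Set.disjoint_left.2 fun x hx hx' => hx'.1.not_ge (hx.2.trans ?_)
    exact NNReal.coe_le_coe.2 (ht (Fin.le_def.2 (by simpa using Fin.lt_def.1 hij)))
  have h2 := hM.iIndepFun (A := fun p : Fin n × ℕ =>
    Ioc (t p.1.castSucc : ℝ) (t p.1.succ) ×ˢ jumpBin ε p.2) (fun p => hm p.1 p.2) (by
      rintro ⟨i, k⟩ ⟨j, l⟩ hne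
      rcases lt_trichotomy i j with hij | rfl | hij
      · exact Disjoint.set_prod_left (hdisj i j hij) _ _
      · exact Disjoint.set_prod_right
          (pairwise_disjoint_jumpBin hε fun h => hne (congrArg (Prod.mk i) h)) _ _
      · exact Disjoint.set_prod_left (hdisj j i hij).symm _ _)
  exact (iIndepFun_curry (X := fun (i : Fin n) (k : ℕ) ω =>
    M ω (Ioc (t i.castSucc : ℝ) (t i.succ) ×ˢ jumpBin ε k))
    (fun i k => hM.measurable_apply (hm i k)) h2).comp
    (fun _ v => (jumpTotal ε v).toReal) (fun _ => (measurable_jumpTotal ε).ennreal_toReal)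

theorem IsPoissonRandomMeasure.iIndepFun_jumpBin
    (hM : IsPoissonRandomMeasure P (jumpIntensity ν) M) (hε : 0 < ε) {J : Set ℝ}
    (hJ : MeasurableSet J) :
    ProbabilityTheory.iIndepFun (fun k ω => M ω (J ×ˢ jumpBin ε k)) P :=
  hM.iIndepFun (fun _ => hJ.prod measurableSet_Ico)
    fun _ _ hij => Disjoint.set_prod_right (pairwise_disjoint_jumpBin hε hij) _ _

/-- The bin counts over (s, s + t] and over [0, t] are independent sequences with the same Poisson
means, since both time sets have length t. -/
theorem IsPoissonRandomMeasure.identDistrib_discretisedProcess_sub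
    (hM : IsPoissonRandomMeasure P (jumpIntensity ν) M) (hν : IsSubordinatorLevyMeasure ν)
    (hε : 0 < ε) (s t : ℝ≥0) :
    IdentDistrib (fun ω => discretisedProcess M ε (s + t) ω - discretisedProcess M ε s ω)
      (discretisedProcess M ε t) P P := by
  have hJ : Ioc (s : ℝ) ((s + t : ℝ≥0) : ℝ) ⊆ Ici 0 :=
    fun x hx => s.coe_nonneg.trans hx.1.le
  have hJ' : Icc (0 : ℝ) t ⊆ Ici 0 := Icc_subset_Ici_self
  have h1 : IdentDistrib
      (fun ω k => M ω (Ioc (s : ℝ) ((s + t : ℝ≥0) : ℝ) ×ˢ jumpBin ε k))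
      (fun ω k => M ω (Icc (0 : ℝ) t ×ˢ jumpBin ε k)) P P := by
    refine IdentDistrib.pi (fun k => ?_) (hM.iIndepFun_jumpBin hε measurableSet_Ioc)
      (hM.iIndepFun_jumpBin hε measurableSet_Icc)
    refine hM.identDistrib (measurableSet_Ioc.prod measurableSet_Ico)
      (measurableSet_Icc.prod measurableSet_Ico)
      (jumpIntensity_prod_jumpBin_ne_top hν hε hJ (by simp) k) ?_
    rw [jumpIntensity_prod hν hJ, jumpIntensity_prod hν hJ']
    simp
  have h2 := h1.comp (measurable_jumpTotal ε).ennreal_toReal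
  have h3 : (fun ω => discretisedProcess M ε (s + t) ω - discretisedProcess M ε s ω) =ᵐ[P]
      (fun v => (jumpTotal ε v).toReal) ∘
        fun ω k => M ω (Ioc (s : ℝ) ((s + t : ℝ≥0) : ℝ) ×ˢ jumpBin ε k) := by
    filter_upwards [hM.ae_jumpMeasure_ne_top hν hε] with ω hω
    rw [discretisedProcess_eq, discretisedProcess_eq,
      toReal_jumpMeasure_sub _ hω (le_add_of_nonneg_right zero_le),
      jumpMeasure_eq_jumpTotal _ hε measurableSet_Ioc]
    rfl
  have h4 : discretisedProcess M ε t = (fun v => (jumpTotal ε v).toReal) ∘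
      fun ω k => M ω (Icc (0 : ℝ) t ×ˢ jumpBin ε k) := by
    funext ω
    rw [discretisedProcess_eq, jumpMeasure_eq_jumpTotal _ hε measurableSet_Icc]
    rfl
  rw [h4]
  exact (IdentDistrib.of_ae_eq h2.aemeasurable_fst h3.symm).symm.trans h2

/-- For finitely many bins the Laplace transform is a product of Poisson ones; both sides then pass
to the limit over the bins. -/
theorem IsPoissonRandomMeasure.integral_exp_discretisedProcess [IsProbabilityMeasure P]
    (hM : IsPoissonRandomMeasure P (jumpIntensity ν) M) (hν : IsSubordinatorLevyMeasure ν)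
    (hε : 0 < ε) (t : ℝ≥0) {u : ℝ} (hu : 0 ≤ u) :
    ∫ ω, Real.exp (-u * discretisedProcess M ε t ω) ∂P =
      Real.exp (-(t : ℝ) * laplaceExponent (discretisedLevyMeasure ν ε) u) := by
  have hJ : Icc (0 : ℝ) t ⊆ Ici 0 := Icc_subset_Ici_self
  have hA : ∀ k, MeasurableSet (Icc (0 : ℝ) t ×ˢ jumpBin ε k) :=
    fun k => measurableSet_Icc.prod measurableSet_Ico
  set f : ℕ → Ω → ℝ := fun k ω =>
    ε * ((k + 1 : ℕ) : ℝ) * (M ω (Icc (0 : ℝ) t ×ˢ jumpBin ε k)).toReal with hf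
  have hfm : ∀ k, Measurable (f k) := fun k =>
    (hM.measurable_apply (hA k)).ennreal_toReal.const_mul _
  have hf0 : ∀ k ω, 0 ≤ f k ω := fun k ω => by positivity
  have hind : ProbabilityTheory.iIndepFun f P :=
    (hM.iIndepFun_jumpBin hε measurableSet_Icc).comp
      (fun k v => ε * ((k + 1 : ℕ) : ℝ) * v.toReal) (fun k => by fun_prop)
  have hlim : ∀ᵐ ω ∂P, Tendsto (fun K => ∑ k ∈ Finset.range K, f k ω) atTop
      (𝓝 (discretisedProcess M ε t ω)) := by
    filter_upwards [hM.ae_jumpMeasure_ne_top hν hε] with ω hω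
    obtain ⟨n, hn⟩ := exists_nat_ge (t : ℝ)
    have h1 : jumpMeasure (M ω) ε (Icc 0 (t : ℝ)) ≠ ∞ :=
      ne_top_of_le_ne_top (hω n) (measure_mono (Icc_subset_Icc_right hn))
    rw [discretisedProcess_eq]
    rw [jumpMeasure_eq_jumpTotal _ hε measurableSet_Icc, jumpTotal] at h1 ⊢
    rw [ENNReal.tsum_toReal_eq (ENNReal.ne_top_of_tsum_ne_top h1)]
    convert (ENNReal.summable_toReal h1).hasSum.tendsto_sum_nat using 4 with K k
    rw [ENNReal.toReal_mul, ENNReal.toReal_ofReal (by positivity)]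
  have hint : ∀ K, ∫ ω, Real.exp (-u * ∑ k ∈ Finset.range K, f k ω) ∂P =
      Real.exp (-(t : ℝ) * ∑ k ∈ Finset.range K, binMass ν ε (k + 1) *
        (1 - Real.exp (-u * (ε * ((k + 1 : ℕ) : ℝ))))) := by
    intro K
    have h1 := hind.mgf_sum (t := -u) hfm (Finset.range K)
    simp only [mgf, Finset.sum_apply] at h1
    rw [h1, Finset.mul_sum, Real.exp_sum]
    refine Finset.prod_congr rfl fun k _ => ?_
    have h2 := hM.integral_exp (hA k)
      (jumpIntensity_prod_jumpBin_ne_top hν hε hJ (by simp) k) (-u * (ε * ((k + 1 : ℕ) : ℝ)))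
    simp only [hf, ← mul_assoc] at h2 ⊢
    rw [h2, jumpIntensity_prod hν hJ, ENNReal.toReal_mul]
    simp only [Real.volume_Icc, sub_zero, ENNReal.toReal_ofReal t.coe_nonneg, binMass, jumpBin]
    congr 1
    ring
  refine tendsto_nhds_unique (f := fun K =>
    ∫ ω, Real.exp (-u * ∑ k ∈ Finset.range K, f k ω) ∂P) (l := atTop) ?_ ?_
  · refine tendsto_integral_of_dominated_convergence (fun _ => 1) (fun K => ?_)
      (integrable_const _) (fun K => ?_) ?_
    · exact (Real.measurable_exp.comp ((Finset.measurable_fun_sum _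
        fun k _ => hfm k).const_mul _)).aestronglyMeasurable
    · refine Eventually.of_forall fun ω => ?_
      rw [Real.norm_eq_abs, Real.abs_exp, Real.exp_le_one_iff]
      have := Finset.sum_nonneg (s := Finset.range K) fun k _ => hf0 k ω
      nlinarith
    · filter_upwards [hlim] with ω hω
      exact (Real.continuous_exp.tendsto _).comp (hω.const_mul _)
  · simp_rw [hint]
    exact (Real.continuous_exp.tendsto _).comp
      ((laplaceExponent_discretised hν hε hu).tendsto_sum_nat.const_mul _)

theorem IsPoissonRandomMeasure.isPureJumpSubordinator_discretisedProcess [IsProbabilityMeasure P]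
    (hM : IsPoissonRandomMeasure P (jumpIntensity ν) M) (hν : IsSubordinatorLevyMeasure ν)
    (hε : 0 < ε) :
    IsPureJumpSubordinator P (discretisedLevyMeasure ν ε) (discretisedProcess M ε) where
  levyMeasure := isSubordinatorLevyMeasure_discretised hν hε
  measurable t := by
    have h1 := (hM.measurable_jumpMeasure hε (measurableSet_Icc (a := (0 : ℝ))
      (b := (t : ℝ)))).ennreal_toReal
    have h2 : discretisedProcess M ε t = fun ω => (jumpMeasure (M ω) ε (Icc 0 t)).toReal :=
      funext fun ω => discretisedProcess_eq M ε t ω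
    rwa [h2]
  zero := by
    have h1 : ∀ᵐ ω ∂P, ∀ k, M ω (Icc (0 : ℝ) 0 ×ˢ jumpBin ε k) = 0 :=
      ae_all_iff.2 fun k => hM.ae_eq_zero (measurableSet_Icc.prod measurableSet_Ico) (by
        rw [jumpIntensity_prod hν Icc_subset_Ici_self]
        simp)
    filter_upwards [h1] with ω hω
    rw [discretisedProcess_eq, NNReal.coe_zero,
      jumpMeasure_eq_jumpTotal _ hε measurableSet_Icc, jumpTotal]
    simp only [hω, mul_zero, tsum_zero, ENNReal.toReal_zero]
  paths := by
    filter_upwards [hM.ae_jumpMeasure_ne_top hν hε] with ω hω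
    simp_rw [discretisedProcess_eq]
    refine ⟨fun s t hst => sub_nonneg.1 ?_, jumpMeasure_continuousWithinAt _ hω⟩
    simp only
    rw [toReal_jumpMeasure_sub _ hω hst]
    exact ENNReal.toReal_nonneg
  indep := hM.hasIndepIncrements_discretisedProcess hν hε
  stationary := hM.identDistrib_discretisedProcess_sub hν hε
  laplace t _ hu := hM.integral_exp_discretisedProcess hν hε t hu

end

/-! ### Identification of the densities and the main theorem. -/

/-- A continuous density of the real-valued version of an almost surely finite random variable is
a continuous density of the variable. -/
theorem isContinuousDensity_of_map_toReal {Ω : Type*} [MeasurableSpace Ω] {P : Measure Ω}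
    {I : Ω → ℝ≥0∞} {φ : ℝ → ℝ} (hI : AEMeasurable I P) (hfin : ∀ᵐ ω ∂P, I ω ≠ ∞)
    (hc : ContinuousOn φ (Ioi 0)) (h0 : ∀ x, 0 < x → 0 ≤ φ x)
    (hlaw : P.map (fun ω => (I ω).toReal) = (volume.restrict (Ioi (0 : ℝ))).withDensity
      (fun x => ENNReal.ofReal (φ x))) : IsContinuousDensity P I φ where
  aemeasurable := hI
  continuousOn := hc
  nonneg := h0
  law := by
    rw [← hlaw, AEMeasurable.map_map_of_aemeasurable ENNReal.measurable_ofReal.aemeasurable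
      hI.ennreal_toReal]
    refine Measure.map_congr ?_
    filter_upwards [hfin] with ω hω
    exact (ENNReal.ofReal_toReal hω).symm

/-- The exponential functional and the Dirichlet law have the same moments, and these determine the
law. -/
theorem IsPoissonRandomMeasure.isContinuousDensity_discretisedProcess {Ω : Type*}
    [MeasurableSpace Ω] {P : Measure Ω} [IsProbabilityMeasure P] {ν : Measure ℝ}
    {M : Ω → Measure (ℝ × ℝ)} {ε : ℝ} (hM : IsPoissonRandomMeasure P (jumpIntensity ν) M)
    (hν : IsSubordinatorLevyMeasure ν) (hε : 0 < ε) (h0 : 0 < ν (Ici ε)) :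
    IsContinuousDensity P (expFunctional (discretisedProcess M ε)) (dirichletDensity ν ε) := by
  have hν' := isSubordinatorLevyMeasure_discretised hν hε
  have hne := discretisedLevyMeasure_ne_zero h0
  have hD := hν.dirichletSystem hε h0
  obtain ⟨hI, hfin, hmom⟩ :=
    (hM.isPureJumpSubordinator_discretisedProcess hν hε).hasMoments hne
  have hpos := hν'.laplaceExponent_pos hne one_pos
  refine isContinuousDensity_of_map_toReal hI hfin ?_ ?_ ?_
  · rw [dirichletDensity_eq]
    exact hD.continuousOn_density.mono Ioi_subset_Ici_self
  · rw [dirichletDensity_eq]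
    exact fun x hx => (hD.density_pos hx).le
  · exact hmom.unique (hasMoments_dirichletLaw hν hε h0) (inv_nonneg.2 hpos.le)
      fun n => expFunctionalMoment_le hν' hpos le_rfl n

theorem mainTheorem4 {Ω : Type*} [MeasurableSpace Ω] (P : Measure Ω) [IsProbabilityMeasure P]
    (ν : Measure ℝ) (hν : ν ≠ 0) (X : ℝ≥0 → Ω → ℝ) (hX : IsPureJumpSubordinator P ν X) :
    -- the law of `I_{[X]}` has a continuous density `φ` on `(0, ∞)`
    ∃ φ : ℝ → ℝ, IsContinuousDensity P (expFunctional X) φ ∧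
      -- for every admissible `ε`, the series converge and give the density of `I_{[X^{(ε)}]}`
      (∀ ε : ℝ, 0 < ε → ε < 1 → 0 < ν (Ici ε) →
        Summable (fun k : ℕ => binMass ν ε (k + 1)) ∧ 0 < totalBinMass ν ε ∧
        Summable (fun j : ℕ => dirichletCoeff ν ε j * Real.exp (-ε * j)) ∧
        (∑' j : ℕ, dirichletCoeff ν ε j * Real.exp (-ε * j)) ≠ 0 ∧
        (∀ x : ℝ, 0 < x → Summable (fun j : ℕ =>
          dirichletCoeff ν ε j * Real.exp (-Real.exp (ε * j) * x * totalBinMass ν ε))) ∧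
        ∀ {Ω' : Type*} [MeasurableSpace Ω'] (P' : Measure Ω') [IsProbabilityMeasure P']
          (M : Ω' → Measure (ℝ × ℝ)), IsPoissonRandomMeasure P' (jumpIntensity ν) M →
          IsContinuousDensity P' (expFunctional (discretisedProcess M ε))
            (dirichletDensity ν ε)) ∧
      -- the densities converge pointwise
      ∀ x : ℝ, 0 < x → Tendsto (fun ε => dirichletDensity ν ε x) (𝓝[>] 0) (𝓝 (φ x)) := by
  have hL := hX.levyMeasure
  obtain ⟨hI, hfin, hmom⟩ := hX.hasMoments hν
  -- The density is the stationarity average of the law of the exponential functional itself.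
  refine ⟨jumpAverage ν (P.map fun ω => (expFunctional X ω).toReal) id,
    isContinuousDensity_of_map_toReal hI hfin (hmom.continuousOn_jumpAverage hL hν)
      (fun x _ => jumpAverage_nonneg x) (hmom.eq_withDensity hL hν),
    fun ε hε _ h0 => ?_, fun x hx => tendsto_dirichletDensity hL hν hmom hx⟩
  have hD := hL.dirichletSystem hε h0
  have h1 : (fun j : ℕ => dirichletCoeff ν ε j * Real.exp (-ε * j)) =
      fun j => dirichletCoeff ν ε j * (Real.exp (-ε) ^ j) ^ 1 := by
    funext j
    rw [pow_one, exp_neg_pow]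
  refine ⟨(hL.hasSum_binMass hε).summable, hL.totalBinMass_pos hε h0, ?_, ?_, fun x hx => ?_,
    fun P' _ M hM => hM.isContinuousDensity_discretisedProcess hL hε h0⟩
  · rw [h1]
    exact hD.summable_powSum 1
  · rw [h1]
    exact hD.powSum_one_pos.ne'
  · refine (hD.summable_series hx.le).congr fun j => ?_
    rw [exp_neg_pow, ← Real.exp_neg, neg_mul ε, neg_neg]
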